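/- Let $2\le n\le 4$ and $\alpha_1,\dots,\alpha_n\in\mathbb{Q}$. For a field $k$ and distinct points $P_1,\dots,P_n\in\mathbb{P}^1(k)$ put $D=\sum_i\alpha_iP_i$ and $$S_D=\bigoplus_{d\ge 0}u^dH^0(\mathbb{P}^1,\lfloor dD\rfloor)\subset k(t)[u],$$ and let $t_i$ be a section of $O(1)$ vanishing only at $P_i$ (unique up to scaling). *Stable systems.* Put $r_e=\sum_i\lfloor e\alpha_i\rfloor$. A finite sequence of monomials $g_a=u^{d_a}\prod_i t_i^{c_{a,i}}$ ($1\le a\le N$; $d_a\ge 1$, $\sum_i c_{a,i}=0$, $c_{a,i}\ge -d_a\alpha_i$) with $d_1\le\dots\le d_N$ is called a stable system for $\alpha$ if every degree $e\ge 1$ satisfies the following condition, which involves only $\alpha$. Let $\mathcal F_e$ be the family of all sets $A_c=\{i:\lfloor c\alpha_i\rfloor+\lfloor (e-c)\alpha_i\rfloor\ne\lfloor e\alpha_i\rfloor\}$ with $1\le c\le e/2$, $r_c\ge 0$, $r_{e-c}\ge 0$. By repeatedly replacing two distinct members $A,B$ with $|A\cup B|\le r_e+1$ by $A\cap B$, one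 can reach from $\mathcal F_e$ a family $\mathcal F$ admitting no further replacement, an index $j$, and a set of integers $M$ such that one of the following holds (with $r=r_e$): - $\mathcal F=\emptyset$ and $M=\{0,1,\dots,r\}$ (empty if $r<0$); - $\mathcal F=\{\emptyset\}$ and $M=\emptyset$; - $\mathcal F=\{A\}$, $j\in A$, and $M=\{0\}\cup\{r-|A|+2,\dots,r\}$; - $\mathcal F=\{A,B\}$, $|B|=r$, $j\in A\setminus B$, and $M=\{r-|A|+2,\dots,r\}$; and such that the $g_a$ with $d_a=e$, in their given order, have strictly decreasing orders of vanishing $c_{a,j}+\lfloor e\alpha_j\rfloor$ at $P_j$ (as sections of $O(\lfloor eD\rfloor)$), the set of these orders being $M$. *Order and Gröbner bases.* In $k[x_1,\dots,x_N]$ write each monomial as the word of its variables in increasing order of index, and let $\prec$ be the dictionary order of these words, e.g. $x_1\prec x_1^4\prec x_1^2x_3\prec x_1x_2^2\prec x_2$. The initial term of $f\ne 0$ is its largest term; $\mathrm{in}_\prec I$ is the $k$-span of the initial terms of elements of $I$. A Gröbner basis of $I$ is a generating set of $I$ whose initial terms form a minimal system of generators of the ideal $\mathrm{in}_\prec I$.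 **Theorem.** Stable systems for $\alpha$ exist. Let $(g_1,\dots,g_N)$ be any stable system for $\alpha$. For every field $k$, all distinct $P_1,\dots,P_n\in\mathbb{P}^1(k)$ and all choices of the $t_i$, the elements $g_1,\dots,g_N$ form a minimal generating set of the $k$-algebra $S_D$. Moreover there is a finite set $L\subset\mathbb{Z}_{\ge 0}^N$, independent of the field $k$ (in particular of its characteristic), of the points $P_i$ and of the choice of the $t_i$, such that for all such data the relation ideal $I=\ker\big(k[x_1,\dots,x_N]\to S_D,\ x_a\mapsto g_a\big)$ has a Gröbner basis with respect to $\prec$ whose initial terms are exactly the monomials $x^m$, $m\in L$. -/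

import Mathlib

open scoped WithZero Polynomial

universe u

noncomputable section

namespace QDiv

/-! ## Divisors on the projective line and the canonical ring -/

section Geometry

variable (k : Type u) [Field k]

/-- The closed points of the projective line over `k`, with function field `k(t)`:
the maximal ideals of `k[t]`, and the point at infinity (`none`). -/
abbrev ClosedPoint : Type u := Option (IsDedekindDomain.HeightOneSpectrum k[X])

variable {k}

open Classical in
/-- The valuation of `k(t)` at a closed point; `f` has a pole of order at most `m` at `x`
(equivalently, vanishes to order at least `-m`) iff `val x f ≤ exp m`. -/
def val : ClosedPoint k → Valuation (RatFunc k) ℤᵐ⁰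
  | none => RatFunc.inftyValuation k
  | some v => v.valuation (RatFunc k)

/-- The closed point attached to a `k`-rational point of the projective line, an element of
`k ∪ {∞}`: the maximal ideal `(t - a)`, or the point at infinity. -/
def rationalPoint : OnePoint k → ClosedPoint k
  | none => none
  | some a => some
      { asIdeal := Ideal.span {Polynomial.X - Polynomial.C a}
        isPrime := (Ideal.span_singleton_prime (Polynomial.X_sub_C_ne_zero a)).2
          (Polynomial.prime_X_sub_C a)
        ne_bot := by
          simpa [Ideal.span_singleton_eq_bot] using Polynomial.X_sub_C_ne_zero a }

open Classical in
theorem val_const_le_one (x : ClosedPoint k) (a : k) :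
    val x (algebraMap k (RatFunc k) a) ≤ 1 := by
  have h : algebraMap k (RatFunc k) a = RatFunc.C a := by
    rw [RatFunc.algebraMap_eq_C]
  cases x with
  | none =>
    by_cases ha : a = 0
    · simp [ha]
    · rw [h]
      exact (RatFunc.inftyValuation.C k ha).le
  | some v =>
    rw [h, ← RatFunc.algebraMap_C]
    exact v.valuation_le_one _

/-- `H⁰(ℙ¹, O(E))` for a `ℤ`-divisor `E`: the rational functions `f` with `f = 0` or
`div f + E ≥ 0`. -/
def H0 (E : ClosedPoint k →₀ ℤ) : Submodule k (RatFunc k) where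
  carrier := {f | ∀ x, val x f ≤ WithZero.exp (E x)}
  zero_mem' := by
    intro x
    simp
  add_mem' := by
    intro f g hf hg x
    exact (Valuation.map_add _ f g).trans (max_le (hf x) (hg x))
  smul_mem' := by
    intro a f hf x
    rw [Algebra.smul_def, map_mul]
    calc val x (algebraMap k (RatFunc k) a) * val x f ≤ 1 * val x f :=
          mul_le_mul_left (val_const_le_one x a) _
      _ ≤ WithZero.exp (E x) := by rw [one_mul]; exact hf x

/-- The integral part `⌊d D⌋` of a multiple of a `ℚ`-divisor (floors of all coefficients). -/
def floorMul (d : ℕ) (D : ClosedPoint k →₀ ℚ) : ClosedPoint k →₀ ℤ :=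
  D.mapRange (fun q => ⌊(d : ℚ) * q⌋) (by simp)

/-- The canonical ring `S_D = ⨁_d u^d H⁰(⌊d D⌋)`, as a subalgebra of `k(t)[u]`. -/
def canonicalRing (D : ClosedPoint k →₀ ℚ) : Subalgebra k (RatFunc k)[X] where
  carrier := {p | ∀ d, p.coeff d ∈ H0 (floorMul d D)}
  add_mem' := by
    intro p q hp hq d
    rw [Polynomial.coeff_add]
    exact (H0 _).add_mem (hp d) (hq d)
  mul_mem' := by
    intro p q hp hq d
    rw [Polynomial.coeff_mul]
    refine Submodule.sum_mem _ fun ij hij x => ?_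
    have hd : ij.1 + ij.2 = d := Finset.HasAntidiagonal.mem_antidiagonal.1 hij
    rw [map_mul]
    calc val x (p.coeff ij.1) * val x (q.coeff ij.2)
        ≤ WithZero.exp (floorMul ij.1 D x) * WithZero.exp (floorMul ij.2 D x) :=
          mul_le_mul' (hp ij.1 x) (hq ij.2 x)
      _ = WithZero.exp (floorMul ij.1 D x + floorMul ij.2 D x) := (WithZero.exp_add _ _).symm
      _ ≤ WithZero.exp (floorMul d D x) := by
          rw [WithZero.exp_le_exp]
          simp only [floorMul, Finsupp.mapRange_apply]
          rw [← hd, Nat.cast_add, add_mul]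
          exact Int.le_floor_add _ _
  algebraMap_mem' := by
    intro a d x
    rw [Polynomial.algebraMap_apply, Polynomial.coeff_C]
    split_ifs with h
    · subst h
      simpa [floorMul] using val_const_le_one x a
    · simp

variable {n : ℕ}

/-- The `ℚ`-divisor `∑ αᵢ Pᵢ`. -/
def divisor (α : Fin n → ℚ) (P : Fin n → OnePoint k) : ClosedPoint k →₀ ℚ :=
  ∑ i, Finsupp.single (rationalPoint (P i)) (α i)

/-- A section of `O(1)` vanishing only at the given rational point (unique up to the scalar `s`),
written in the affine coordinate `t`: the linear form `s (X - a Y)`, respectively `s Y` for the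
point at infinity, divided by `Y`. In a product `∏ tᵢ ^ cᵢ` with `∑ cᵢ = 0` the powers of `Y`
cancel, so that this is the correct rational function. -/
def linSection (s : kˣ) : OnePoint k → RatFunc k
  | none => RatFunc.C (s : k)
  | some a => RatFunc.C (s : k) * (RatFunc.X - RatFunc.C a)

/-- The element `u^d t₁^{c₁} ⋯ tₙ^{cₙ}` of `k(t)[u]`. -/
def monomialElt (P : Fin n → OnePoint k) (s : Fin n → kˣ) (d : ℕ) (c : Fin n → ℤ) :
    (RatFunc k)[X] :=
  Polynomial.monomial d (∏ i, linSection (s i) (P i) ^ c i)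

variable {N : ℕ}

/-- The relation ideal of the monomials `g_a = u^{d_a} ∏ tᵢ^{c_{a,i}}`: the kernel of
`k[x_1, …, x_N] → k(t)[u]`, `x_a ↦ g_a`. -/
def relationIdeal (P : Fin n → OnePoint k) (s : Fin n → kˣ) (d : Fin N → ℕ)
    (c : Fin N → Fin n → ℤ) : Ideal (MvPolynomial (Fin N) k) :=
  RingHom.ker (MvPolynomial.aeval (R := k) fun a => monomialElt P s (d a) (c a))

/-- The family `g` is a minimal system of generators of the algebra `A`. -/
def IsMinimalGenerating {R : Type*} [CommRing R] [Algebra k R] (A : Subalgebra k R)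
    (g : Fin N → R) : Prop :=
  Algebra.adjoin k (Set.range g) = A ∧ ∀ a, g a ∉ Algebra.adjoin k (g '' {b | b ≠ a})

end Geometry

/-! ## Reverse lexicographic order and Gröbner bases -/

section Groebner

variable {k : Type u} [Field k] {N : ℕ}

/-- A monomial `x^m` as a word: its variables listed (with multiplicity) in increasing order. -/
def word (m : Fin N →₀ ℕ) : List (Fin N) := (Finsupp.toMultiset m).sort

/-- The reverse lexicographic order `x^m ≺ x^m'`: words are compared as in a dictionary, e.g.
`x₁ ≺ x₁⁴ ≺ x₁² x₃ ≺ x₁ x₂² ≺ x₂`. -/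
def RevLex (m m' : Fin N →₀ ℕ) : Prop := word m < word m'

/-- `x^m` is the last monomial occurring in `f`. -/
def IsInitialMonomial (f : MvPolynomial (Fin N) k) (m : Fin N →₀ ℕ) : Prop :=
  m ∈ f.support ∧ ∀ m' ∈ f.support, m' ≠ m → RevLex m' m

open Classical in
/-- The initial term of `f`: its last term in the reverse lexicographic order (and `0` for
`f = 0`). -/
def initialTerm (f : MvPolynomial (Fin N) k) : MvPolynomial (Fin N) k :=
  if h : ∃ m, IsInitialMonomial f m then MvPolynomial.monomial h.choose (f.coeff h.choose) else 0

/-- The `k`-span `in(I)` of the initial terms of the elements of `I`. -/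
def initialSpace (I : Ideal (MvPolynomial (Fin N) k)) :
    Submodule k (MvPolynomial (Fin N) k) :=
  Submodule.span k (initialTerm '' (I : Set (MvPolynomial (Fin N) k)))

/-- `G` is a Gröbner basis of `I`: it generates `I`, and the initial terms of its elements form
a minimal system of generators of the ideal `in(I)`. -/
structure IsGroebnerBasis (I : Ideal (MvPolynomial (Fin N) k))
    (G : Set (MvPolynomial (Fin N) k)) : Prop where
  span_eq : Ideal.span G = I
  injOn : Set.InjOn initialTerm G
  initial_eq : (Ideal.span (initialTerm '' G)).restrictScalars k = initialSpace I
  minimal : ∀ τ ∈ initialTerm '' G, τ ∉ Ideal.span ((initialTerm '' G) \ {τ})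

end Groebner

/-! ## The stable generators

All of this depends only on the coefficients `α`. -/

section Stable

variable {n N : ℕ}

/-- The degree of `⌊d D⌋`, for `D = ∑ αᵢ Pᵢ`. -/
def floorDeg (α : Fin n → ℚ) (d : ℕ) : ℤ := ∑ i, ⌊(d : ℚ) * α i⌋

/-- The set `A` of indices with `⌊c D⌋ + ⌊(e - c) D⌋ = ⌊e D⌋ - ∑_{i ∈ A} Pᵢ`. -/
def dropSet (α : Fin n → ℚ) (e c : ℕ) : Finset (Fin n) :=
  {i | ⌊(c : ℚ) * α i⌋ + ⌊((e - c : ℕ) : ℚ) * α i⌋ ≠ ⌊(e : ℚ) * α i⌋}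

/-- The family of index sets `A` for which `u^e H⁰(⌊e D⌋ - ∑_{i ∈ A} Pᵢ)` is a nonzero product
`S_c S_{e-c}` with `1 ≤ c ≤ e / 2`. The sum of these spaces is the part of `S_e` which is
generated in degrees less than `e`. -/
def pregenFamily (α : Fin n → ℚ) (e : ℕ) : Finset (Finset (Fin n)) :=
  {c ∈ Finset.Icc 1 (e / 2) | 0 ≤ floorDeg α c ∧ 0 ≤ floorDeg α (e - c)}.image (dropSet α e)

/-- One step of simplification of a family of index sets. With `V_A` the space of sections of
`O(r)` vanishing at the `Pᵢ`, `i ∈ A`, two members with `|A ∪ B| ≤ r + 1` may be replaced by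
`A ∩ B`, since then `V_A + V_B = V_{A ∩ B}`. -/
inductive MergeStep (r : ℤ) : Finset (Finset (Fin n)) → Finset (Finset (Fin n)) → Prop
  | merge (F : Finset (Finset (Fin n))) (A B : Finset (Fin n)) (hA : A ∈ F) (hB : B ∈ F)
      (hne : A ≠ B) (hcard : ((A ∪ B).card : ℤ) ≤ r + 1) :
      MergeStep r F (insert (A ∩ B) ((F.erase A).erase B))

/-- `F'` is a fully simplified form of `F`. -/
def IsReduction (r : ℤ) (F F' : Finset (Finset (Fin n))) : Prop :=
  Relation.ReflTransGen (MergeStep r) F F' ∧ ∀ F'', ¬ MergeStep r F' F''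

/-- `NewOrders r F j M`: for the simplified family `F`, the point `P_j` is an admissible choice,
and the monomials to be adjoined to `∑_{A ∈ F} V_A` in order to get a basis of `H⁰(O(r))` are to
vanish at `P_j` to the orders in `M`, one monomial for each order. -/
inductive NewOrders (r : ℤ) : Finset (Finset (Fin n)) → Fin n → Set ℤ → Prop
  | none (j : Fin n) : NewOrders r ∅ j (Set.Icc 0 r)
  | all (j : Fin n) : NewOrders r {∅} j ∅
  | one (A : Finset (Fin n)) (j : Fin n) (hj : j ∈ A) :
      NewOrders r {A} j (insert 0 (Set.Icc (r - A.card + 2) r))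
  | two (A B : Finset (Fin n)) (j : Fin n) (hB : (B.card : ℤ) = r) (hjA : j ∈ A) (hjB : j ∉ B) :
      NewOrders r {A, B} j (Set.Icc (r - A.card + 2) r)

/-- The order of vanishing at `P_j` of `u^d ∏ tᵢ^{cᵢ}` as a section of `O(⌊d D⌋)`. -/
def sectionOrder (α : Fin n → ℚ) (d : ℕ) (c : Fin n → ℤ) (j : Fin n) : ℤ :=
  c j + ⌊(d : ℚ) * α j⌋

/-- The monomials `g_a = u^{d_a} ∏ tᵢ^{c_{a,i}}`, `a = 1, …, N`, form a system of stable
generators for `α`, in the prescribed order: increasing degree and, in each degree, strictly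
decreasing order of vanishing at the chosen point `P_j`. -/
structure IsStableSystem (α : Fin n → ℚ) (d : Fin N → ℕ) (c : Fin N → Fin n → ℤ) : Prop where
  pos : ∀ a, 1 ≤ d a
  mono : Monotone d
  sum_zero : ∀ a, ∑ i, c a i = 0
  section_nonneg : ∀ a i, 0 ≤ sectionOrder α (d a) (c a) i
  recipe : ∀ e : ℕ, 1 ≤ e → ∃ (F : Finset (Finset (Fin n))) (j : Fin n) (M : Set ℤ),
    IsReduction (floorDeg α e) (pregenFamily α e) F ∧
    NewOrders (floorDeg α e) F j M ∧
    (∀ a b, d a = e → d b = e → a < b →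
      sectionOrder α e (c b) j < sectionOrder α e (c a) j) ∧
    {m | ∃ a, d a = e ∧ sectionOrder α e (c a) j = m} = M

end Stable

end QDiv

end

/-!
The statement is reduced to combinatorics of index sets. All that is used of the sections
`L a = H⁰(∑ aᵢ Pᵢ)` on the projective line is collected in `SectionSystem`; in particular
`L a + L b = L (max a b)` if `min a b` has degree at least `-1`, and `L a * L b = L (a + b)` in
nonnegative degrees. The first relation shows that simplifying a family `F` of index sets does not
change `V E F = ∑_{A ∈ F} L (E - A)`, the second one that the decomposable part of `S_e` is of this
form. As `n ≤ 4`, a simplified family is `∅`, `{A}` or consists of two complementary pairs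
(`irreducible_cases`), and in each case the prescribed monomials complement `V` to a basis of `S_e`
(`V_sup_orders`, `mon_notMem`). Hence the `g_a` generate `S_D` minimally.

A monomial `x^m` is initial for the relation ideal iff its value lies in the span `W m` of the
values of the smaller monomials of the same degree. If `x_b` is the first letter of `x_b x^m`, then
`W (x_b x^m) = J_b + g_b W m`, where `J_b` is generated by the `g_a` with `a < b`. So the question
is passed on from `x_b x^m` to `x^m` by taking the colon by `g_b`, and the heart of the proof is
`exists_colon`: for every family `F` there is a family `F'`, depending only on the combinatorial
data, such that for `y ∈ L ⌊f D⌋` one has `g_b y ∈ V F + J_b` iff `y ∈ V F'`. Here `J_b` is a sum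
`V` of decomposable spaces together with the sections vanishing to some order at `P_j`, which come
from the preceding generators of the same degree; the shape of the recipe for the orders makes
these fit together. By induction on the word (`exists_mem_V_sup_W_iff`) the set of initial monomials
is the same for all fields and points, and its minimal elements are finite in number by Dickson's
lemma.

On the set of all monomials the dictionary order is neither a well-ordering nor invariant under
multiplication, but on monomials of equal weight it is the reverse lexicographic order. Since the
relation ideal is homogeneous, Gröbner basis theory can be carried out weight by weight
(`exists_isGroebnerBasis`).

Stable systems exist because the recipe asks for no generators in large degrees: if `q` is a common
denominator of the `αᵢ`, then `S_e = S_q S_{e-q}` or `S_e = 0` for large `e`.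
-/

noncomputable section

namespace QDiv

/-! ### Systems of sections with monomials -/

/-- A model of the sections of line bundles on a projective line with `n` marked points: `L a` plays
the role of `H⁰(∑ aᵢ Pᵢ)` inside the function field `K`, and `mon c` that of `∏ tᵢ ^ cᵢ`. The
fields are the properties of sections from which everything below is derived; since no point is
mentioned in them, statements quantified over all section systems are uniform in the field and in
the points. Only the exponents `c` with `∑ cᵢ = 0` correspond to rational functions. -/
structure SectionSystem (n : ℕ) (k K : Type*) [Field k] [Field K] [Algebra k K] where
  L : (Fin n → ℤ) → Submodule k K
  mon : (Fin n → ℤ) → K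
  mon_zero : mon 0 = 1
  mon_add : ∀ c c', mon (c + c') = mon c * mon c'
  mon_mul_mem : ∀ c, ∑ i, c i = 0 → ∀ a f, mon c * f ∈ L a ↔ f ∈ L (a + c)
  inf_eq : ∀ a b, L a ⊓ L b = L (a ⊓ b)
  one_mem : 1 ∈ L 0
  one_notMem : ∀ a i, a i < 0 → 1 ∉ L a
  mul_mem : ∀ a b f g, f ∈ L a → g ∈ L b → f * g ∈ L (a + b)
  eq_bot : ∀ a, ∑ i, a i < 0 → L a = ⊥
  exists_sub_smul_mem : ∀ a i f g, f ∈ L (a + Pi.single i 1) → g ∈ L (a + Pi.single i 1) →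
    g ∉ L a → ∃ t : k, f - t • g ∈ L a

namespace SectionSystem

variable {n : ℕ} {k K : Type*} [Field k] [Field K] [Algebra k K] (T : SectionSystem n k K)

theorem mono {a b : Fin n → ℤ} (h : a ≤ b) : T.L a ≤ T.L b := by
  have := T.inf_eq a b
  rw [inf_eq_left.2 h] at this
  exact inf_eq_left.1 this

theorem one_mem_iff {a : Fin n → ℤ} : (1 : K) ∈ T.L a ↔ 0 ≤ a := by
  constructor
  · intro h i
    by_contra hi
    exact T.one_notMem a i (not_le.1 hi) h
  · intro h
    exact T.mono h T.one_mem

theorem mon_mem_iff {a c : Fin n → ℤ} (hc : ∑ i, c i = 0) : T.mon c ∈ T.L a ↔ 0 ≤ a + c := by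
  rw [← T.one_mem_iff, ← T.mon_mul_mem c hc, mul_one]

theorem mon_ne_zero {c : Fin n → ℤ} : T.mon c ≠ 0 := by
  intro h
  have := T.mon_add c (-c)
  rw [h, add_neg_cancel, T.mon_zero, zero_mul] at this
  exact one_ne_zero this

theorem map_mon {c : Fin n → ℤ} (hc : ∑ i, c i = 0) (a : Fin n → ℤ) :
    (T.L a).map (LinearMap.mulLeft k (T.mon c)) = T.L (a - c) := by
  ext f
  rw [Submodule.mem_map]
  constructor
  · rintro ⟨g, hg, rfl⟩
    rw [LinearMap.mulLeft_apply, T.mon_mul_mem c hc, sub_add_cancel]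
    exact hg
  · intro hf
    refine ⟨T.mon (-c) * f, ?_, ?_⟩
    · rw [T.mon_mul_mem _ (by simpa using hc), ← sub_eq_add_neg]
      exact hf
    · rw [LinearMap.mulLeft_apply, ← mul_assoc, ← T.mon_add, add_neg_cancel, T.mon_zero, one_mul]

/-- A monomial section of `L a` which vanishes to order exactly zero at the `i`-th point, as a
section of a line bundle of degree `∑ aᵢ`: all its zeros are moved to another marked point. -/
theorem exists_mon (hn : 2 ≤ n) {a : Fin n → ℤ} (ha : 0 ≤ ∑ i, a i) (i : Fin n) :
    ∃ c : Fin n → ℤ, ∑ i, c i = 0 ∧ c i = -a i ∧ T.mon c ∈ T.L a := by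
  have : Nontrivial (Fin n) := Fin.nontrivial_iff_two_le.2 hn
  obtain ⟨j, hj⟩ := exists_ne i
  have hs : ∑ l, (-a + Pi.single j (∑ i, a i) : Fin n → ℤ) l = 0 := by
    simp [Finset.sum_add_distrib]
  refine ⟨-a + Pi.single j (∑ i, a i), hs, by simp [hj.symm], ?_⟩
  rw [T.mon_mem_iff hs]
  intro l
  by_cases hl : l = j
  · subst hl; simpa using ha
  · simp [hl]

theorem le_sup_span {a : Fin n → ℤ} {i : Fin n} {g : K} (hg : g ∈ T.L (a + Pi.single i 1))
    (hg' : g ∉ T.L a) : T.L (a + Pi.single i 1) = T.L a ⊔ Submodule.span k {g} := by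
  apply le_antisymm
  · intro f hf
    obtain ⟨t, ht⟩ := T.exists_sub_smul_mem a i f g hf hg hg'
    rw [← sub_add_cancel f (t • g)]
    exact Submodule.add_mem_sup ht (Submodule.smul_mem _ _ (Submodule.mem_span_singleton_self g))
  · refine sup_le (T.mono ?_) ?_
    · intro l
      by_cases hl : l = i
      · subst hl; simp
      · simp [hl]
    · rwa [Submodule.span_singleton_le_iff_mem]

/-- The Mayer–Vietoris relation: `H¹` of the intersection vanishes as soon as its degree is at
least `-1`. This is what makes the merging of two index sets legitimate. -/
theorem sup_eq (hn : 2 ≤ n) {a b : Fin n → ℤ} (h : -1 ≤ ∑ i, (a ⊓ b) i) :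
    T.L a ⊔ T.L b = T.L (a ⊔ b) := by
  apply le_antisymm (sup_le (T.mono le_sup_left) (T.mono le_sup_right))
  obtain ⟨N, hN⟩ : ∃ N : ℕ, ∑ i, ((a ⊔ b) i - a i) = N :=
    Int.eq_ofNat_of_zero_le (Finset.sum_nonneg fun i _ => by simp)
  induction N generalizing a with
  | zero =>
    have h0 := (Finset.sum_eq_zero_iff_of_nonneg (fun i _ => by simp)).1 hN
    have : a ⊔ b = a := by
      funext i
      have := h0 i (Finset.mem_univ i)
      linarith
    rw [this]
    exact le_sup_left
  | succ N ih =>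
    obtain ⟨i, hi⟩ : ∃ i, a i < b i := by
      by_contra! hcon
      have : ∑ i, ((a ⊔ b) i - a i) = 0 :=
        Finset.sum_eq_zero fun i _ => by simp [hcon i]
      omega
    have hsup : (a + Pi.single i 1) ⊔ b = a ⊔ b := by
      funext l
      by_cases hl : l = i
      · subst hl; simp; omega
      · simp [hl]
    have hinf : (a + Pi.single i 1) ⊓ b = a ⊓ b + Pi.single i 1 := by
      funext l
      by_cases hl : l = i
      · subst hl; simp; omega
      · simp [hl]
    have hs : ∑ l, ((a + Pi.single i 1) ⊓ b) l = ∑ l, (a ⊓ b) l + 1 := by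
      rw [hinf]; simp [Finset.sum_add_distrib]
    have key := ih (a := a + Pi.single i 1) (by omega) (by
      rw [hsup]
      simp only [Finset.sum_sub_distrib, Pi.add_apply, Finset.sum_add_distrib,
        Finset.sum_pi_single', Finset.mem_univ, if_true] at hN ⊢
      push_cast at hN
      simp at hN ⊢
      omega)
    rw [hsup] at key
    refine key.trans (sup_le ?_ le_sup_right)
    obtain ⟨c, hc, hci, hmem⟩ := T.exists_mon hn (a := (a + Pi.single i 1) ⊓ b) (by omega) i
    rw [T.le_sup_span (g := T.mon c) (T.mono inf_le_left hmem)]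
    · refine sup_le_sup_left ?_ _
      rw [Submodule.span_singleton_le_iff_mem]
      exact T.mono inf_le_right hmem
    · rw [T.mon_mem_iff hc]
      intro hcon
      have := hcon i
      simp [hci] at this
      omega

theorem L_zero (hn : 2 ≤ n) : T.L 0 = Submodule.span k {(1 : K)} := by
  let i : Fin n := ⟨0, by omega⟩
  have h1 : T.L (-Pi.single i 1) = ⊥ := T.eq_bot _ (by simp)
  have := T.le_sup_span (a := -Pi.single i 1) (i := i) (g := 1)
    (by simpa using T.one_mem) (by rw [h1]; simp)
  rwa [h1, bot_sup_eq, neg_add_cancel] at this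

/-- Multiplication of sections on the projective line is surjective in nonnegative degrees. -/
theorem mul_eq (hn : 2 ≤ n) {a b : Fin n → ℤ} (ha : 0 ≤ ∑ i, a i) (hb : 0 ≤ ∑ i, b i) :
    T.L a * T.L b = T.L (a + b) := by
  apply le_antisymm (Submodule.mul_le.2 fun f hf g hg => T.mul_mem a b f g hf hg)
  obtain ⟨N, hN⟩ := Int.eq_ofNat_of_zero_le hb
  induction N generalizing b with
  | zero =>
    have hb' : ∑ i, (-b) i = 0 := by simpa using hN
    have := T.map_mon hb' a
    rw [sub_neg_eq_add] at this
    rw [← this, Submodule.map_le_iff_le_comap]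
    intro f hf
    rw [Submodule.mem_comap, LinearMap.mulLeft_apply, mul_comm (T.mon _)]
    refine Submodule.mul_mem_mul hf ?_
    rw [T.mon_mem_iff hb', add_neg_cancel]
  | succ N ih =>
    push_cast at hN
    have hlt : ∀ i : Fin n, b - Pi.single i 1 ≤ b := fun i l => by
      by_cases hl : l = i
      · subst hl; simp
      · simp [hl]
    have h1 : ∀ i : Fin n, T.L (a + b - Pi.single i 1) ≤ T.L a * T.L b := fun i => by
      have hs : ∑ l, (b - Pi.single i 1 : Fin n → ℤ) l = N := by
        simp [Finset.sum_sub_distrib]; omega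
      have := ih (b := b - Pi.single i 1) (by omega) hs
      rw [add_sub_assoc]
      exact this.trans (Submodule.mul_le.2 fun f hf g hg =>
        Submodule.mul_mem_mul hf (T.mono (hlt i) hg))
    have : Nontrivial (Fin n) := Fin.nontrivial_iff_two_le.2 hn
    obtain ⟨i, j, hij⟩ := exists_pair_ne (Fin n)
    have hinf : (a + b - Pi.single i 1) ⊓ (a + b - Pi.single j 1)
        = a + b - Pi.single i 1 - Pi.single j 1 := by
      funext l
      by_cases hl : l = i
      · subst hl; simp [hij]
      · by_cases hl' : l = j
        · subst hl'; simp [hl]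
        · simp [hl, hl']
    have hsup : (a + b - Pi.single i 1) ⊔ (a + b - Pi.single j 1) = a + b := by
      funext l
      by_cases hl : l = i
      · subst hl; simp [hij]
      · simp [hl]; by_cases hl' : l = j
        · subst hl'; simp
        · simp [hl']
    have := T.sup_eq hn (a := a + b - Pi.single i 1) (b := a + b - Pi.single j 1) (by
      rw [hinf]; simp [Finset.sum_sub_distrib, Finset.sum_add_distrib]; omega)
    rw [← hsup, ← this]
    exact sup_le (h1 i) (h1 j)

/-- Riemann–Roch, with the dimension given by the natural number `N`; the case of degree `-1`
is included. -/
theorem finrank_eq (hn : 2 ≤ n) {a : Fin n → ℤ} {N : ℕ} (ha : ∑ i, a i + 1 = N) :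
    FiniteDimensional k (T.L a) ∧ Module.finrank k (T.L a) = N := by
  induction N generalizing a with
  | zero =>
    rw [T.eq_bot a (by push_cast at ha; omega)]
    exact ⟨inferInstance, finrank_bot k K⟩
  | succ N ih =>
    push_cast at ha
    let i : Fin n := ⟨0, by omega⟩
    have hs : ∑ l, (a - Pi.single i 1 : Fin n → ℤ) l + 1 = N := by
      simp [Finset.sum_sub_distrib]; omega
    obtain ⟨h1, h2⟩ := ih hs
    obtain ⟨c, hc, hci, hmem⟩ := T.exists_mon hn (a := a) (by omega) i
    have hnot : T.mon c ∉ T.L (a - Pi.single i 1) := by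
      rw [T.mon_mem_iff hc]
      intro hcon
      have := hcon i
      simp [hci] at this
    have heq := T.le_sup_span (a := a - Pi.single i 1) (i := i) (g := T.mon c)
      (by simpa using hmem) hnot
    rw [sub_add_cancel] at heq
    rw [heq]
    refine ⟨inferInstance, ?_⟩
    have hdis : T.L (a - Pi.single i 1) ⊓ Submodule.span k {T.mon c} = ⊥ := by
      rw [← disjoint_iff, Submodule.disjoint_span_singleton' T.mon_ne_zero]
      exact hnot
    have := Submodule.finrank_sup_add_finrank_inf_eq (T.L (a - Pi.single i 1))
      (Submodule.span k {T.mon c})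
    rw [hdis, finrank_bot, h2, finrank_span_singleton T.mon_ne_zero] at this
    simpa using this

end SectionSystem

/-! ### Families of index sets and their reductions -/

section Families

variable {n : ℕ}

/-- The indicator function of `A`, i.e. the divisor `∑_{i ∈ A} Pᵢ`. -/
def ind (A : Finset (Fin n)) : Fin n → ℤ := fun i => if i ∈ A then 1 else 0

theorem sum_ind (A : Finset (Fin n)) : ∑ i, ind A i = A.card := by
  simp [ind]

theorem ind_of_mem {A : Finset (Fin n)} {i : Fin n} (h : i ∈ A) : ind A i = 1 := by
  simp [ind, h]

theorem ind_of_notMem {A : Finset (Fin n)} {i : Fin n} (h : i ∉ A) : ind A i = 0 := by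
  simp [ind, h]

theorem ind_nonneg (A : Finset (Fin n)) (i : Fin n) : 0 ≤ ind A i := by
  unfold ind; split_ifs <;> simp

theorem ind_le_one (A : Finset (Fin n)) (i : Fin n) : ind A i ≤ 1 := by
  unfold ind; split_ifs <;> simp

theorem sub_ind_inf (E : Fin n → ℤ) (A B : Finset (Fin n)) :
    (E - ind A) ⊓ (E - ind B) = E - ind (A ∪ B) := by
  funext i
  by_cases hA : i ∈ A <;> by_cases hB : i ∈ B <;> simp [ind, hA, hB]

theorem sub_ind_sup (E : Fin n → ℤ) (A B : Finset (Fin n)) :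
    (E - ind A) ⊔ (E - ind B) = E - ind (A ∩ B) := by
  funext i
  by_cases hA : i ∈ A <;> by_cases hB : i ∈ B <;> simp [ind, hA, hB]

theorem sub_ind_empty (E : Fin n → ℤ) : E - ind ∅ = E := by
  funext i
  simp [ind]

theorem MergeStep.card_lt {r : ℤ} {F F' : Finset (Finset (Fin n))} (h : MergeStep r F F') :
    F'.card < F.card := by
  obtain ⟨A, B, hA, hB, hne, -⟩ := h
  have h1 := Finset.card_insert_le (A ∩ B) ((F.erase A).erase B)
  have h2 := Finset.card_erase_lt_of_mem hA
  have h3 := Finset.card_erase_lt_of_mem (Finset.mem_erase.2 ⟨hne.symm, hB⟩)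
  omega

theorem exists_isReduction (r : ℤ) (F : Finset (Finset (Fin n))) : ∃ F', IsReduction r F F' := by
  induction h : F.card using Nat.strong_induction_on generalizing F with
  | _ N ih =>
    by_cases hF : ∃ F', MergeStep r F F'
    · obtain ⟨F', hF'⟩ := hF
      obtain ⟨F'', h1, h2⟩ := ih _ (h ▸ hF'.card_lt) F' rfl
      exact ⟨F'', Relation.ReflTransGen.head hF' h1, h2⟩
    · exact ⟨F, Relation.ReflTransGen.refl, not_exists.1 hF⟩

theorem MergeStep.card_le {r : ℤ} {F F' : Finset (Finset (Fin n))} (h : MergeStep r F F')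
    (hF : ∀ A ∈ F, (A.card : ℤ) ≤ r) : ∀ A ∈ F', (A.card : ℤ) ≤ r := by
  obtain ⟨A, B, hA, hB, hne, -⟩ := h
  intro C hC
  rw [Finset.mem_insert] at hC
  rcases hC with rfl | hC
  · have := hF A hA
    have h2 : (A ∩ B).card ≤ A.card := Finset.card_le_card Finset.inter_subset_left
    omega
  · exact hF C (Finset.mem_of_mem_erase (Finset.mem_of_mem_erase hC))

theorem IsReduction.card_le {r : ℤ} {F F' : Finset (Finset (Fin n))} (h : IsReduction r F F')
    (hF : ∀ A ∈ F, (A.card : ℤ) ≤ r) : ∀ A ∈ F', (A.card : ℤ) ≤ r := by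
  obtain ⟨h, -⟩ := h
  induction h with
  | refl => exact hF
  | tail _ h ih => exact h.card_le ih

/-- Two members of a fully simplified family satisfy `|A ∪ B| ≥ r + 2` while `|A|, |B| ≤ r`. With
at most four points this leaves only two complementary pairs and `r = 2`. This is the place where
`n ≤ 4` is used. -/
theorem irreducible_pair (hn : n ≤ 4) {r : ℤ} {F : Finset (Finset (Fin n))}
    (hirr : ∀ F', ¬ MergeStep r F F') (hF : ∀ A ∈ F, (A.card : ℤ) ≤ r) {A B : Finset (Fin n)}
    (hA : A ∈ F) (hB : B ∈ F) (hne : A ≠ B) : r = 2 ∧ A.card = 2 ∧ B.card = 2 ∧ B = Aᶜ := by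
  have h1 : ¬ ((A ∪ B).card : ℤ) ≤ r + 1 := fun hc => hirr _ (MergeStep.merge F A B hA hB hne hc)
  have h2 := hF A hA
  have h3 := hF B hB
  have h4 := Finset.card_union_add_card_inter A B
  have h5 : (A ∪ B).card ≤ n := by simpa using Finset.card_le_univ (A ∪ B)
  refine ⟨by omega, by omega, by omega, ?_⟩
  have hd : Disjoint A B := by
    rw [Finset.disjoint_iff_inter_eq_empty, ← Finset.card_eq_zero]; omega
  symm
  apply Finset.eq_of_superset_of_card_ge
  · intro i hi
    rw [Finset.mem_compl]
    exact fun hiA => Finset.disjoint_left.1 hd hiA hi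
  · rw [Finset.card_compl, Fintype.card_fin]; omega

theorem irreducible_cases (hn : n ≤ 4) {r : ℤ} {F : Finset (Finset (Fin n))}
    (hirr : ∀ F', ¬ MergeStep r F F') (hF : ∀ A ∈ F, (A.card : ℤ) ≤ r) :
    F = ∅ ∨ (∃ A, F = {A}) ∨
      ∃ A B, F = {A, B} ∧ r = 2 ∧ A.card = 2 ∧ B.card = 2 ∧ B = Aᶜ := by
  rcases F.eq_empty_or_nonempty with h | ⟨A, hA⟩
  · exact Or.inl h
  by_cases h : ∀ B ∈ F, B = A
  · exact Or.inr (Or.inl ⟨A, Finset.eq_singleton_iff_unique_mem.2 ⟨hA, h⟩⟩)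
  · push Not at h
    obtain ⟨B, hB, hBA⟩ := h
    obtain ⟨h1, h2, h3, h4⟩ := irreducible_pair hn hirr hF hA hB hBA.symm
    refine Or.inr (Or.inr ⟨A, B, ?_, h1, h2, h3, h4⟩)
    ext C
    rw [Finset.mem_insert, Finset.mem_singleton]
    constructor
    · intro hC
      by_cases hCA : C = A
      · exact Or.inl hCA
      · right
        rw [h4]
        exact (irreducible_pair hn hirr hF hA hC (Ne.symm hCA)).2.2.2
    · rintro (rfl | rfl) <;> assumption

end Families

namespace SectionSystem

variable {n : ℕ} {k K : Type*} [Field k] [Field K] [Algebra k K] (T : SectionSystem n k K)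

/-- The sum `∑_{A ∈ F} H⁰(E - ∑_{i ∈ A} Pᵢ)` attached to a family `F` of index sets. -/
def V (E : Fin n → ℤ) (F : Finset (Finset (Fin n))) : Submodule k K := ⨆ A ∈ F, T.L (E - ind A)

theorem V_empty (E : Fin n → ℤ) : T.V E ∅ = ⊥ := by simp [V]

theorem V_insert (E : Fin n → ℤ) (A : Finset (Fin n)) (F : Finset (Finset (Fin n))) :
    T.V E (insert A F) = T.L (E - ind A) ⊔ T.V E F := by
  exact Finset.iSup_insert A F fun A => T.L (E - ind A)

theorem V_singleton (E : Fin n → ℤ) (A : Finset (Fin n)) : T.V E {A} = T.L (E - ind A) := by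
  simp [V]

theorem V_pair (E : Fin n → ℤ) (A B : Finset (Fin n)) :
    T.V E {A, B} = T.L (E - ind A) ⊔ T.L (E - ind B) := by
  rw [V_insert, V_singleton]

theorem V_union (E : Fin n → ℤ) (F G : Finset (Finset (Fin n))) :
    T.V E (F ∪ G) = T.V E F ⊔ T.V E G := by
  exact Finset.iSup_union

theorem V_le (E : Fin n → ℤ) (F : Finset (Finset (Fin n))) : T.V E F ≤ T.L E := by
  refine iSup₂_le fun A _ => T.mono fun i => ?_
  have := ind_nonneg A i
  simp only [Pi.sub_apply]
  omega

theorem V_mergeStep (hn : 2 ≤ n) {E : Fin n → ℤ} {F F' : Finset (Finset (Fin n))}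
    (h : MergeStep (∑ i, E i) F F') : T.V E F = T.V E F' := by
  obtain ⟨A, B, hA, hB, hne, hcard⟩ := h
  have hF : F = insert A (insert B ((F.erase A).erase B)) := by
    rw [Finset.insert_erase (Finset.mem_erase.2 ⟨hne.symm, hB⟩), Finset.insert_erase hA]
  conv_lhs => rw [hF]
  rw [V_insert, V_insert, V_insert, ← sup_assoc, T.sup_eq hn, sub_ind_sup]
  rw [sub_ind_inf]
  simp only [Pi.sub_apply, Finset.sum_sub_distrib, sum_ind]
  omega

theorem V_isReduction (hn : 2 ≤ n) {E : Fin n → ℤ} {F F' : Finset (Finset (Fin n))}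
    (h : IsReduction (∑ i, E i) F F') : T.V E F = T.V E F' := by
  obtain ⟨h, -⟩ := h
  induction h with
  | refl => rfl
  | tail _ h ih => exact ih.trans (T.V_mergeStep hn h)

/-- Members with more than `deg E` elements contribute nothing, and may be dropped. -/
theorem V_filter (E : Fin n → ℤ) (F : Finset (Finset (Fin n))) :
    T.V E {A ∈ F | (A.card : ℤ) ≤ ∑ i, E i} = T.V E F := by
  apply le_antisymm
  · exact iSup₂_le fun A hA => le_iSup₂_of_le A (Finset.mem_of_mem_filter A hA) le_rfl
  · refine iSup₂_le fun A hA => ?_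
    by_cases h : (A.card : ℤ) ≤ ∑ i, E i
    · exact le_iSup₂_of_le (f := fun A (_ : A ∈ Finset.filter _ F) => T.L (E - ind A)) A
        (Finset.mem_filter.2 ⟨hA, h⟩) le_rfl
    · rw [T.eq_bot _ (by
        simp only [Pi.sub_apply, Finset.sum_sub_distrib, sum_ind]; omega)]
      exact bot_le

end SectionSystem

section Floors

variable {n : ℕ} (α : Fin n → ℚ)

/-- The coefficients of the divisor `⌊e D⌋` at the marked points. -/
def fl (e : ℕ) : Fin n → ℤ := fun i => ⌊(e : ℚ) * α i⌋

theorem sum_fl (e : ℕ) : ∑ i, fl α e i = floorDeg α e := rfl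

theorem fl_zero : fl α 0 = 0 := by
  funext i; simp [fl]

theorem fl_add_fl {e c : ℕ} (h : c ≤ e) :
    fl α c + fl α (e - c) = fl α e - ind (dropSet α e c) := by
  funext i
  have h0 : (e : ℚ) * α i = (c : ℚ) * α i + ((e - c : ℕ) : ℚ) * α i := by
    rw [Nat.cast_sub h]; ring
  have h1 := Int.le_floor_add ((c : ℚ) * α i) (((e - c : ℕ) : ℚ) * α i)
  have h2 := Int.le_floor_add_floor ((c : ℚ) * α i) (((e - c : ℕ) : ℚ) * α i)
  rw [← h0] at h1 h2
  simp only [fl, ind, dropSet, Pi.add_apply, Pi.sub_apply, Finset.mem_filter, Finset.mem_univ,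
    true_and, ne_eq]
  split_ifs with hi <;> omega

end Floors

/-! ### The new generators of one degree -/

theorem eq_single_of_sum_le {n : ℕ} {o : Fin n → ℤ} (h0 : 0 ≤ o) {j : Fin n}
    (h : ∑ i, o i ≤ o j) : o = Pi.single j (o j) := by
  funext i
  by_cases hi : i = j
  · subst hi; simp
  · have h1 := Finset.add_sum_erase Finset.univ o (Finset.mem_univ j)
    have h2 : o i ≤ ∑ l ∈ Finset.univ.erase j, o l :=
      Finset.single_le_sum (fun l _ => h0 l) (Finset.mem_erase.2 ⟨hi, Finset.mem_univ i⟩)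
    have h3 := h0 i
    simp only [Pi.zero_apply] at h3
    simp [hi]
    omega

namespace SectionSystem

variable {n : ℕ} {k K : Type*} [Field k] [Field K] [Algebra k K] (T : SectionSystem n k K)

/-- Let `o` run through divisors of zeros of sections of `O(q)` which take at `j` exactly the orders
from `v` to `deg q`. Then the products of these sections with `L s`, where `deg s ≥ 0`, span the
space of all sections of `O(s + q)` which vanish to order `v` at `j`. -/
theorem iSup_orders (hn : 2 ≤ n) {s q : Fin n → ℤ} (hs : 0 ≤ ∑ i, s i) {j : Fin n}
    {O : Set (Fin n → ℤ)} (hO : ∀ o ∈ O, 0 ≤ o ∧ ∑ i, o i = ∑ i, q i) {v : ℤ}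
    (hv : v ≤ ∑ i, q i) (hM : ∀ m, v ≤ m → m ≤ ∑ i, q i → ∃ o ∈ O, o j = m)
    (hge : ∀ o ∈ O, v ≤ o j) :
    ⨆ o ∈ O, T.L (s + q - o) = T.L (s + q - Pi.single j v) := by
  apply le_antisymm
  · refine iSup₂_le fun o ho => T.mono fun i => ?_
    have h0 := (hO o ho).1 i
    by_cases hi : i = j
    · subst hi; have := hge o ho; simp; omega
    · simpa [hi] using h0
  · have key : ∀ t : ℕ, ∀ m, v ≤ m → m ≤ ∑ i, q i → ∑ i, q i - m = t →
        T.L (s + q - Pi.single j m) ≤ ⨆ o ∈ O, T.L (s + q - o) := by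
      intro t
      induction t with
      | zero =>
        intro m h1 h2 h3
        obtain ⟨o, ho, hoj⟩ := hM m h1 h2
        have := eq_single_of_sum_le (hO o ho).1 (j := j) (by rw [(hO o ho).2, hoj]; omega)
        rw [← hoj, ← this]
        exact le_iSup₂_of_le o ho le_rfl
      | succ t ih =>
        intro m h1 h2 h3
        push_cast at h3
        obtain ⟨o, ho, hoj⟩ := hM m h1 h2
        have h4 := ih (m + 1) (by omega) (by omega) (by omega)
        have hinf : (s + q - Pi.single j (m + 1)) ⊓ (s + q - o)
            = s + q - o - Pi.single j 1 := by
          funext i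
          have h0 := (hO o ho).1 i
          simp only [Pi.zero_apply] at h0
          by_cases hi : i = j
          · subst hi; simp [hoj]; omega
          · simp [hi, h0]
        have hsup : (s + q - Pi.single j (m + 1)) ⊔ (s + q - o) = s + q - Pi.single j m := by
          funext i
          have h0 := (hO o ho).1 i
          simp only [Pi.zero_apply] at h0
          by_cases hi : i = j
          · subst hi; simp [hoj]; omega
          · simp [hi, h0]
        rw [← hsup, ← T.sup_eq hn]
        · exact sup_le h4 (le_iSup₂_of_le o ho le_rfl)
        · rw [hinf]
          have := (hO o ho).2
          simp [Finset.sum_sub_distrib, Finset.sum_add_distrib]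
          omega
    exact key (∑ i, q i - v).toNat v le_rfl hv (by omega)

/-- The case `s = 0` of `iSup_orders`, in which an empty range of orders is allowed as well. -/
theorem iSup_orders_zero (hn : 2 ≤ n) {q : Fin n → ℤ} {j : Fin n}
    {O : Set (Fin n → ℤ)} (hO : ∀ o ∈ O, 0 ≤ o ∧ ∑ i, o i = ∑ i, q i) {v : ℤ}
    (hv : v ≤ ∑ i, q i + 1) (hM : ∀ m, v ≤ m → m ≤ ∑ i, q i → ∃ o ∈ O, o j = m)
    (hge : ∀ o ∈ O, v ≤ o j) :
    ⨆ o ∈ O, T.L (q - o) = T.L (q - Pi.single j v) := by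
  rcases hv.eq_or_lt with h | h
  · have hbot : T.L (q - Pi.single j v) = ⊥ :=
      T.eq_bot _ (by simp [Finset.sum_sub_distrib]; omega)
    rw [hbot]
    refine le_bot_iff.1 (iSup₂_le fun o ho => ?_)
    exfalso
    have h1 := hge o ho
    have h2 := (hO o ho).2
    have h3 : o j ≤ ∑ i, o i :=
      Finset.single_le_sum (fun l _ => (hO o ho).1 l) (Finset.mem_univ j)
    omega
  · simpa using T.iSup_orders hn (s := 0) (q := q) (by simp) hO (by omega) hM hge

/-- A monomial section of `L a` which does not vanish at `j` spans a complement of the sections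
vanishing there; the line it spans is `L b`. -/
theorem le_sup_of_apply_eq {a b : Fin n → ℤ} {j : Fin n}
    (h : ∑ i, b i = 0) (hb : b ≤ a) (hj : b j = a j) :
    T.L a ≤ T.L (a - Pi.single j 1) ⊔ T.L b := by
  have h1 : ∑ i, (-b) i = 0 := by simpa using h
  have h2 := T.le_sup_span (a := a - Pi.single j 1) (i := j) (g := T.mon (-b))
    (by
      rw [T.mon_mem_iff h1, sub_add_cancel]
      intro i; simpa using hb i)
    (by
      rw [T.mon_mem_iff h1]
      intro hcon
      have := hcon j
      simp [hj] at this)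
  rw [sub_add_cancel] at h2
  rw [h2]
  refine sup_le_sup_left ?_ _
  rw [Submodule.span_singleton_le_iff_mem, T.mon_mem_iff h1]
  simp

/-- The monomials with the prescribed orders of vanishing span, together with `V q F`, all of
`L q`. The line spanned by the section with divisor of zeros `o` is `L (q - o)`. -/
theorem V_sup_orders (hn : 2 ≤ n) (hn4 : n ≤ 4) {q : Fin n → ℤ} {F : Finset (Finset (Fin n))}
    {j : Fin n} {M : Set ℤ} (hNO : NewOrders (∑ i, q i) F j M)
    (hirr : ∀ F', ¬ MergeStep (∑ i, q i) F F') (hF : ∀ A ∈ F, (A.card : ℤ) ≤ ∑ i, q i)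
    {O : Set (Fin n → ℤ)} (hO : ∀ o ∈ O, 0 ≤ o ∧ ∑ i, o i = ∑ i, q i)
    (hM : (fun o => o j) '' O = M) :
    T.V q F ⊔ ⨆ o ∈ O, T.L (q - o) = T.L q := by
  have hle : T.V q F ⊔ ⨆ o ∈ O, T.L (q - o) ≤ T.L q := by
    refine sup_le (T.V_le q F) (iSup₂_le fun o ho => T.mono fun i => ?_)
    simpa using (hO o ho).1 i
  refine le_antisymm hle ?_
  have hmem : ∀ m ∈ M, ∃ o ∈ O, o j = m := by
    rw [← hM]; rintro m ⟨o, ho, rfl⟩; exact ⟨o, ho, rfl⟩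
  have hmem' : ∀ o ∈ O, o j ∈ M := fun o ho => hM ▸ ⟨o, ho, rfl⟩
  -- the generators of high order span a full space of sections vanishing at `P_j`
  have htop : ∀ v, v ≤ ∑ i, q i + 1 → (∀ m, v ≤ m → m ≤ ∑ i, q i → m ∈ M) →
      T.L (q - Pi.single j v) ≤ ⨆ o ∈ O, T.L (q - o) := by
    intro v hv h
    rw [← T.iSup_orders_zero hn (O := {o ∈ O | v ≤ o j}) (fun o ho => hO o ho.1) hv
      (fun m h1 h2 => ?_) (fun o ho => ho.2)]
    · exact iSup₂_le fun o ho => le_iSup₂_of_le o ho.1 le_rfl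
    · obtain ⟨o, ho, hoj⟩ := hmem m (h m h1 h2)
      exact ⟨o, ⟨ho, hoj ▸ h1⟩, hoj⟩
  cases hNO with
  | none =>
    by_cases hr : ∑ i, q i < 0
    · rw [T.eq_bot q hr]; exact bot_le
    · have := htop 0 (by omega) (fun m h1 h2 => ⟨h1, h2⟩)
      rw [Pi.single_zero, sub_zero] at this
      exact this.trans le_sup_right
  | all => rw [T.V_singleton, sub_ind_empty]; exact le_sup_left
  | one A j hj =>
    -- the sections of high order at `P_j` merge with `V` to give all sections vanishing at `P_j`,
    -- and the monomial of order zero supplies the rest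
    have hA := hF A (Finset.mem_singleton_self A)
    have hA0 : 1 ≤ A.card := Finset.card_pos.2 ⟨j, hj⟩
    have h1 := htop (∑ i, q i - A.card + 2) (by omega) (fun m h1 h2 => Or.inr ⟨h1, h2⟩)
    obtain ⟨o, ho, hoj⟩ := hmem 0 (Or.inl rfl)
    rw [T.V_singleton]
    have hinf : ∑ i, (q - ind A - Pi.single j (∑ i, q i - A.card + 1) : Fin n → ℤ) i
        ≤ ∑ i, ((q - ind A) ⊓ (q - Pi.single j (∑ i, q i - A.card + 2))) i := by
      refine Finset.sum_le_sum fun i _ => ?_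
      have := ind_nonneg A i
      by_cases hi : i = j
      · subst hi; simp [ind_of_mem hj]; omega
      · simp [hi, this]
    have h2 : T.L (q - Pi.single j 1) ≤ T.L (q - ind A) ⊔ ⨆ o ∈ O, T.L (q - o) := by
      refine le_trans ?_ (sup_le_sup_left h1 _)
      rw [T.sup_eq hn]
      · refine T.mono fun i => ?_
        have := ind_nonneg A i
        by_cases hi : i = j
        · subst hi; simp [ind_of_mem hj]
        · simp [hi]
      · refine le_trans ?_ hinf
        simp only [Pi.sub_apply, Finset.sum_sub_distrib, sum_ind, Finset.sum_pi_single',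
          Finset.mem_univ, if_true]
        simp
    have h3 := T.le_sup_of_apply_eq (a := q) (b := q - o) (j := j)
      (by simp [Finset.sum_sub_distrib, (hO o ho).2]) (sub_le_self q (hO o ho).1)
      (by simp [hoj])
    refine h3.trans (sup_le h2 ?_)
    exact le_sup_of_le_right (le_iSup₂_of_le o ho le_rfl)
  | two A B j hB hjA hjB =>
    have hne : A ≠ B := fun h => hjB (h ▸ hjA)
    obtain ⟨h1, h2, h3, h4⟩ := irreducible_pair hn4 hirr hF (A := A) (B := B) (by simp) (by simp) hne
    -- here the monomials of order `2` merge with `V_A` to the sections vanishing at `P_j`, and these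
    -- merge with `V_B`
    have h5 := htop 2 (by omega) (fun m hm1 hm2 => ⟨by omega, hm2⟩)
    rw [T.V_pair]
    have h6 : T.L (q - Pi.single j 1) ≤ T.L (q - ind A) ⊔ T.L (q - Pi.single j 2) := by
      rw [T.sup_eq hn]
      · refine T.mono fun i => ?_
        by_cases hi : i = j
        · subst hi; simp [ind_of_mem hjA]
        · simp [hi]
      · have : ∑ i, (q - ind A - Pi.single j 1 : Fin n → ℤ) i
            ≤ ∑ i, ((q - ind A) ⊓ (q - Pi.single j 2)) i := by
          refine Finset.sum_le_sum fun i _ => ?_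
          have := ind_nonneg A i
          by_cases hi : i = j
          · subst hi; simp [ind_of_mem hjA]; omega
          · simp [hi, this]
        refine le_trans ?_ this
        simp only [Pi.sub_apply, Finset.sum_sub_distrib, sum_ind]
        simp
        omega
    have h7 : T.L q ≤ T.L (q - ind B) ⊔ T.L (q - Pi.single j 1) := by
      rw [T.sup_eq hn]
      · refine T.mono fun i => ?_
        have := ind_nonneg B i
        by_cases hi : i = j
        · subst hi; simp [ind_of_notMem hjB]
        · simp [hi]
      · have : ∑ i, (q - ind B - Pi.single j 1 : Fin n → ℤ) i
            ≤ ∑ i, ((q - ind B) ⊓ (q - Pi.single j 1)) i := by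
          refine Finset.sum_le_sum fun i _ => ?_
          have := ind_nonneg B i
          by_cases hi : i = j
          · subst hi; simp [ind_of_notMem hjB]
          · simp [hi, this]
        refine le_trans ?_ this
        simp only [Pi.sub_apply, Finset.sum_sub_distrib, sum_ind]
        simp
        omega
    refine h7.trans (sup_le (le_sup_right.trans le_sup_left) (h6.trans (sup_le ?_ ?_)))
    · exact le_sup_left.trans le_sup_left
    · exact h5.trans le_sup_right

/-- The number of new monomials does not exceed the codimension of `V q F`, so that there is no
superfluous one. -/
theorem finrank_V_add_ncard_le (hn : 2 ≤ n) (hn4 : n ≤ 4) {q : Fin n → ℤ} (hq : 0 ≤ ∑ i, q i)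
    {F : Finset (Finset (Fin n))}
    {j : Fin n} {M : Set ℤ} (hNO : NewOrders (∑ i, q i) F j M)
    (hirr : ∀ F', ¬ MergeStep (∑ i, q i) F F') (hF : ∀ A ∈ F, (A.card : ℤ) ≤ ∑ i, q i) :
    (Module.finrank k (T.V q F) + M.ncard : ℤ) ≤ ∑ i, q i + 1 := by
  have hfin : ∀ A : Finset (Fin n), (A.card : ℤ) ≤ ∑ i, q i →
      (Module.finrank k (T.L (q - ind A)) : ℤ) = ∑ i, q i + 1 - A.card := by
    intro A hA
    rw [(T.finrank_eq hn (a := q - ind A) (N := (∑ i, q i + 1 - A.card).toNat) ?_).2]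
    · omega
    · simp only [Pi.sub_apply, Finset.sum_sub_distrib, sum_ind]; omega
  have hIcc : ∀ a b : ℤ, (Set.Icc a b).ncard = (b + 1 - a).toNat := by
    intro a b
    rw [← Finset.coe_Icc, Set.ncard_coe_finset, Int.card_Icc]
  cases hNO with
  | none =>
    rw [T.V_empty, finrank_bot, hIcc]; omega
  | all =>
    rw [T.V_singleton, hfin ∅ (by simpa using hq)]; simp
  | one A j hj =>
    have hA := hF A (Finset.mem_singleton_self A)
    have hA0 : 1 ≤ A.card := Finset.card_pos.2 ⟨j, hj⟩
    have := Set.ncard_insert_le 0 (Set.Icc (∑ i, q i - A.card + 2) (∑ i, q i))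
    rw [hIcc] at this
    rw [T.V_singleton, hfin A hA]
    omega
  | two A B j hB hjA hjB =>
    have hne : A ≠ B := fun h => hjB (h ▸ hjA)
    obtain ⟨h1, h2, h3, h4⟩ := irreducible_pair hn4 hirr hF (A := A) (B := B) (by simp) (by simp) hne
    have h5 := hfin A (by omega)
    have h6 := hfin B (by omega)
    have := (T.finrank_eq hn (a := q - ind A) (N := 1)
      (by simp only [Pi.sub_apply, Finset.sum_sub_distrib, sum_ind]; omega)).1
    have := (T.finrank_eq hn (a := q - ind B) (N := 1)
      (by simp only [Pi.sub_apply, Finset.sum_sub_distrib, sum_ind]; omega)).1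
    have h7 := Submodule.finrank_add_le_finrank_add_finrank (T.L (q - ind A)) (T.L (q - ind B))
    rw [T.V_pair, hIcc]
    omega

end SectionSystem

/-! ### Monomials in a stable system -/

section Stable

variable {n N : ℕ} {α : Fin n → ℚ} {d : Fin N → ℕ} {c : Fin N → Fin n → ℤ}

/-- The spaces attached to the members of `pregenFamily` have nonnegative degree, being products of
nonzero spaces. -/
theorem pregenFamily_card_le (α : Fin n → ℚ) (e : ℕ) :
    ∀ A ∈ pregenFamily α e, (A.card : ℤ) ≤ floorDeg α e := by
  intro A hA
  obtain ⟨c, hc, rfl⟩ := Finset.mem_image.1 hA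
  obtain ⟨hc1, hc2, hc3⟩ := Finset.mem_filter.1 hc
  have hce : c ≤ e := (Finset.mem_Icc.1 hc1).2.trans (Nat.div_le_self e 2)
  have := congrArg (fun x : Fin n → ℤ => ∑ i, x i) (fl_add_fl α hce)
  simp only [Pi.add_apply, Pi.sub_apply, Finset.sum_add_distrib, Finset.sum_sub_distrib, sum_fl,
    sum_ind] at this
  omega

variable (h : IsStableSystem α d c)
include h

theorem IsStableSystem.order_nonneg (a : Fin N) : 0 ≤ fl α (d a) + c a := fun i => by
  have := h.section_nonneg a i
  rw [sectionOrder, add_comm] at this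
  exact this

theorem IsStableSystem.sum_order (a : Fin N) :
    ∑ i, (fl α (d a) + c a) i = floorDeg α (d a) := by
  simp [Finset.sum_add_distrib, h.sum_zero, sum_fl]

theorem IsStableSystem.floorDeg_nonneg (a : Fin N) : 0 ≤ floorDeg α (d a) := by
  rw [← h.sum_order a]
  exact Finset.sum_nonneg fun i _ => h.order_nonneg a i

/-- The generators that precede `g_b` in its degree have at `P_j` exactly the orders from some
`v ≥ 1` on. Either `v` exceeds the order of `g_b` by one, or `g_b` is the last generator, of order
zero, of a degree in which the simplified family is `{A}`; then there is a gap of length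
`r - |A| + 1` between the two orders. -/
theorem IsStableSystem.earlier_orders (b : Fin N) :
    ∃ (j : Fin n) (v : ℤ), 1 ≤ v ∧
      (∀ a, a < b → d a = d b → v ≤ (fl α (d a) + c a) j) ∧
      (∀ m, v ≤ m → m ≤ floorDeg α (d b) → ∃ a < b, d a = d b ∧ (fl α (d a) + c a) j = m) ∧
      (v = (fl α (d b) + c b) j + 1 ∨
        (fl α (d b) + c b) j = 0 ∧ ∃ A : Finset (Fin n), j ∈ A ∧
          (A.card : ℤ) ≤ floorDeg α (d b) ∧ v = floorDeg α (d b) - A.card + 2 ∧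
          IsReduction (floorDeg α (d b)) (pregenFamily α (d b)) {A}) := by
  obtain ⟨F, j, M, hred, hNO, hlt, hM⟩ := h.recipe (d b) (h.pos b)
  have hcard := hred.card_le (pregenFamily_card_le α (d b))
  have hord : ∀ a, d a = d b → sectionOrder α (d b) (c a) j = (fl α (d a) + c a) j := by
    intro a ha
    rw [sectionOrder, ← ha, add_comm]; rfl
  have hmem : ∀ a, d a = d b → (fl α (d a) + c a) j ∈ M := fun a ha =>
    hM ▸ ⟨a, ha, hord a ha⟩
  have hgt : ∀ a, a < b → d a = d b → (fl α (d b) + c b) j < (fl α (d a) + c a) j := by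
    intro a hab ha
    rw [← hord a ha, ← hord b rfl]
    exact hlt a b ha rfl hab
  have hex : ∀ m ∈ M, (fl α (d b) + c b) j < m →
      ∃ a < b, d a = d b ∧ (fl α (d a) + c a) j = m := by
    intro m hm hlt'
    rw [← hM] at hm
    obtain ⟨a, ha, rfl⟩ := hm
    rw [hord a ha] at hlt' ⊢
    refine ⟨a, ?_, ha, rfl⟩
    rcases lt_trichotomy a b with hab | rfl | hab
    · exact hab
    · exact absurd hlt' (lt_irrefl _)
    · have := hlt b a rfl ha hab
      rw [hord a ha, hord b rfl] at this
      omega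
  have hb := hmem b rfl
  have hb0 : 0 ≤ (fl α (d b) + c b) j := h.order_nonneg b j
  have hfirst : (∀ m, (fl α (d b) + c b) j + 1 ≤ m → m ≤ floorDeg α (d b) → m ∈ M) →
      ∃ v : ℤ, 1 ≤ v ∧
      (∀ a, a < b → d a = d b → v ≤ (fl α (d a) + c a) j) ∧
      (∀ m, v ≤ m → m ≤ floorDeg α (d b) → ∃ a < b, d a = d b ∧ (fl α (d a) + c a) j = m) ∧
      (v = (fl α (d b) + c b) j + 1 ∨
        (fl α (d b) + c b) j = 0 ∧ ∃ A : Finset (Fin n), j ∈ A ∧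
          (A.card : ℤ) ≤ floorDeg α (d b) ∧ v = floorDeg α (d b) - A.card + 2 ∧
          IsReduction (floorDeg α (d b)) (pregenFamily α (d b)) {A}) := fun hall =>
    ⟨_, by omega, fun a hab ha => hgt a hab ha,
      fun m h1 h2 => hex m (hall m h1 h2) (by omega), Or.inl rfl⟩
  refine ⟨j, ?_⟩
  cases hNO with
  | none => exact hfirst fun m h1 h2 => ⟨by omega, h2⟩
  | all => exact absurd hb (Set.notMem_empty _)
  | one A j hj =>
    have hA := hcard A (Finset.mem_singleton_self A)
    rcases hb with hb | hb
    · refine ⟨floorDeg α (d b) - A.card + 2, by omega, ?_, ?_, Or.inr ⟨hb, A, hj, hA, rfl, hred⟩⟩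
      · intro a hab ha
        rcases hmem a ha with h0 | h0
        · have := hgt a hab ha
          omega
        · exact h0.1
      · exact fun m h1 h2 => hex m (Or.inr ⟨h1, h2⟩) (by omega)
    · exact hfirst fun m h1 h2 => Or.inr ⟨by have := hb.1; omega, h2⟩
  | two A B j hB hjA hjB =>
    exact hfirst fun m h1 h2 => ⟨by have := hb.1; omega, h2⟩

end Stable

theorem fl_add_le {n : ℕ} (α : Fin n → ℚ) (e f : ℕ) : fl α e + fl α f ≤ fl α (e + f) := by
  intro i
  have := Int.le_floor_add ((e : ℚ) * α i) ((f : ℚ) * α i)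
  rw [← add_mul, ← Nat.cast_add] at this
  exact this

namespace SectionSystem

variable {n : ℕ} {k K : Type*} [Field k] [Field K] [Algebra k K] (T : SectionSystem n k K)
variable {N : ℕ} {α : Fin n → ℚ} {d : Fin N → ℕ} {c : Fin N → Fin n → ℤ}

/-- The value `∏_a mon(c_a) ^ m_a` of the monomial with exponent `m`, without the power of `u`. -/
def x (c : Fin N → Fin n → ℤ) (m : Fin N →₀ ℕ) : K := T.mon (Finsupp.weight c m)

theorem x_zero : T.x c 0 = 1 := by simp [x, T.mon_zero]

theorem x_add (m m' : Fin N →₀ ℕ) : T.x c (m + m') = T.x c m * T.x c m' := by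
  simp [x, T.mon_add]

theorem x_single (a : Fin N) : T.x c (Finsupp.single a 1) = T.mon (c a) := by
  simp [x, Finsupp.weight_single]

theorem mon_mem (h : IsStableSystem α d c) (a : Fin N) : T.mon (c a) ∈ T.L (fl α (d a)) :=
  (T.mon_mem_iff (h.sum_zero a)).2 (h.order_nonneg a)

theorem x_mem (h : IsStableSystem α d c) (m : Fin N →₀ ℕ) :
    T.x c m ∈ T.L (fl α (Finsupp.weight d m)) := by
  induction m using Finsupp.induction_linear with
  | zero => simpa [x_zero, fl_zero] using T.one_mem
  | add m m' h1 h2 =>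
    rw [x_add, map_add]
    exact T.mono (fl_add_le α _ _) (T.mul_mem _ _ _ _ h1 h2)
  | single a t =>
    induction t with
    | zero => simpa [x_zero, fl_zero] using T.one_mem
    | succ t ih =>
      rw [Finsupp.single_add, x_add, map_add, x_single]
      refine T.mono (fl_add_le α _ _) (T.mul_mem _ _ _ _ ih ?_)
      simpa [Finsupp.weight_single] using T.mon_mem h a

theorem L_neg (hn : 2 ≤ n) {c : Fin n → ℤ} (hc : ∑ i, c i = 0) :
    T.L (-c) = Submodule.span k {T.mon c} := by
  have := T.map_mon hc 0
  rw [T.L_zero hn, Submodule.map_span] at this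
  simpa using this.symm

/-- The sections of degree `e` are spanned by those generated in smaller degrees and by the
generators of degree `e`. -/
theorem L_eq_V_sup (hn : 2 ≤ n) (hn4 : n ≤ 4) (h : IsStableSystem α d c) {e : ℕ} (he : 1 ≤ e) :
    T.L (fl α e) = T.V (fl α e) (pregenFamily α e) ⊔
      Submodule.span k ((fun a => T.mon (c a)) '' {a | d a = e}) := by
  obtain ⟨F, j, M, hred, hNO, hlt, hM⟩ := h.recipe e he
  have := T.V_sup_orders hn hn4 (q := fl α e) (F := F) (j := j) (M := M)
    (O := (fun a => fl α (d a) + c a) '' {a | d a = e}) hNO hred.2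
    (hred.card_le (pregenFamily_card_le α e)) ?_ ?_
  · have hV : T.V (fl α e) (pregenFamily α e) = T.V (fl α e) F :=
      T.V_isReduction hn (E := fl α e) hred
    rw [← this, hV, iSup_image]
    congr 1
    have hL : ∀ a ∈ {a | d a = e}, T.L (fl α e - (fl α (d a) + c a))
        = Submodule.span k {T.mon (c a)} := by
      rintro a rfl
      rw [sub_add_cancel_left, T.L_neg hn (h.sum_zero a)]
    rw [biSup_congr hL]
    apply le_antisymm
    · exact iSup₂_le fun a ha => Submodule.span_mono (Set.singleton_subset_iff.2 ⟨a, ha, rfl⟩)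
    · rw [Submodule.span_le]
      rintro _ ⟨a, ha, rfl⟩
      exact (le_iSup₂ (f := fun a (_ : a ∈ {a | d a = e}) => Submodule.span k {T.mon (c a)}) a ha)
        (Submodule.mem_span_singleton_self _)
  · rintro _ ⟨a, rfl, rfl⟩
    exact ⟨h.order_nonneg a, h.sum_order a⟩
  · rw [← hM, Set.image_image]
    ext m
    simp only [Set.mem_image, Set.mem_ofPred_eq, sectionOrder]
    refine exists_congr fun a => and_congr_right fun ha => ?_
    rw [ha, Pi.add_apply, add_comm]; rfl

theorem L_drop (hn : 2 ≤ n) {e c : ℕ} (hce : c ≤ e) (h1 : 0 ≤ floorDeg α c)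
    (h2 : 0 ≤ floorDeg α (e - c)) :
    T.L (fl α c) * T.L (fl α (e - c)) = T.L (fl α e - ind (dropSet α e c)) := by
  rw [T.mul_eq hn (a := fl α c) (b := fl α (e - c)) h1 h2, fl_add_fl α hce]

/-- The ring of sections is generated by the stable generators, degree by degree. -/
theorem L_eq_span (hn : 2 ≤ n) (hn4 : n ≤ 4) (h : IsStableSystem α d c) (e : ℕ) :
    T.L (fl α e) = Submodule.span k (T.x c '' {m | Finsupp.weight d m = e}) := by
  apply le_antisymm
  · induction e using Nat.strong_induction_on with
    | _ e ih =>
      rcases Nat.eq_zero_or_pos e with rfl | he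
      · rw [fl_zero, T.L_zero hn]
        exact Submodule.span_mono (Set.singleton_subset_iff.2 ⟨0, by simp, T.x_zero⟩)
      · rw [T.L_eq_V_sup hn hn4 h he]
        refine sup_le (iSup₂_le fun A hA => ?_) (Submodule.span_mono ?_)
        · obtain ⟨l, hl, rfl⟩ := Finset.mem_image.1 hA
          obtain ⟨hl1, hl2, hl3⟩ := Finset.mem_filter.1 hl
          have hl1 := Finset.mem_Icc.1 hl1
          rw [← T.L_drop hn (by omega) hl2 hl3]
          refine (mul_le_mul' (ih l (by omega)) (ih (e - l) (by omega))).trans ?_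
          rw [Submodule.span_mul_span]
          refine Submodule.span_mono ?_
          rintro _ ⟨_, ⟨m, hm, rfl⟩, _, ⟨m', hm', rfl⟩, rfl⟩
          refine ⟨m + m', ?_, T.x_add m m'⟩
          simp only [Set.mem_ofPred_eq, map_add] at hm hm' ⊢
          omega
        · rintro _ ⟨a, ha, rfl⟩
          refine ⟨Finsupp.single a 1, ?_, T.x_single a⟩
          simpa [Finsupp.weight_single] using ha
  · rw [Submodule.span_le]
    rintro _ ⟨m, rfl, rfl⟩
    exact T.x_mem h m

/-- The part of degree `e` of the ideal generated by the generators which precede `g_b`. -/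
def J (α : Fin n → ℚ) (d : Fin N → ℕ) (c : Fin N → Fin n → ℤ) (b : Fin N) (e : ℕ) :
    Submodule k K := ⨆ a ∈ {a | a < b ∧ d a ≤ e}, T.L (fl α (e - d a) - c a)

theorem map_mon_gen (h : IsStableSystem α d c) (a : Fin N) (s : Fin n → ℤ) :
    (T.L s).map (LinearMap.mulLeft k (T.mon (c a))) = T.L (s - c a) :=
  T.map_mon (h.sum_zero a) s

end SectionSystem

/-- The index sets `A` for which `H⁰(⌊e D⌋ - ∑_{i ∈ A} Pᵢ)` is a product `S_l S_{e-l}` with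
`1 ≤ l < δ`. -/
def lowerFamily {n : ℕ} (α : Fin n → ℚ) (δ e : ℕ) : Finset (Finset (Fin n)) :=
  {l ∈ Finset.Ico 1 δ | 0 ≤ floorDeg α l ∧ 0 ≤ floorDeg α (e - l)}.image (dropSet α e)

namespace SectionSystem

variable {n : ℕ} {k K : Type*} [Field k] [Field K] [Algebra k K] (T : SectionSystem n k K)
variable {N : ℕ} {α : Fin n → ℚ} {d : Fin N → ℕ} {c : Fin N → Fin n → ℤ}

/-- The generators of degree less than `d b` generate a sum of spaces of the form `V`, and those
of degree `d b` that precede `g_b` are kept separate. -/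
theorem J_eq (hn : 2 ≤ n) (hn4 : n ≤ 4) (h : IsStableSystem α d c) (b : Fin N) {e : ℕ}
    (he : d b ≤ e) :
    T.J α d c b e = T.V (fl α e) (lowerFamily α (d b) e) ⊔
      ⨆ a ∈ {a | a < b ∧ d a = d b}, T.L (fl α (e - d b) - c a) := by
  apply le_antisymm
  · refine iSup₂_le fun a ha => ?_
    obtain ⟨hab, hae⟩ := ha
    rcases (h.mono hab.le).eq_or_lt with hd | hd
    · refine le_sup_of_le_right ?_
      rw [hd]
      exact le_iSup₂ (f := fun a (_ : a ∈ {a | a < b ∧ d a = d b}) =>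
        T.L (fl α (e - d b) - c a)) a ⟨hab, hd⟩
    · refine le_sup_of_le_left ?_
      by_cases hr : 0 ≤ floorDeg α (e - d a)
      · refine le_iSup₂_of_le (dropSet α e (d a)) (Finset.mem_image.2 ⟨d a, ?_, rfl⟩) ?_
        · rw [Finset.mem_filter, Finset.mem_Ico]
          exact ⟨⟨h.pos a, hd⟩, h.floorDeg_nonneg a, hr⟩
        · rw [← fl_add_fl α hae]
          refine T.mono fun i => ?_
          have := h.order_nonneg a i
          simp only [Pi.sub_apply, Pi.add_apply, Pi.zero_apply] at this ⊢
          omega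
      · rw [T.eq_bot]
        · exact bot_le
        · simp only [Pi.sub_apply, Finset.sum_sub_distrib, h.sum_zero, sum_fl]
          omega
  · refine sup_le (iSup₂_le fun A hA => ?_) (iSup₂_le fun a ha => ?_)
    · obtain ⟨l, hl, rfl⟩ := Finset.mem_image.1 hA
      obtain ⟨hl1, hl2, hl3⟩ := Finset.mem_filter.1 hl
      have hl1 := Finset.mem_Ico.1 hl1
      rw [← T.L_drop hn (by omega) hl2 hl3, T.L_eq_span hn hn4 h l,
        T.L_eq_span hn hn4 h (e - l), Submodule.span_mul_span, Submodule.span_le]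
      rintro _ ⟨_, ⟨m, hm, rfl⟩, _, ⟨m', hm', rfl⟩, rfl⟩
      simp only [Set.mem_ofPred_eq] at hm hm'
      -- some generator `g_a` divides the first factor, and it has degree at most `l`
      obtain ⟨a, ha⟩ : ∃ a, m a ≠ 0 := by
        by_contra! hcon
        have : m = 0 := Finsupp.ext hcon
        rw [this, map_zero] at hm
        omega
      obtain ⟨m₀, rfl⟩ : ∃ m₀, m = Finsupp.single a 1 + m₀ :=
        ⟨m - Finsupp.single a 1, (add_tsub_cancel_of_le (by
          rw [Finsupp.single_le_iff]; omega)).symm⟩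
      have hw : Finsupp.weight d (Finsupp.single a 1) = d a := by simp [Finsupp.weight_single]
      rw [map_add, hw] at hm
      have hab : a < b := by
        by_contra hcon
        have := h.mono (not_lt.1 hcon)
        omega
      refine (le_iSup₂ (f := fun a (_ : a ∈ {a | a < b ∧ d a ≤ e}) =>
        T.L (fl α (e - d a) - c a)) a ⟨hab, by omega⟩) ?_
      rw [← T.map_mon_gen h]
      refine ⟨T.x c (m₀ + m'), ?_, ?_⟩
      · have := T.x_mem h (m₀ + m')
        rwa [map_add, hm', show Finsupp.weight d m₀ + (e - l) = e - d a by omega] at this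
      · simp only [x_add, x_single, LinearMap.mulLeft_apply]
        ring
    · obtain ⟨hab, hd⟩ := ha
      rw [← hd]
      exact le_iSup₂ (f := fun a (_ : a ∈ {a | a < b ∧ d a ≤ e}) =>
        T.L (fl α (e - d a) - c a)) a ⟨hab, by omega⟩

/-- No generator is superfluous: by dimension count, the generators of a given degree are a basis
modulo what is generated in smaller degrees. -/
theorem mon_notMem (hn : 2 ≤ n) (hn4 : n ≤ 4) (h : IsStableSystem α d c) (b : Fin N) :
    T.mon (c b) ∉ T.V (fl α (d b)) (pregenFamily α (d b)) ⊔
      Submodule.span k ((fun a => T.mon (c a)) '' {a | d a = d b ∧ a ≠ b}) := by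
  classical
  intro hcon
  have hL := T.L_eq_V_sup hn hn4 h (h.pos b)
  obtain ⟨F, j, M, hred, hNO, hlt, hM⟩ := h.recipe (d b) (h.pos b)
  have hV : T.V (fl α (d b)) (pregenFamily α (d b)) = T.V (fl α (d b)) F :=
    T.V_isReduction hn (E := fl α (d b)) hred
  have hdim := T.finrank_V_add_ncard_le hn hn4 (q := fl α (d b)) (h.floorDeg_nonneg b)
    hNO hred.2 (hred.card_le (pregenFamily_card_le α _))
  rw [← hV] at hdim
  -- the number of generators of degree `d b`
  have hMc : M.ncard = (Finset.univ.filter fun a => d a = d b).card := by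
    have : M = (fun a => sectionOrder α (d b) (c a) j) '' {a | d a = d b} := by
      rw [← hM]; rfl
    rw [this, Set.InjOn.ncard_image, Set.ncard_eq_toFinset_card']
    · congr 1; ext a; simp
    · intro a ha a' ha' heq
      by_contra hne
      rcases lt_or_gt_of_ne hne with hl | hl
      · exact absurd heq (hlt a a' ha ha' hl).ne'
      · exact absurd heq (hlt a' a ha' ha hl).ne
  have hset : ((fun a => T.mon (c a)) '' {a | d a = d b ∧ a ≠ b}) =
      (((Finset.univ.filter fun a => d a = d b).erase b).image fun a => T.mon (c a) : Finset K) := by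
    ext y; simp
  have hspan : Module.finrank k
      (Submodule.span k ((fun a => T.mon (c a)) '' {a | d a = d b ∧ a ≠ b})) + 1 ≤ M.ncard := by
    rw [hset, hMc]
    refine (Nat.add_le_add_right ((finrank_span_finset_le_card _).trans Finset.card_image_le) 1).trans ?_
    rw [Finset.card_erase_add_one (by simp)]
  have htop : T.L (fl α (d b)) ≤ T.V (fl α (d b)) (pregenFamily α (d b)) ⊔
      Submodule.span k ((fun a => T.mon (c a)) '' {a | d a = d b ∧ a ≠ b}) := by
    rw [hL]
    refine sup_le le_sup_left ?_
    rw [Submodule.span_le]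
    rintro _ ⟨a, ha, rfl⟩
    by_cases hab : a = b
    · rw [hab]; exact hcon
    · exact Submodule.mem_sup_right (Submodule.subset_span ⟨a, ⟨ha, hab⟩, rfl⟩)
  have h0 := h.floorDeg_nonneg b
  have hfr := T.finrank_eq hn (a := fl α (d b)) (N := (floorDeg α (d b) + 1).toNat) (by
    rw [sum_fl]; omega)
  have := hfr.1
  have : FiniteDimensional k (T.V (fl α (d b)) (pregenFamily α (d b))) :=
    Submodule.finiteDimensional_of_le (T.V_le _ _)
  have : FiniteDimensional k
      (Submodule.span k ((fun a => T.mon (c a)) '' {a | d a = d b ∧ a ≠ b})) :=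
    FiniteDimensional.span_of_finite k (Set.toFinite _)
  have h1 := Submodule.finrank_mono htop
  have h2 := Submodule.finrank_add_le_finrank_add_finrank
    (T.V (fl α (d b)) (pregenFamily α (d b)))
    (Submodule.span k ((fun a => T.mon (c a)) '' {a | d a = d b ∧ a ≠ b}))
  rw [sum_fl] at hdim
  omega

end SectionSystem

/-! ### Colon spaces -/

namespace SectionSystem

variable {n : ℕ} {k K : Type*} [Field k] [Field K] [Algebra k K] (T : SectionSystem n k K)
variable {s q o : Fin n → ℤ} {Δ : Finset (Fin n)}

theorem mon_mul_mem_iff_inf (hc : ∑ i, (o - q) i = 0) {y : K} (hy : y ∈ T.L s) {a t : Fin n → ℤ}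
    (ht : s ⊓ (a + (o - q)) = t) : T.mon (o - q) * y ∈ T.L a ↔ y ∈ T.L t := by
  rw [T.mon_mul_mem _ hc, ← ht, ← T.inf_eq, Submodule.mem_inf]
  exact (and_iff_right hy).symm

/-- The colon of a single space by the section with divisor of zeros `o`. Here `y` is a section of
`O(s)`, the monomial `mon (o - q)` is the section of `O(q)` with divisor `o`, and their product is
regarded as a section of `O(s + q + Δ)`. -/
theorem colon_single (ho : 0 ≤ o) (hc : ∑ i, (o - q) i = 0) {y : K} (hy : y ∈ T.L s)
    (A : Finset (Fin n)) : T.mon (o - q) * y ∈ T.L (s + q + ind Δ - ind A) ↔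
      y ∈ T.L (s - ind {i ∈ A | i ∉ Δ ∧ o i = 0}) := by
  apply T.mon_mul_mem_iff_inf hc hy
  funext i
  have h0 := ho i
  simp only [Pi.zero_apply] at h0
  by_cases hA : i ∈ A <;> by_cases hΔ : i ∈ Δ <;> by_cases hoi : o i = 0 <;>
    simp [ind, hA, hΔ, hoi] <;> omega

theorem mon_mul_mem_of_le (hc : ∑ i, (o - q) i = 0) {y : K} (hy : y ∈ T.L s)
    {a : Fin n → ℤ} (ha : s + q - o ≤ a) : T.mon (o - q) * y ∈ T.L a := by
  rw [T.mon_mul_mem _ hc]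
  refine T.mono ?_ hy
  intro i
  have := ha i
  simp only [Pi.sub_apply, Pi.add_apply] at this ⊢
  omega

/-- The product with a section of order `v - 1` at `j` has order at least `v` iff the other factor
vanishes at `j`. -/
theorem colon_top (ho : 0 ≤ o) (hc : ∑ i, (o - q) i = 0) {y : K} (hy : y ∈ T.L s)
    {j : Fin n} {v : ℤ} (hv : v = o j + 1) :
    T.mon (o - q) * y ∈ T.L (s + q - Pi.single j v) ↔ y ∈ T.L (s - ind {j}) := by
  apply T.mon_mul_mem_iff_inf hc hy
  funext i
  have h0 := ho i
  simp only [Pi.zero_apply] at h0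
  by_cases hi : i = j
  · subst hi; simp [ind, hv]; omega
  · simp [ind, hi]; omega

/-- If the intersection of `L a` with the sections of order at least `v = o j + 1` at `j` has degree
at most `-2`, then `L a` does not contribute to the colon: it meets the sections of order at least
`v - 1`, among which are all multiples of `mon (o - q)`, in zero only. -/
theorem colon_sup_of_le (ho : 0 ≤ o) (hc : ∑ i, (o - q) i = 0) {y : K} (hy : y ∈ T.L s)
    {j : Fin n} {v : ℤ} (hv : v = o j + 1) {a : Fin n → ℤ}
    (ha : ∑ i, (a ⊓ (s + q - Pi.single j v)) i ≤ -2) :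
    T.mon (o - q) * y ∈ T.L a ⊔ T.L (s + q - Pi.single j v) ↔ y ∈ T.L (s - ind {j}) := by
  rw [← T.colon_top ho hc hy hv]
  refine ⟨fun h => ?_, fun h => Submodule.mem_sup_right h⟩
  obtain ⟨w, hw, z, hz, hwz⟩ := Submodule.mem_sup.1 h
  have hle : s + q - o ≤ s + q - Pi.single j (v - 1) := fun i => by
    have h0 := ho i
    simp only [Pi.zero_apply] at h0
    by_cases hi : i = j
    · subst hi; simp [hv]
    · simp [hi, h0]
  have hle' : s + q - Pi.single j v ≤ s + q - Pi.single j (v - 1) := fun i => by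
    by_cases hi : i = j
    · subst hi; simp; omega
    · simp [hi]
  have hw' : w ∈ T.L (s + q - Pi.single j (v - 1)) := by
    rw [eq_sub_of_add_eq hwz]
    exact Submodule.sub_mem _ (T.mon_mul_mem_of_le hc hy hle) (T.mono hle' hz)
  have hw0 : w ∈ T.L a ⊓ T.L (s + q - Pi.single j (v - 1)) := ⟨hw, hw'⟩
  rw [T.inf_eq, T.eq_bot, Submodule.mem_bot] at hw0
  · rw [← hwz, hw0, zero_add]; exact hz
  · have : ∑ i, (a ⊓ (s + q - Pi.single j (v - 1))) i ≤
        ∑ i, (a ⊓ (s + q - Pi.single j v) + Pi.single j 1 : Fin n → ℤ) i := by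
      refine Finset.sum_le_sum fun i _ => ?_
      by_cases hi : i = j
      · subst hi; simp; omega
      · simp [hi]
    rw [Finset.sum_congr rfl fun i _ => Pi.add_apply _ _ i, Finset.sum_add_distrib] at this
    simp at this ha ⊢
    omega

/-- If the two spaces merge, the colon is again computed point by point. -/
theorem colon_sup (hn : 2 ≤ n) (ho : 0 ≤ o) (hc : ∑ i, (o - q) i = 0) {y : K} (hy : y ∈ T.L s)
    {j : Fin n} {v : ℤ} (hv : 1 ≤ v) (A : Finset (Fin n))
    (hA : -1 ≤ ∑ i, ((s + q + ind Δ - ind A) ⊓ (s + q - Pi.single j v)) i) :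
    T.mon (o - q) * y ∈ T.L (s + q + ind Δ - ind A) ⊔ T.L (s + q - Pi.single j v) ↔
      y ∈ T.L (s - ind {i ∈ A | i = j ∧ i ∉ Δ ∧ o i = 0}) := by
  rw [T.sup_eq hn hA]
  apply T.mon_mul_mem_iff_inf hc hy
  funext i
  have h0 := ho i
  simp only [Pi.zero_apply] at h0
  by_cases hi : i = j
  · subst hi
    by_cases hA : i ∈ A <;> by_cases hΔ : i ∈ Δ <;> by_cases hoi : o i = 0 <;>
      simp [ind, hA, hΔ, hoi] <;> omega
  · by_cases hA : i ∈ A <;> by_cases hΔ : i ∈ Δ <;>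
      simp [ind, hA, hΔ, hi] <;> omega

theorem V_sub (hc : ∑ i, (o - q) i = 0) (F : Finset (Finset (Fin n))) :
    T.V (s - (o - q)) F = (T.V s F).map (LinearMap.mulLeft k (T.mon (o - q))) := by
  simp only [V, Submodule.map_iSup, T.map_mon hc]
  refine iSup_congr fun A => iSup_congr fun _ => ?_
  rw [sub_right_comm]

/-- The colon of two complementary conditions, if the section or `Δ` already satisfies the first
one at some point `i ∈ A`: an element of the sum is then a multiple of the section only if its
second component vanishes, for reasons of degree. -/
theorem colon_pair (ho : 0 ≤ o) (hc : ∑ i, (o - q) i = 0) {y : K} (hy : y ∈ T.L s)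
    {A : Finset (Fin n)} {i : Fin n} (hi : i ∈ A) (hG : 1 ≤ ind Δ i + o i)
    (hE : ∑ l, (s + q + ind Δ) l ≤ Aᶜ.card) :
    T.mon (o - q) * y ∈ T.L (s + q + ind Δ - ind A) ⊔ T.L (s + q + ind Δ - ind Aᶜ) ↔
      y ∈ T.L (s - ind {i ∈ A | i ∉ Δ ∧ o i = 0}) := by
  rw [← T.colon_single ho hc hy A]
  refine ⟨fun h => ?_, fun h => Submodule.mem_sup_left h⟩
  obtain ⟨w, hw, z, hz, hwz⟩ := Submodule.mem_sup.1 h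
  have h1 : T.mon (o - q) * y ∈ T.L (s + q + ind Δ - Pi.single i 1) := by
    refine T.mon_mul_mem_of_le hc hy fun l => ?_
    have h0 := ho l
    simp only [Pi.zero_apply] at h0
    have := ind_nonneg Δ l
    by_cases hl : l = i
    · subst hl; simp; omega
    · simp [hl]; omega
  have h2 : w ∈ T.L (s + q + ind Δ - Pi.single i 1) := by
    refine T.mono (fun l => ?_) hw
    have := ind_nonneg A l
    by_cases hl : l = i
    · subst hl; simp [ind_of_mem hi]
    · simp [hl]; omega
  have hz0 : z ∈ T.L (s + q + ind Δ - ind Aᶜ) ⊓ T.L (s + q + ind Δ - Pi.single i 1) := by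
    refine ⟨hz, ?_⟩
    rw [eq_sub_of_add_eq' hwz]
    exact Submodule.sub_mem _ h1 h2
  rw [T.inf_eq, T.eq_bot, Submodule.mem_bot] at hz0
  · rw [← hwz, hz0, add_zero]; exact hw
  · have : (s + q + ind Δ - ind Aᶜ) ⊓ (s + q + ind Δ - Pi.single i 1)
        = s + q + ind Δ - ind Aᶜ - Pi.single i 1 := by
      funext l
      by_cases hl : l = i
      · subst hl; simp [ind, hi]
      · have := ind_nonneg Aᶜ l
        simp [hl, this]
    rw [this]
    rw [Finset.sum_congr rfl fun l _ => Pi.sub_apply _ _ l, Finset.sum_sub_distrib,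
      Finset.sum_congr rfl fun l _ => Pi.sub_apply _ _ l, Finset.sum_sub_distrib, sum_ind]
    simp at hE ⊢
    omega

/-- In degree `2`, the sections vanishing on one of the complementary pairs `A = {i, j}` and `Aᶜ`,
together with those vanishing on `Δ` and to order `v` at `j`, span everything if `i ∉ Δ`. If
`i ∈ Δ`, the latter already vanish on `A`. -/
theorem pair_sup_top (hn : 2 ≤ n) {A : Finset (Fin n)} {j i : Fin n} {v : ℤ} (hA : A = {i, j})
    (hij : i ≠ j) (hiΔ : i ∉ Δ) (hv : 1 ≤ v) (hE : ∑ l, (s + q + ind Δ) l = 2)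
    (hAc : Aᶜ.card = 2) (hsum : (Δ.card : ℤ) + v ≤ 2) :
    T.L (s + q + ind Δ) ≤ T.L (s + q + ind Δ - ind A) ⊔ T.L (s + q + ind Δ - ind Aᶜ) ⊔
      T.L (s + q - Pi.single j v) := by
  have hjA : j ∈ A := by simp [hA]
  have h1 : T.L (s + q + ind Δ - Pi.single j 1) ≤
      T.L (s + q + ind Δ - ind A) ⊔ T.L (s + q - Pi.single j v) := by
    rw [T.sup_eq hn]
    · refine T.mono fun l => ?_
      by_cases hl : l = j
      · subst hl; simp [ind_of_mem hjA]
      · by_cases hl' : l = i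
        · subst hl'; simp [hl, ind_of_notMem hiΔ]
        · have : l ∉ A := by simp [hA, hl, hl']
          simp [hl, ind_of_notMem this]
    · have : ∑ l, (s + q - Pi.single j v - Pi.single i 1 : Fin n → ℤ) l ≤
          ∑ l, ((s + q + ind Δ - ind A) ⊓ (s + q - Pi.single j v)) l := by
        refine Finset.sum_le_sum fun l _ => ?_
        have h0 := ind_nonneg Δ l
        by_cases hl : l = j
        · subst hl; simp [ind_of_mem hjA, hij.symm]; omega
        · by_cases hl' : l = i
          · subst hl'; simp [hl, ind_of_notMem hiΔ]; have := ind_le_one A l; omega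
          · have : l ∉ A := by simp [hA, hl, hl']
            simp [hl, hl', ind_of_notMem this, h0]
      refine le_trans ?_ this
      simp only [Pi.add_apply, Finset.sum_add_distrib, sum_ind] at hE
      simp [Finset.sum_sub_distrib, Finset.sum_add_distrib]
      omega
  have h2 : T.L (s + q + ind Δ) ≤
      T.L (s + q + ind Δ - ind Aᶜ) ⊔ T.L (s + q + ind Δ - Pi.single j 1) := by
    rw [T.sup_eq hn]
    · refine T.mono fun l => ?_
      by_cases hl : l = j
      · subst hl; simp [ind, hjA]
      · simp [hl]
    · have : ∑ l, (s + q + ind Δ - ind Aᶜ - Pi.single j 1 : Fin n → ℤ) l ≤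
          ∑ l, ((s + q + ind Δ - ind Aᶜ) ⊓ (s + q + ind Δ - Pi.single j 1)) l := by
        refine Finset.sum_le_sum fun l _ => ?_
        have h0 := ind_nonneg Aᶜ l
        by_cases hl : l = j
        · subst hl; simp [ind, hjA]
        · simp [hl, h0]
      refine le_trans ?_ this
      rw [Finset.sum_congr rfl fun l _ => Pi.sub_apply _ _ l, Finset.sum_sub_distrib,
        Finset.sum_congr rfl fun l _ => Pi.sub_apply _ _ l, Finset.sum_sub_distrib, hE, sum_ind, hAc]
      simp
  refine h2.trans (sup_le (le_sup_right.trans le_sup_left) (h1.trans (sup_le ?_ le_sup_right)))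
  exact le_sup_left.trans le_sup_left

end SectionSystem

/-! ### The colon of a family by a generator is a family -/

section Colon

variable {n : ℕ} {s q o : Fin n → ℤ} {Δ : Finset (Fin n)}

/-- The colon of `V E F`, for a simplified family `F`, by a monomial section is of the form `V s F'`,
with `F'` independent of the field and the points. -/
theorem exists_colon_V (ho : 0 ≤ o) (hc : ∑ i, (o - q) i = 0) {F : Finset (Finset (Fin n))}
    (hcases : F = ∅ ∨ (∃ A, F = {A}) ∨ ∃ A B, F = {A, B} ∧ ∑ i, (s + q + ind Δ) i = 2 ∧
      A.card = 2 ∧ B.card = 2 ∧ B = Aᶜ) :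
    ∃ F' : Finset (Finset (Fin n)), ∀ (k K : Type u) [Field k] [Field K] [Algebra k K]
      (T : SectionSystem n k K), ∀ y ∈ T.L s,
        (T.mon (o - q) * y ∈ T.V (s + q + ind Δ) F ↔ y ∈ T.V s F') := by
  rcases hcases with rfl | ⟨A, rfl⟩ | ⟨A, B, rfl, hE, hA, hB, rfl⟩
  · refine ⟨∅, fun k K _ _ _ T y hy => ?_⟩
    simp [T.V_empty, T.mon_ne_zero]
  · refine ⟨{({i ∈ A | i ∉ Δ ∧ o i = 0} : Finset (Fin n))}, fun k K _ _ _ T y hy => ?_⟩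
    rw [T.V_singleton, T.V_singleton, T.colon_single ho hc hy]
  · by_cases hG : ∃ i, 1 ≤ ind Δ i + o i
    · obtain ⟨i, hi⟩ := hG
      by_cases hiA : i ∈ A
      · refine ⟨{({i ∈ A | i ∉ Δ ∧ o i = 0} : Finset (Fin n))}, fun k K _ _ _ T y hy => ?_⟩
        rw [T.V_singleton, T.V_pair, T.colon_pair ho hc hy hiA hi (by omega)]
      · refine ⟨{({i ∈ Aᶜ | i ∉ Δ ∧ o i = 0} : Finset (Fin n))}, fun k K _ _ _ T y hy => ?_⟩
        have := T.colon_pair ho hc hy (Finset.mem_compl.2 hiA) hi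
          (by rw [compl_compl]; omega)
        rw [compl_compl, sup_comm] at this
        rw [T.V_singleton, T.V_pair, this]
    · push Not at hG
      have hEs : s + q + ind Δ = s - (o - q) := by
        funext i
        have h1 := hG i
        have h2 := ho i
        have h3 := ind_nonneg Δ i
        simp only [Pi.zero_apply, Pi.add_apply, Pi.sub_apply] at h2 ⊢
        omega
      refine ⟨{A, Aᶜ}, fun k K _ _ _ T y hy => ?_⟩
      rw [hEs, T.V_sub hc, Submodule.mem_map]
      constructor
      · rintro ⟨z, hz, hzy⟩
        rw [LinearMap.mulLeft_apply] at hzy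
        rwa [← mul_left_cancel₀ T.mon_ne_zero hzy]
      · exact fun h => ⟨y, h, rfl⟩

/-- The same with the sections of order at least `v` at `j` added, which are the products with the
preceding generators of the same degree. The hypothesis `hlast` reflects the two cases of
`IsStableSystem.earlier_orders`; in the second one, the sections vanishing on `A` are products of
sections of smaller degrees and already lie in `V E F`. -/
theorem exists_colon_V_sup (hn : 2 ≤ n) (ho : 0 ≤ o) (hsumo : ∑ i, o i = ∑ i, q i)
    (hs : 0 ≤ ∑ i, s i) {F : Finset (Finset (Fin n))}
    (hcases : F = ∅ ∨ (∃ A, F = {A}) ∨ ∃ A B, F = {A, B} ∧ ∑ i, (s + q + ind Δ) i = 2 ∧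
      A.card = 2 ∧ B.card = 2 ∧ B = Aᶜ)
    {j : Fin n} {v : ℤ} (hv : 1 ≤ v) (hvr : v ≤ ∑ i, q i)
    (hlast : v = o j + 1 ∨ ∃ A : Finset (Fin n), j ∈ A ∧ (A.card : ℤ) ≤ ∑ i, q i ∧
      v = ∑ i, q i - A.card + 2 ∧
      ∀ (k K : Type u) [Field k] [Field K] [Algebra k K] (T : SectionSystem n k K),
        T.L (s + q - ind A) ≤ T.V (s + q + ind Δ) F) :
    ∃ F' : Finset (Finset (Fin n)), ∀ (k K : Type u) [Field k] [Field K] [Algebra k K]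
      (T : SectionSystem n k K), ∀ y ∈ T.L s,
        (T.mon (o - q) * y ∈ T.V (s + q + ind Δ) F ⊔ T.L (s + q - Pi.single j v) ↔
          y ∈ T.V s F') := by
  have hc : ∑ i, (o - q) i = 0 := by simp [Finset.sum_sub_distrib, hsumo]
  have hsq : ∀ A : Finset (Fin n), ∑ i, (s + q - ind A) i = ∑ i, s i + ∑ i, q i - A.card := by
    intro A
    simp only [Pi.sub_apply, Pi.add_apply, Finset.sum_sub_distrib, Finset.sum_add_distrib, sum_ind]
  rcases hcases with rfl | ⟨A, rfl⟩ | ⟨A, B, rfl, hE, hA, hB, rfl⟩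
  · refine ⟨{{j}}, fun k K _ _ _ T y hy => ?_⟩
    rw [T.V_empty, bot_sup_eq, T.V_singleton]
    rcases hlast with h | ⟨A, hjA, hA, hvA, hle⟩
    · exact T.colon_top ho hc hy h
    · exfalso
      obtain ⟨e, -, -, he⟩ := T.exists_mon hn (a := s + q - ind A) (by rw [hsq]; omega) j
      have := hle k K T he
      rw [T.V_empty, Submodule.mem_bot] at this
      exact T.mon_ne_zero this
  · by_cases hmerge : -1 ≤ ∑ i, ((s + q + ind Δ - ind A) ⊓ (s + q - Pi.single j v)) i
    · refine ⟨{({i ∈ A | i = j ∧ i ∉ Δ ∧ o i = 0} : Finset (Fin n))},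
        fun k K _ _ _ T y hy => ?_⟩
      rw [T.V_singleton, T.V_singleton]
      exact T.colon_sup hn ho hc hy hv A hmerge
    · refine ⟨{{j}}, fun k K _ _ _ T y hy => ?_⟩
      rw [T.V_singleton, T.V_singleton]
      rcases hlast with h | ⟨A', hjA, hA, hvA, hle⟩
      · exact T.colon_sup_of_le ho hc hy h (by omega)
      · exfalso
        -- the sections in `F` contain those vanishing on `Δ` and `A'`, hence `A ⊆ Δ ∪ A'`
        have hsub : ∀ i ∈ A, i ∉ Δ → i ∈ A' := by
          intro i hi hiΔ
          by_contra hiA'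
          obtain ⟨e, he0, hei, he⟩ := T.exists_mon hn (a := s + q - ind A') (by rw [hsq]; omega) i
          have h1 := hle k K T he
          rw [T.V_singleton, T.mon_mem_iff he0] at h1
          have h2 := h1 i
          simp [hei, ind_of_mem hi, ind_of_notMem hiΔ, ind_of_notMem hiA'] at h2
          omega
        apply hmerge
        have : ∑ i, (s + q - ind A' - Pi.single j (v - 1) : Fin n → ℤ) i ≤
            ∑ i, ((s + q + ind Δ - ind A) ⊓ (s + q - Pi.single j v)) i := by
          refine Finset.sum_le_sum fun i _ => ?_
          have h1 := ind_nonneg Δ i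
          have h2 := ind_nonneg A' i
          have h3 := ind_le_one A i
          by_cases hi : i = j
          · subst hi; simp [ind_of_mem hjA]; omega
          · by_cases hiA : i ∈ A
            · by_cases hiΔ : i ∈ Δ
              · simp [hi, ind_of_mem hiΔ, ind_of_mem hiA, h2]
              · simp [hi, ind_of_notMem hiΔ, ind_of_mem hiA, ind_of_mem (hsub i hiA hiΔ)]
            · simp [hi, ind_of_notMem hiA]; omega
        refine le_trans ?_ this
        rw [Finset.sum_congr rfl fun l _ => Pi.sub_apply _ _ l, Finset.sum_sub_distrib, hsq]
        simp
        omega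
  · have hsum : (Δ.card : ℤ) + v ≤ 2 := by
      simp only [Pi.add_apply, Finset.sum_add_distrib, sum_ind] at hE
      omega
    have main : ∀ A : Finset (Fin n), A.card = 2 → Aᶜ.card = 2 → j ∈ A →
        ∃ F' : Finset (Finset (Fin n)), ∀ (k K : Type u) [Field k] [Field K] [Algebra k K]
        (T : SectionSystem n k K), ∀ y ∈ T.L s,
        (T.mon (o - q) * y ∈ T.V (s + q + ind Δ) {A, Aᶜ} ⊔ T.L (s + q - Pi.single j v) ↔
          y ∈ T.V s F') := by
      intro A hA hAc hj
      by_cases hAsub : ∀ i ∈ A, i ≠ j → i ∈ Δ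
      · obtain ⟨F', hF'⟩ := exists_colon_V (s := s) (Δ := Δ) ho hc (F := {A, Aᶜ})
          (Or.inr (Or.inr ⟨A, Aᶜ, rfl, hE, hA, hAc, rfl⟩))
        refine ⟨F', fun k K _ _ _ T y hy => ?_⟩
        rw [← hF' k K T y hy, sup_eq_left.2]
        rw [T.V_pair]
        refine le_sup_of_le_left (T.mono fun i => ?_)
        have h1 := ind_nonneg Δ i
        by_cases hi : i = j
        · subst hi; simp [ind_of_mem hj]; omega
        · by_cases hiA : i ∈ A
          · simp [hi, ind_of_mem hiA, ind_of_mem (hAsub i hiA hi)]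
          · simp [hi, ind_of_notMem hiA, h1]
      · push Not at hAsub
        obtain ⟨i, hi, hij, hiΔ⟩ := hAsub
        have hAeq : A = {i, j} := by
          symm
          apply Finset.eq_of_subset_of_card_le
          · intro l hl
            rw [Finset.mem_insert, Finset.mem_singleton] at hl
            rcases hl with rfl | rfl <;> assumption
          · rw [hA, Finset.card_pair hij]
        refine ⟨{∅}, fun k K _ _ _ T y hy => ?_⟩
        rw [T.V_singleton, sub_ind_empty, T.V_pair]
        refine iff_of_true (T.pair_sup_top hn hAeq hij hiΔ hv hE hAc hsum ?_) hy
        refine T.mon_mul_mem_of_le hc hy fun l => ?_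
        have h0 := ho l
        have h1 := ind_nonneg Δ l
        simp only [Pi.zero_apply, Pi.add_apply, Pi.sub_apply] at h0 ⊢
        omega
    by_cases hj : j ∈ A
    · exact main A hA hB hj
    · have := main Aᶜ hB (by rwa [compl_compl]) (Finset.mem_compl.2 hj)
      rwa [compl_compl, Finset.pair_comm] at this

end Colon

section Closure

variable {n N : ℕ} {α : Fin n → ℚ} {d : Fin N → ℕ} {c : Fin N → Fin n → ℤ}

/-- If degree `δ` simplifies to `{A}`, then products of sections of degree `f` with the sections of
degree `δ` vanishing on `A` are generated by the degrees less than `δ`. -/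
theorem SectionSystem.L_le_V_lowerFamily {k K : Type*} [Field k] [Field K] [Algebra k K]
    (T : SectionSystem n k K) (hn : 2 ≤ n) {δ f : ℕ}
    (hf : 0 ≤ floorDeg α f) {A : Finset (Fin n)} (hA : (A.card : ℤ) ≤ floorDeg α δ)
    (hred : IsReduction (floorDeg α δ) (pregenFamily α δ) {A}) :
    T.L (fl α f + fl α δ - ind A) ≤ T.V (fl α (δ + f)) (lowerFamily α δ (δ + f)) := by
  have hV : T.V (fl α δ) (pregenFamily α δ) = T.V (fl α δ) {A} :=
    T.V_isReduction hn (E := fl α δ) hred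
  rw [T.V_singleton] at hV
  rw [add_sub_assoc, ← T.mul_eq hn (a := fl α f) hf (by
    simp only [Pi.sub_apply, Finset.sum_sub_distrib, sum_fl, sum_ind]; omega), ← hV]
  simp only [SectionSystem.V, Submodule.mul_iSup]
  refine iSup₂_le fun B hB => ?_
  obtain ⟨l, hl, rfl⟩ := Finset.mem_image.1 hB
  obtain ⟨hl1, hl2, hl3⟩ := Finset.mem_filter.1 hl
  have hl1 := Finset.mem_Icc.1 hl1
  have hle : fl α f + fl α (δ - l) ≤ fl α (δ + f - l) := by
    have := fl_add_le α f (δ - l)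
    rwa [show f + (δ - l) = δ + f - l by omega] at this
  have hdeg : floorDeg α f + floorDeg α (δ - l) ≤ floorDeg α (δ + f - l) := by
    rw [← sum_fl, ← sum_fl, ← sum_fl, ← Finset.sum_add_distrib]
    exact Finset.sum_le_sum fun i _ => hle i
  refine le_iSup₂_of_le (dropSet α (δ + f) l) (Finset.mem_image.2 ⟨l, ?_, rfl⟩) ?_
  · rw [Finset.mem_filter, Finset.mem_Ico]
    exact ⟨by omega, hl2, by omega⟩
  · rw [← fl_add_fl α (by omega : l ≤ δ + f), ← fl_add_fl α (by omega : l ≤ δ)]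
    refine Submodule.mul_le.2 fun y hy z hz => T.mono ?_ (T.mul_mem _ _ _ _ hy hz)
    intro i
    have := hle i
    simp only [Pi.add_apply] at this ⊢
    omega

/-- The spaces `V + J`, where `J` is the ideal of the preceding generators, are stable under taking
the colon by a generator, with a family `F'` that depends on combinatorial data only. Whether a
given monomial is initial is decided by iterating this, letter by letter. -/
theorem exists_colon (hn : 2 ≤ n) (hn4 : n ≤ 4) (h : IsStableSystem α d c) (b : Fin N) (f : ℕ)
    (F : Finset (Finset (Fin n))) :
    ∃ F' : Finset (Finset (Fin n)), ∀ (k K : Type u) [Field k] [Field K] [Algebra k K]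
      (T : SectionSystem n k K), ∀ y ∈ T.L (fl α f),
        (T.mon (c b) * y ∈ T.V (fl α (d b + f)) F ⊔ T.J α d c b (d b + f) ↔
          y ∈ T.V (fl α f) F') := by
  by_cases hf : 0 ≤ floorDeg α f
  swap
  · refine ⟨∅, fun k K _ _ _ T y hy => ?_⟩
    rw [T.eq_bot (fl α f) (not_le.1 hf), Submodule.mem_bot] at hy
    simp [hy]
  obtain ⟨j, v, hv, hge, hex, hlast⟩ := h.earlier_orders b
  set q := fl α (d b) with hq
  set s := fl α f with hs
  set o := q + c b with ho
  set Δ := dropSet α (d b + f) (d b) with hΔ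
  have hfs : 0 ≤ ∑ i, s i := hf
  have hcb : c b = o - q := by rw [ho, add_sub_cancel_left]
  have hE : fl α (d b + f) = s + q + ind Δ := by
    have := fl_add_fl α (Nat.le_add_right (d b) f)
    rw [Nat.add_sub_cancel_left] at this
    rw [hs, hq, hΔ, add_comm (fl α f), this, sub_add_cancel]
  have ho0 : 0 ≤ o := h.order_nonneg b
  have hso : ∑ i, o i = ∑ i, q i := by
    have := h.sum_order b
    exact this
  -- reduce the whole family
  obtain ⟨G, hG⟩ := exists_isReduction (∑ i, (s + q + ind Δ) i)
    ({A ∈ F ∪ lowerFamily α (d b) (d b + f) | (A.card : ℤ) ≤ ∑ i, (s + q + ind Δ) i})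
  have hGcard := hG.card_le fun A hA => (Finset.mem_filter.1 hA).2
  have hVG : ∀ (k K : Type u) [Field k] [Field K] [Algebra k K] (T : SectionSystem n k K),
      T.V (s + q + ind Δ) F ⊔ T.J α d c b (d b + f) = T.V (s + q + ind Δ) G ⊔
        ⨆ a ∈ {a | a < b ∧ d a = d b}, T.L (s - c a) := by
    intro k K _ _ _ T
    rw [← T.V_isReduction hn hG, T.V_filter, T.V_union, T.J_eq hn hn4 h b (Nat.le_add_right _ _),
      Nat.add_sub_cancel_left, ← hE, sup_assoc]
  have hlow : ∀ (k K : Type u) [Field k] [Field K] [Algebra k K] (T : SectionSystem n k K),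
      T.V (s + q + ind Δ) (lowerFamily α (d b) (d b + f)) ≤ T.V (s + q + ind Δ) G := by
    intro k K _ _ _ T
    rw [← T.V_isReduction hn hG, T.V_filter, T.V_union]
    exact le_sup_right
  have hcases := irreducible_cases hn4 hG.2 hGcard
  rw [hcb, hE]
  by_cases hvr : v ≤ ∑ i, q i
  · have hU : ∀ (k K : Type u) [Field k] [Field K] [Algebra k K] (T : SectionSystem n k K),
        ⨆ a ∈ {a | a < b ∧ d a = d b}, T.L (s - c a) = T.L (s + q - Pi.single j v) := by
      intro k K _ _ _ T
      rw [← T.iSup_orders hn (O := (fun a => fl α (d a) + c a) '' {a | a < b ∧ d a = d b}) hfs ?_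
        hvr ?_ ?_, iSup_image]
      · refine biSup_congr fun a ha => ?_
        rw [hq, ha.2]
        congr 1
        abel
      · rintro _ ⟨a, ha, rfl⟩
        refine ⟨h.order_nonneg a, ?_⟩
        rw [h.sum_order a, ha.2]; rfl
      · intro m h1 h2
        obtain ⟨a, hab, had, ham⟩ := hex m h1 h2
        exact ⟨_, ⟨a, ⟨hab, had⟩, rfl⟩, ham⟩
      · rintro _ ⟨a, ha, rfl⟩
        exact hge a ha.1 ha.2
    obtain ⟨F', hF'⟩ := exists_colon_V_sup.{u} hn ho0 hso hfs hcases hv hvr (hlast.imp_right (by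
      rintro ⟨-, A, hjA, hA, hvA, hred⟩
      refine ⟨A, hjA, hA, hvA, fun k K _ _ _ T => le_trans ?_ (hlow k K T)⟩
      rw [← hE]
      exact T.L_le_V_lowerFamily hn hf hA hred))
    refine ⟨F', fun k K _ _ _ T y hy => ?_⟩
    rw [← hF' k K T y hy, hVG, hU]
  · have hU : ∀ (k K : Type u) [Field k] [Field K] [Algebra k K] (T : SectionSystem n k K),
        ⨆ a ∈ {a | a < b ∧ d a = d b}, T.L (s - c a) = ⊥ := by
      intro k K _ _ _ T
      refine le_bot_iff.1 (iSup₂_le fun a ha => ?_)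
      exfalso
      have h1 := hge a ha.1 ha.2
      have h2 := h.sum_order a
      have h3 : (fl α (d a) + c a) j ≤ ∑ i, (fl α (d a) + c a) i :=
        Finset.single_le_sum (fun l _ => h.order_nonneg a l) (Finset.mem_univ j)
      have h4 : floorDeg α (d a) = ∑ i, q i := by rw [ha.2]; rfl
      exact hvr (h1.trans (h3.trans_eq (h2.trans h4)))
    obtain ⟨F', hF'⟩ := exists_colon_V.{u} ho0 (by rw [← hcb]; exact h.sum_zero b) hcases
    refine ⟨F', fun k K _ _ _ T y hy => ?_⟩
    rw [← hF' k K T y hy, hVG, hU, sup_bot_eq]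

end Closure

/-! ### The reverse lexicographic order on monomials of equal weight -/

section Order

variable {N : ℕ}

theorem word_zero : word (0 : Fin N →₀ ℕ) = [] := by simp [word]

theorem word_single_add {b : Fin N} {m : Fin N →₀ ℕ} (h : ∀ a, m a ≠ 0 → b ≤ a) :
    word (Finsupp.single b 1 + m) = b :: word m := by
  unfold word
  rw [map_add, Finsupp.toMultiset_single, one_smul, Multiset.singleton_add, Multiset.sort_cons]
  intro a ha
  rw [Finsupp.mem_toMultiset, Finsupp.mem_support_iff] at ha
  exact h a ha

theorem word_injective : Function.Injective (word : (Fin N →₀ ℕ) → List (Fin N)) := by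
  intro m m' h
  have := congrArg (fun l : List (Fin N) => (l : Multiset (Fin N))) h
  simp only [word, Multiset.sort_eq] at this
  exact Multiset.toFinsupp.symm.injective this

theorem exists_eq_single_add {m : Fin N →₀ ℕ} (hm : m ≠ 0) :
    ∃ (b : Fin N) (m₀ : Fin N →₀ ℕ), m = Finsupp.single b 1 + m₀ ∧ ∀ a, m a ≠ 0 → b ≤ a := by
  have hs : m.support.Nonempty := Finsupp.support_nonempty_iff.2 hm
  refine ⟨m.support.min' hs, m - Finsupp.single (m.support.min' hs) 1, ?_, ?_⟩
  · rw [add_tsub_cancel_of_le]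
    rw [Finsupp.single_le_iff]
    have := m.support.min'_mem hs
    rw [Finsupp.mem_support_iff] at this
    omega
  · intro a ha
    exact Finset.min'_le _ _ (Finsupp.mem_support_iff.2 ha)

theorem not_revLex_self (m : Fin N →₀ ℕ) : ¬ RevLex m m := fun h =>
  lt_irrefl (word m) h

theorem RevLex.trans {m m' m'' : Fin N →₀ ℕ} (h : RevLex m m') (h' : RevLex m' m'') :
    RevLex m m'' := lt_trans (a := word m) h h'

theorem RevLex.not_gt {m m' : Fin N →₀ ℕ} (h : RevLex m m') : ¬ RevLex m' m := fun h' =>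
  not_revLex_self m (h.trans h')

theorem not_revLex_zero (m : Fin N →₀ ℕ) : ¬ RevLex m 0 := by
  unfold RevLex
  rw [word_zero]
  exact List.not_lt_nil _

variable {d : Fin N → ℕ}

theorem weight_single_one (b : Fin N) : Finsupp.weight d (Finsupp.single b 1) = d b := by
  simp [Finsupp.weight_single]

theorem eq_zero_of_weight_eq_zero (hd : ∀ a, 1 ≤ d a) {m : Fin N →₀ ℕ}
    (h : Finsupp.weight d m = 0) : m = 0 := by
  by_contra hm
  obtain ⟨b, m₀, rfl, -⟩ := exists_eq_single_add hm
  rw [map_add, weight_single_one] at h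
  have := hd b
  omega

theorem revLex_of_first_diff (hd : ∀ a, 1 ≤ d a) {m m' : Fin N →₀ ℕ}
    (hw : Finsupp.weight d m = Finsupp.weight d m') {i : Fin N} (heq : ∀ j < i, m j = m' j)
    (hi : m' i < m i) : RevLex m m' := by
  induction hs : Finsupp.weight d m using Nat.strong_induction_on generalizing m m' with
  | _ w ih =>
    subst hs
    have hm : m ≠ 0 := by rintro rfl; simp at hi
    have hm' : m' ≠ 0 := by
      rintro rfl
      rw [map_zero] at hw
      exact hm (eq_zero_of_weight_eq_zero hd hw)
    obtain ⟨b, m₀, hmb, hb⟩ := exists_eq_single_add hm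
    obtain ⟨b', m₀', hmb', hb'⟩ := exists_eq_single_add hm'
    have hmbb : m b ≠ 0 := by rw [hmb]; simp
    have hmbb' : m' b' ≠ 0 := by rw [hmb']; simp
    have hword : word m = b :: word m₀ := by
      rw [hmb]
      refine word_single_add fun a ha => hb a ?_
      rw [hmb]; simp [ha]
    have hword' : word m' = b' :: word m₀' := by
      rw [hmb']
      refine word_single_add fun a ha => hb' a ?_
      rw [hmb']; simp [ha]
    have hbi : b ≤ i := hb i (by omega)
    have hbb : b ≤ b' := by
      by_contra hcon
      rw [not_le] at hcon
      have := heq b' (lt_of_lt_of_le hcon hbi)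
      exact absurd (hb b' (by omega)) (not_le.2 hcon)
    unfold RevLex
    rw [hword, hword', List.cons_lt_cons_iff]
    rcases hbb.eq_or_lt with rfl | hlt
    · right
      refine ⟨rfl, ?_⟩
      have hw1 : Finsupp.weight d m = d b + Finsupp.weight d m₀ := by
        rw [hmb, map_add, weight_single_one]
      have hw2 : Finsupp.weight d m' = d b + Finsupp.weight d m₀' := by
        rw [hmb', map_add, weight_single_one]
      have hpos := hd b
      have hw3 : Finsupp.weight d m₀ = Finsupp.weight d m₀' := by omega
      refine ih (Finsupp.weight d m₀) (by omega) hw3 (fun j hj => ?_) ?_ rfl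
      · have := heq j hj
        rw [hmb, hmb'] at this
        simpa using this
      · rw [hmb, hmb'] at hi
        simpa using hi
    · exact Or.inl hlt

theorem exists_first_diff {m m' : Fin N →₀ ℕ} (h : m ≠ m') :
    ∃ i, (∀ j < i, m j = m' j) ∧ m i ≠ m' i := by
  have hne : (Finset.univ.filter fun i => m i ≠ m' i).Nonempty := by
    by_contra hcon
    rw [Finset.not_nonempty_iff_eq_empty, Finset.filter_eq_empty_iff] at hcon
    exact h (Finsupp.ext fun i => by simpa using hcon (Finset.mem_univ i))
  refine ⟨Finset.min' _ hne, fun j hj => ?_, (Finset.mem_filter.1 (Finset.min'_mem _ hne)).2⟩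
  by_contra hcon
  exact absurd (Finset.min'_le _ j (by simpa using hcon)) (not_le.2 hj)

/-- On monomials of equal weight the order of words is the reverse lexicographic order of exponent
vectors, which is invariant under translation. Without the weights one word may be a proper
prefix of the other, and the equivalence fails. -/
theorem revLex_iff (hd : ∀ a, 1 ≤ d a) {m m' : Fin N →₀ ℕ}
    (hw : Finsupp.weight d m = Finsupp.weight d m') :
    RevLex m m' ↔ ∃ i, (∀ j < i, m j = m' j) ∧ m' i < m i := by
  constructor
  · intro h
    have hne : m ≠ m' := by rintro rfl; exact not_revLex_self m h
    obtain ⟨i, hi, hi'⟩ := exists_first_diff hne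
    rcases lt_or_gt_of_ne hi' with hlt | hlt
    · exact absurd h (revLex_of_first_diff hd hw.symm (fun j hj => (hi j hj).symm) hlt).not_gt
    · exact ⟨i, hi, hlt⟩
  · rintro ⟨i, hi, hi'⟩
    exact revLex_of_first_diff hd hw hi hi'

theorem RevLex.add_left (hd : ∀ a, 1 ≤ d a) {m m' : Fin N →₀ ℕ}
    (hw : Finsupp.weight d m = Finsupp.weight d m') (h : RevLex m m') (l : Fin N →₀ ℕ) :
    RevLex (l + m) (l + m') := by
  obtain ⟨i, hi, hi'⟩ := (revLex_iff hd hw).1 h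
  refine (revLex_iff hd (by rw [map_add, map_add, hw])).2 ⟨i, fun j hj => ?_, ?_⟩
  · simp [hi j hj]
  · simpa using hi'

end Order

/-! ### Standard monomials do not depend on the field and the points -/

namespace SectionSystem

variable {n : ℕ} {k K : Type*} [Field k] [Field K] [Algebra k K] (T : SectionSystem n k K)
variable {N : ℕ} {α : Fin n → ℚ} {d : Fin N → ℕ} {c : Fin N → Fin n → ℤ}

/-- The span of the values of the monomials of the same weight which are smaller than `m`. -/
def W (d : Fin N → ℕ) (c : Fin N → Fin n → ℤ) (m : Fin N →₀ ℕ) : Submodule k K :=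
  Submodule.span k (T.x c '' {m' | RevLex m' m ∧ Finsupp.weight d m' = Finsupp.weight d m})

theorem W_le (h : IsStableSystem α d c) (m : Fin N →₀ ℕ) :
    T.W d c m ≤ T.L (fl α (Finsupp.weight d m)) := by
  rw [W, Submodule.span_le]
  rintro _ ⟨m', ⟨-, hm'⟩, rfl⟩
  rw [← hm']
  exact T.x_mem h m'

/-- The monomials below `x_b x^m`, with `b` the first letter, are those starting with a smaller
letter, whose values span `J`, and the products of `x_b` with monomials below `x^m`. -/
theorem W_single_add (hn : 2 ≤ n) (hn4 : n ≤ 4) (h : IsStableSystem α d c) {b : Fin N}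
    {m : Fin N →₀ ℕ} (hb : ∀ a, m a ≠ 0 → b ≤ a) :
    T.W d c (Finsupp.single b 1 + m) = T.J α d c b (d b + Finsupp.weight d m) ⊔
      (T.W d c m).map (LinearMap.mulLeft k (T.mon (c b))) := by
  apply le_antisymm
  · rw [W, Submodule.span_le]
    rintro _ ⟨m', ⟨hlt, hw⟩, rfl⟩
    rw [map_add, weight_single_one] at hw
    have hpos := h.pos b
    obtain ⟨b', m₀, rfl, hb'⟩ := exists_eq_single_add (m := m') (by
      rintro rfl; rw [map_zero] at hw; omega)
    rw [map_add, weight_single_one] at hw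
    have hlt' := hlt
    unfold RevLex at hlt'
    rw [word_single_add hb, word_single_add (fun a ha => hb' a (by simp [ha])),
      List.cons_lt_cons_iff] at hlt'
    rw [x_add, x_single]
    rcases hlt' with hlt' | ⟨rfl, hlt'⟩
    · refine Submodule.mem_sup_left ?_
      refine (le_iSup₂ (f := fun a (_ : a ∈ {a | a < b ∧ d a ≤ d b + Finsupp.weight d m}) =>
        T.L (fl α (d b + Finsupp.weight d m - d a) - c a)) b' ⟨hlt', by omega⟩) ?_
      rw [← T.map_mon_gen h, ← hw, Nat.add_sub_cancel_left]
      exact ⟨_, T.x_mem h m₀, rfl⟩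
    · exact Submodule.mem_sup_right ⟨T.x c m₀,
        Submodule.subset_span ⟨m₀, ⟨hlt', by omega⟩, rfl⟩, rfl⟩
  · refine sup_le (iSup₂_le fun a ha => ?_) ?_
    · rw [← T.map_mon_gen h, T.L_eq_span hn hn4 h, Submodule.map_span, Submodule.span_le]
      rintro _ ⟨_, ⟨m', hm', rfl⟩, rfl⟩
      have hm' : Finsupp.weight d m' = d b + Finsupp.weight d m - d a := hm'
      have ha1 := ha.1
      have ha2 := ha.2
      refine Submodule.subset_span ⟨Finsupp.single a 1 + m', ⟨?_, ?_⟩, ?_⟩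
      · have hw : Finsupp.weight d (Finsupp.single a 1 + m')
            = Finsupp.weight d (Finsupp.single b 1 + m) := by
          rw [map_add, map_add, weight_single_one, weight_single_one]; omega
        -- the first letter of the word of `x_a x^{m'}` is at most `a < b`
        obtain ⟨b', m₀, heq, hb'⟩ := exists_eq_single_add
          (m := Finsupp.single a 1 + m') (by
            intro h0
            have := DFunLike.congr_fun h0 a
            simp at this)
        have hba : b' ≤ a := hb' a (by simp)
        rw [heq]
        unfold RevLex
        rw [word_single_add hb, word_single_add (fun a ha => hb' a (by rw [heq]; simp [ha])),
          List.cons_lt_cons_iff]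
        exact Or.inl (lt_of_le_of_lt hba ha1)
      · rw [map_add, map_add, weight_single_one, weight_single_one]; omega
      · rw [x_add, x_single]; rfl
    · rw [W, Submodule.map_span, Submodule.span_le]
      rintro _ ⟨_, ⟨m', ⟨hlt, hw⟩, rfl⟩, rfl⟩
      refine Submodule.subset_span ⟨Finsupp.single b 1 + m', ⟨hlt.add_left h.pos hw _, ?_⟩, ?_⟩
      · rw [map_add, map_add, hw]
      · rw [x_add, x_single]; rfl

end SectionSystem

/-- Whether the value of `x^m` is a combination of the values of smaller monomials, modulo the
sections of a family `F`, depends on neither the field nor the points. The induction removes the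
first letter of `m` and replaces `F` by its colon; it is the reason for carrying `F` along. -/
theorem exists_mem_V_sup_W_iff {n N : ℕ} {α : Fin n → ℚ} {d : Fin N → ℕ} {c : Fin N → Fin n → ℤ}
    (hn : 2 ≤ n) (hn4 : n ≤ 4) (h : IsStableSystem α d c) (m : Fin N →₀ ℕ)
    (F : Finset (Finset (Fin n))) :
    ∃ t : Prop, ∀ (k K : Type u) [Field k] [Field K] [Algebra k K] (T : SectionSystem n k K),
      T.x c m ∈ T.V (fl α (Finsupp.weight d m)) F ⊔ T.W d c m ↔ t := by
  induction hw : Finsupp.weight d m using Nat.strong_induction_on generalizing m F with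
  | _ w ih =>
    subst hw
    by_cases hm : m = 0
    · subst hm
      refine ⟨∅ ∈ F, fun k K _ _ _ T => ?_⟩
      have hW : T.W d c (0 : Fin N →₀ ℕ) = ⊥ := by
        rw [SectionSystem.W, Submodule.span_eq_bot]
        rintro _ ⟨m', ⟨hlt, -⟩, rfl⟩
        exact absurd hlt (not_revLex_zero m')
      rw [hW, sup_bot_eq, T.x_zero, map_zero, fl_zero]
      constructor
      · intro h1
        by_contra hF
        have : T.V 0 F = ⊥ := by
          refine le_bot_iff.1 (iSup₂_le fun A hA => ?_)
          have hA0 : 0 < A.card := Finset.card_pos.2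
            (Finset.nonempty_iff_ne_empty.2 fun h0 => hF (h0 ▸ hA))
          rw [T.eq_bot _ (by
            simp only [Pi.sub_apply, Finset.sum_sub_distrib, sum_ind]
            simp; exact Finset.card_pos.1 hA0)]
        rw [this, Submodule.mem_bot] at h1
        exact one_ne_zero h1
      · intro hF
        refine (le_iSup₂ (f := fun A (_ : A ∈ F) => T.L (0 - ind A)) ∅ hF) ?_
        rw [sub_ind_empty]
        exact T.one_mem
    · obtain ⟨b, m₀, rfl, hb⟩ := exists_eq_single_add hm
      have hb0 : ∀ a, m₀ a ≠ 0 → b ≤ a := fun a ha => hb a (by simp [ha])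
      obtain ⟨F', hF'⟩ := exists_colon.{u} hn hn4 h b (Finsupp.weight d m₀) F
      have hpos := h.pos b
      obtain ⟨t, ht⟩ := ih (Finsupp.weight d m₀)
        (by rw [map_add, weight_single_one]; omega) m₀ F' rfl
      refine ⟨t, fun k K _ _ _ T => ?_⟩
      rw [← ht k K T, T.W_single_add hn hn4 h hb0, map_add, weight_single_one, ← sup_assoc,
        T.x_add, T.x_single]
      constructor
      · intro hmem
        obtain ⟨y, hy, z, ⟨w, hw, rfl⟩, hyz⟩ := Submodule.mem_sup.1 hmem
        rw [LinearMap.mulLeft_apply] at hyz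
        have h1 : T.x c m₀ - w ∈ T.L (fl α (Finsupp.weight d m₀)) :=
          Submodule.sub_mem _ (T.x_mem h m₀) (T.W_le h m₀ hw)
        have h2 := (hF' k K T _ h1).1 (by rwa [mul_sub, ← hyz, add_sub_cancel_right])
        rw [← sub_add_cancel (T.x c m₀) w]
        exact Submodule.add_mem_sup h2 hw
      · intro hmem
        obtain ⟨y, hy, w, hw, hyw⟩ := Submodule.mem_sup.1 hmem
        rw [← hyw, mul_add]
        refine Submodule.add_mem_sup ?_ ⟨w, hw, rfl⟩
        exact (hF' k K T y (T.V_le _ _ hy)).2 hy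

/-! ### Sections on the projective line -/

section Line

variable {k : Type u} [Field k]

theorem rationalPoint_injective : Function.Injective (rationalPoint : OnePoint k → ClosedPoint k) := by
  intro x y h
  rcases x with _ | a <;> rcases y with _ | b
  · rfl
  · exact absurd h (by simp [rationalPoint])
  · exact absurd h (by simp [rationalPoint])
  · have h1 : Ideal.span {(Polynomial.X - Polynomial.C a : k[X])} =
        Ideal.span {Polynomial.X - Polynomial.C b} := by
      have := Option.some.inj h
      exact congrArg IsDedekindDomain.HeightOneSpectrum.asIdeal this
    have h2 : (Polynomial.X - Polynomial.C a : k[X]) ∈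
        Ideal.span {(Polynomial.X - Polynomial.C b : k[X])} := h1 ▸ Ideal.mem_span_singleton_self _
    rw [Ideal.mem_span_singleton, Polynomial.dvd_iff_isRoot, Polynomial.IsRoot, Polynomial.eval_sub,
      Polynomial.eval_X, Polynomial.eval_C, sub_eq_zero] at h2
    rw [h2]

theorem linSection_ne_zero (s : kˣ) (p : OnePoint k) : linSection s p ≠ 0 := by
  have hs : RatFunc.C (s : k) ≠ 0 := by simp
  rcases p with _ | a
  · exact hs
  · refine mul_ne_zero hs ?_
    rw [← RatFunc.algebraMap_X, ← RatFunc.algebraMap_C, ← map_sub]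
    exact (map_ne_zero_iff _ (RatFunc.algebraMap_injective k)).2 (Polynomial.X_sub_C_ne_zero a)

open Classical in
theorem val_C {t : k} (ht : t ≠ 0) (x : ClosedPoint k) : val x (RatFunc.C t) = 1 := by
  rcases x with _ | v
  · exact RatFunc.inftyValuation.C k ht
  · change v.valuation (RatFunc k) (RatFunc.C t) = 1
    rw [← RatFunc.algebraMap_C, IsDedekindDomain.HeightOneSpectrum.valuation_eq_one_iff_notMem]
    intro h
    exact v.isPrime.ne_top (Ideal.eq_top_of_isUnit_mem _ h (by simpa using ht))

open Classical in
/-- The affine expression of `tᵢ` has divisor `Pᵢ - ∞`. -/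
theorem val_linSection (s : kˣ) (p : OnePoint k) (x : ClosedPoint k) :
    val x (linSection s p) = WithZero.exp
      ((if x = none then 1 else 0) - if rationalPoint p = x then 1 else 0 : ℤ) := by
  have hs : (s : k) ≠ 0 := s.ne_zero
  rcases p with _ | a
  · change val x (RatFunc.C (s : k)) = _
    rw [val_C hs]
    rcases x with _ | v <;> simp [rationalPoint]
  · change val x (RatFunc.C (s : k) * (RatFunc.X - RatFunc.C a)) = _
    rw [map_mul, val_C hs, one_mul, ← RatFunc.algebraMap_X, ← RatFunc.algebraMap_C, ← map_sub]
    rcases x with _ | v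
    · change RatFunc.inftyValuationDef k _ = _
      rw [RatFunc.inftyValuation.polynomial k (Polynomial.X_sub_C_ne_zero a)]
      simp [rationalPoint]
    · change v.valuation (RatFunc k) _ = _
      by_cases hv : rationalPoint (some a) = some v
      · have hv' : v.asIdeal = Ideal.span {Polynomial.X - Polynomial.C a} := by
          rw [← Option.some.inj hv]
        rw [IsDedekindDomain.HeightOneSpectrum.valuation_of_algebraMap,
          v.intValuation_singleton (Polynomial.X_sub_C_ne_zero a) hv', if_pos hv]
        simp
      · rw [if_neg hv]
        simp only [reduceCtorEq, if_false, sub_zero, WithZero.exp_zero]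
        rw [IsDedekindDomain.HeightOneSpectrum.valuation_eq_one_iff_notMem]
        intro hmem
        apply hv
        have hmax : (Ideal.span {(Polynomial.X - Polynomial.C a : k[X])}).IsMaximal :=
          PrincipalIdealRing.isMaximal_of_irreducible (Polynomial.irreducible_X_sub_C a)
        have := hmax.eq_of_le v.isPrime.ne_top
          ((Ideal.span_singleton_le_iff_mem _).2 hmem)
        exact congrArg some (IsDedekindDomain.HeightOneSpectrum.ext this)

open Classical in
/-- The residue field at a rational point is `k`. -/
theorem exists_val_sub_lt_one (p : OnePoint k) {h : RatFunc k}
    (hh : val (rationalPoint p) h ≤ 1) :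
    ∃ t : k, val (rationalPoint p) (h - RatFunc.C t) < 1 := by
  rcases p with _ | a
  · change RatFunc.inftyValuation k h ≤ 1 at hh
    change ∃ t : k, RatFunc.inftyValuation k (h - RatFunc.C t) < 1
    by_cases h0 : RatFunc.inftyValuation k h < 1
    · exact ⟨0, by simpa using h0⟩
    have h1 : RatFunc.inftyValuation k h = 1 := le_antisymm hh (not_lt.1 h0)
    have hne : h ≠ 0 := by rintro rfl; simp at h1
    have hdeg : h.num.natDegree = h.denom.natDegree := by
      rw [RatFunc.inftyValuation_apply, RatFunc.inftyValuation_of_nonzero k hne,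
        WithZero.exp_eq_one] at h1
      rw [RatFunc.intDegree] at h1
      omega
    refine ⟨h.num.leadingCoeff, ?_⟩
    have hd0 : (algebraMap k[X] (RatFunc k)) h.denom ≠ 0 := by simpa using h.denom_ne_zero
    have heq : h - RatFunc.C h.num.leadingCoeff =
        algebraMap k[X] (RatFunc k) (h.num - Polynomial.C h.num.leadingCoeff * h.denom) /
          algebraMap k[X] (RatFunc k) h.denom := by
      rw [eq_div_iff hd0, sub_mul, map_sub, map_mul, RatFunc.algebraMap_C]
      congr 1
      conv_lhs => rw [← RatFunc.num_div_denom h]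
      rw [RatFunc.num_div_denom]
      nth_rewrite 1 [← RatFunc.num_div_denom h]
      exact div_mul_cancel₀ _ hd0
    rw [heq, map_div₀]
    by_cases hz : h.num - Polynomial.C h.num.leadingCoeff * h.denom = 0
    · simp [hz]
    · have hnum0 : h.num ≠ 0 := by simpa using hne
      have hlt : (h.num - Polynomial.C h.num.leadingCoeff * h.denom).natDegree
          < h.denom.natDegree := by
        rw [← hdeg]
        apply Polynomial.natDegree_lt_natDegree hz
        apply Polynomial.degree_sub_lt_left _ hnum0
        · rw [Polynomial.leadingCoeff_mul, Polynomial.leadingCoeff_C, (RatFunc.monic_denom h), mul_one]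
        · rw [Polynomial.degree_C_mul (by simpa using hne), Polynomial.degree_eq_natDegree hnum0,
            Polynomial.degree_eq_natDegree h.denom_ne_zero, hdeg]
      rw [RatFunc.inftyValuation_apply, RatFunc.inftyValuation_apply,
        RatFunc.inftyValuation.polynomial k hz, RatFunc.inftyValuation.polynomial k h.denom_ne_zero,
        div_lt_one₀ (by simp)]
      simpa using hlt
  · obtain ⟨v, hv⟩ : ∃ v, rationalPoint (some a) = some v := ⟨_, rfl⟩
    have hva : v.asIdeal = Ideal.span {Polynomial.X - Polynomial.C a} := by
      rw [← Option.some.inj hv]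
    rw [hv] at hh ⊢
    change v.valuation (RatFunc k) h ≤ 1 at hh
    change ∃ t : k, v.valuation (RatFunc k) (h - RatFunc.C t) < 1
    obtain ⟨r, hr⟩ := v.exists_valuation_sub_lt_of_integer hh 1
    refine ⟨r.eval a, ?_⟩
    have h2 : v.valuation (RatFunc k) (algebraMap k[X] (RatFunc k) (r - Polynomial.C (r.eval a))) < 1 := by
      rw [IsDedekindDomain.HeightOneSpectrum.valuation_lt_one_iff_mem, hva,
        Ideal.mem_span_singleton, Polynomial.dvd_iff_isRoot]
      simp
    have heq : h - RatFunc.C (r.eval a) =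
        algebraMap k[X] (RatFunc k) (r - Polynomial.C (r.eval a)) -
          (algebraMap k[X] (RatFunc k) r - h) := by
      rw [map_sub, RatFunc.algebraMap_C]; ring
    rw [heq]
    exact (Valuation.map_sub _ _ _).trans_lt (max_lt h2 (by simpa using hr))

variable {n : ℕ} (P : Fin n → OnePoint k)

/-- The `ℤ`-divisor `∑ aᵢ Pᵢ`. -/
def pointDiv (a : Fin n → ℤ) : ClosedPoint k →₀ ℤ :=
  ∑ i, Finsupp.single (rationalPoint (P i)) (a i)

open Classical in
theorem pointDiv_apply (a : Fin n → ℤ) (x : ClosedPoint k) :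
    pointDiv P a x = ∑ i, if rationalPoint (P i) = x then a i else 0 := by
  simp [pointDiv, Finsupp.single_apply]

theorem pointDiv_add (a b : Fin n → ℤ) (x : ClosedPoint k) :
    pointDiv P (a + b) x = pointDiv P a x + pointDiv P b x := by
  classical
  rw [pointDiv_apply, pointDiv_apply, pointDiv_apply, ← Finset.sum_add_distrib]
  exact Finset.sum_congr rfl fun i _ => by split_ifs <;> simp

variable {P} (hP : Function.Injective P)

include hP in
theorem pointDiv_point (a : Fin n → ℤ) (i : Fin n) :
    pointDiv P a (rationalPoint (P i)) = a i := by
  classical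
  rw [pointDiv_apply, Finset.sum_eq_single i]
  · simp
  · intro j _ hj
    rw [if_neg fun h => hj (hP (rationalPoint_injective h))]
  · simp

theorem pointDiv_of_forall_ne (a : Fin n → ℤ) {x : ClosedPoint k}
    (hx : ∀ i, rationalPoint (P i) ≠ x) : pointDiv P a x = 0 := by
  classical
  rw [pointDiv_apply]
  exact Finset.sum_eq_zero fun i _ => if_neg (hx i)

include hP in
theorem mem_H0_pointDiv {a : Fin n → ℤ} {f : RatFunc k} :
    f ∈ H0 (pointDiv P a) ↔ (∀ i, val (rationalPoint (P i)) f ≤ WithZero.exp (a i)) ∧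
      ∀ x, (∀ i, rationalPoint (P i) ≠ x) → val x f ≤ 1 := by
  constructor
  · intro h
    refine ⟨fun i => ?_, fun x hx => ?_⟩
    · have := h (rationalPoint (P i))
      rwa [pointDiv_point hP] at this
    · have := h x
      rwa [pointDiv_of_forall_ne a hx, WithZero.exp_zero] at this
  · rintro ⟨h1, h2⟩ x
    by_cases hx : ∀ i, rationalPoint (P i) ≠ x
    · rw [pointDiv_of_forall_ne a hx, WithZero.exp_zero]
      exact h2 x hx
    · push Not at hx
      obtain ⟨i, rfl⟩ := hx
      rw [pointDiv_point hP]
      exact h1 i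

variable (P) in
/-- The rational function `∏ tᵢ ^ cᵢ`. -/
def monFun (s : Fin n → kˣ) (c : Fin n → ℤ) : RatFunc k := ∏ i, linSection (s i) (P i) ^ c i

theorem val_monFun (s : Fin n → kˣ) {c : Fin n → ℤ} (hc : ∑ i, c i = 0) (x : ClosedPoint k) :
    val x (monFun P s c) = WithZero.exp (-pointDiv P c x) := by
  classical
  have h1 : ∀ t : Finset (Fin n), val x (∏ i ∈ t, linSection (s i) (P i) ^ c i) =
      WithZero.exp (∑ i ∈ t, c i *
        ((if x = none then 1 else 0) - if rationalPoint (P i) = x then 1 else 0 : ℤ)) := by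
    intro t
    induction t using Finset.induction_on with
    | empty => simp
    | insert i t hi ih =>
      rw [Finset.prod_insert hi, Finset.sum_insert hi, map_mul, ih, WithZero.exp_add, map_zpow₀,
        val_linSection, ← WithZero.exp_zsmul, smul_eq_mul]
  rw [monFun, h1]
  congr 1
  simp only [mul_sub, Finset.sum_sub_distrib, ← Finset.sum_mul, hc, zero_mul, zero_sub]
  rw [pointDiv_apply]
  simp

theorem monFun_add (s : Fin n → kˣ) (c c' : Fin n → ℤ) :
    monFun P s (c + c') = monFun P s c * monFun P s c' := by
  rw [monFun, monFun, monFun, ← Finset.prod_mul_distrib]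
  exact Finset.prod_congr rfl fun i _ => zpow_add₀ (linSection_ne_zero _ _) _ _

theorem monFun_zero (s : Fin n → kˣ) : monFun P s 0 = 1 := by simp [monFun]

theorem monFun_mul_mem (s : Fin n → kˣ) {c : Fin n → ℤ} (hc : ∑ i, c i = 0) (a : Fin n → ℤ)
    (f : RatFunc k) :
    monFun P s c * f ∈ H0 (pointDiv P a) ↔ f ∈ H0 (pointDiv P (a + c)) := by
  refine forall_congr' fun x => ?_
  rw [map_mul, val_monFun s hc, pointDiv_add, WithZero.exp_add, WithZero.exp_neg,
    inv_mul_le_iff₀ (WithZero.exp_pos), mul_comm]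

include hP in
open Classical in
theorem H0_pointDiv_eq_bot {a : Fin n → ℤ} (ha : ∑ i, a i < 0) : H0 (pointDiv P a) = ⊥ := by
  obtain ⟨i, -⟩ : ∃ i, a i < 0 := by
    by_contra! h
    exact absurd (Finset.sum_nonneg fun i _ => h i) (not_le.2 ha)
  rw [Submodule.eq_bot_iff]
  intro f hf
  -- move all poles and zeros to the point `P i`
  set c : Fin n → ℤ := a - Pi.single i (∑ l, a l) with hc
  have hc0 : ∑ l, c l = 0 := by simp [hc, Finset.sum_sub_distrib]
  have hac : a = Pi.single i (∑ l, a l) + c := by rw [hc]; abel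
  have hg : monFun P 1 c * f ∈ H0 (pointDiv P (Pi.single i (∑ l, a l))) := by
    rw [monFun_mul_mem 1 hc0, ← hac]
    exact hf
  rw [mem_H0_pointDiv hP] at hg
  obtain ⟨hg1, hg2⟩ := hg
  set g := monFun P 1 c * f with hgdef
  have hgi : val (rationalPoint (P i)) g < 1 := by
    refine (hg1 i).trans_lt ?_
    rw [← WithZero.exp_zero, WithZero.exp_lt_exp]
    simpa using ha
  have hall : ∀ x, val x g ≤ 1 := by
    intro x
    by_cases hx : ∀ l, rationalPoint (P l) ≠ x
    · exact hg2 x hx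
    · push Not at hx
      obtain ⟨l, rfl⟩ := hx
      by_cases hl : l = i
      · rw [hl]; exact hgi.le
      · have := hg1 l
        rwa [Pi.single_eq_of_ne hl, WithZero.exp_zero] at this
  obtain ⟨p, hp⟩ := IsDedekindDomain.HeightOneSpectrum.mem_integers_of_valuation_le_one
    (R := k[X]) (RatFunc k) g fun v => hall (some v)
  have hg0 : g = 0 := by
    by_contra hg0
    have hp0 : p ≠ 0 := by rintro rfl; exact hg0 (by rw [← hp, map_zero])
    have h1 : RatFunc.inftyValuationDef k (algebraMap k[X] (RatFunc k) p) ≤ 1 := by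
      rw [hp]
      exact hall none
    rw [RatFunc.inftyValuation.polynomial k hp0, ← WithZero.exp_zero, WithZero.exp_le_exp] at h1
    have h2 : p.natDegree = 0 := by omega
    rw [Polynomial.eq_C_of_natDegree_eq_zero h2, RatFunc.algebraMap_C] at hp
    have h3 : p.coeff 0 ≠ 0 := by
      intro h
      rw [h, map_zero] at hp
      exact hg0 hp.symm
    rw [← hp, val_C h3] at hgi
    exact lt_irrefl _ hgi
  rcases mul_eq_zero.1 hg0 with h | h
  · exfalso
    have := val_monFun (P := P) 1 hc0 none
    rw [h, map_zero] at this
    exact WithZero.exp_ne_zero this.symm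
  · exact h

include hP in
theorem exists_sub_smul_mem_H0 (a : Fin n → ℤ) (i : Fin n) {f g : RatFunc k}
    (hf : f ∈ H0 (pointDiv P (a + Pi.single i 1))) (hg : g ∈ H0 (pointDiv P (a + Pi.single i 1)))
    (hg' : g ∉ H0 (pointDiv P a)) : ∃ t : k, f - t • g ∈ H0 (pointDiv P a) := by
  have hval : ∀ y, y ∈ H0 (pointDiv P (a + Pi.single i 1)) →
      val (rationalPoint (P i)) y ≤ WithZero.exp (a i) → y ∈ H0 (pointDiv P a) := by
    intro y hy hyi
    rw [mem_H0_pointDiv hP] at hy ⊢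
    refine ⟨fun l => ?_, hy.2⟩
    by_cases hl : l = i
    · rw [hl]; exact hyi
    · have := hy.1 l
      rwa [Pi.add_apply, Pi.single_eq_of_ne hl, add_zero] at this
  have hgi : WithZero.exp (a i) < val (rationalPoint (P i)) g := by
    by_contra h
    exact hg' (hval g hg (not_lt.1 h))
  have hg0 : val (rationalPoint (P i)) g ≠ 0 := fun h => by
    rw [h] at hgi; exact absurd hgi (not_lt.2 zero_le)
  have hgne : g ≠ 0 := by rintro rfl; simp at hg0
  have hsingle : (a + Pi.single i 1 : Fin n → ℤ) i = a i + 1 := by simp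
  have hg1 := ((mem_H0_pointDiv hP).1 hg).1 i
  have hf1 := ((mem_H0_pointDiv hP).1 hf).1 i
  rw [hsingle] at hg1 hf1
  have hgeq : val (rationalPoint (P i)) g = WithZero.exp (a i + 1) := by
    refine le_antisymm hg1 ?_
    rw [← WithZero.le_log_iff_exp_le hg0]
    rw [← WithZero.lt_log_iff_exp_lt hg0] at hgi
    omega
  obtain ⟨t, ht⟩ := exists_val_sub_lt_one (P i) (h := f / g) (by
    rw [map_div₀, hgeq]
    exact div_le_one_of_le₀ hf1 zero_le)
  refine ⟨t, hval _ (Submodule.sub_mem _ hf (Submodule.smul_mem _ _ hg)) ?_⟩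
  have heq : f - t • g = (f / g - RatFunc.C t) * g := by
    rw [sub_mul, div_mul_cancel₀ _ hgne, Algebra.smul_def, RatFunc.algebraMap_eq_C]
  rw [heq, map_mul, hgeq]
  by_cases h0 : val (rationalPoint (P i)) (f / g - RatFunc.C t) = 0
  · rw [h0, zero_mul]; exact zero_le
  · have h1 : val (rationalPoint (P i)) (f / g - RatFunc.C t) ≤ WithZero.exp (-1) := by
      rw [← WithZero.log_le_iff_le_exp h0]
      rw [← WithZero.exp_zero, ← WithZero.log_lt_iff_lt_exp h0] at ht
      omega
    calc _ ≤ WithZero.exp (-1) * WithZero.exp (a i + 1) := by gcongr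
      _ = WithZero.exp (a i) := by rw [← WithZero.exp_add]; congr 1; ring

/-- The spaces of sections of the divisors `∑ aᵢ Pᵢ` on the projective line form a section
system. -/
def lineSections (hP : Function.Injective P) (s : Fin n → kˣ) :
    SectionSystem n k (RatFunc k) where
  L a := H0 (pointDiv P a)
  mon := monFun P s
  mon_zero := monFun_zero s
  mon_add := monFun_add s
  mon_mul_mem _ hc := monFun_mul_mem s hc
  inf_eq a b := by
    ext f
    rw [Submodule.mem_inf, mem_H0_pointDiv hP, mem_H0_pointDiv hP, mem_H0_pointDiv hP]
    have : ∀ i, val (rationalPoint (P i)) f ≤ WithZero.exp ((a ⊓ b) i) ↔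
        val (rationalPoint (P i)) f ≤ WithZero.exp (a i) ∧
        val (rationalPoint (P i)) f ≤ WithZero.exp (b i) := by
      intro i
      rcases le_total (a i) (b i) with h | h
      · rw [Pi.inf_apply, inf_eq_left.2 h]
        exact ⟨fun hf => ⟨hf, hf.trans (WithZero.exp_le_exp.2 h)⟩, And.left⟩
      · rw [Pi.inf_apply, inf_eq_right.2 h]
        exact ⟨fun hf => ⟨hf.trans (WithZero.exp_le_exp.2 h), hf⟩, And.right⟩
    simp only [this, forall_and]
    tauto
  one_mem x := by simp [pointDiv]
  one_notMem a i hi h := by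
    have := ((mem_H0_pointDiv hP).1 h).1 i
    rw [map_one, ← WithZero.exp_zero, WithZero.exp_le_exp] at this
    omega
  mul_mem a b f g hf hg x := by
    rw [map_mul, pointDiv_add, WithZero.exp_add]
    exact mul_le_mul' (hf x) (hg x)
  eq_bot _ := H0_pointDiv_eq_bot hP
  exists_sub_smul_mem a i _ _ := exists_sub_smul_mem_H0 hP a i

include hP in
theorem floorMul_divisor (α : Fin n → ℚ) (e : ℕ) :
    floorMul e (divisor α P) = pointDiv P (fl α e) := by
  classical
  ext x
  have h1 : divisor α P x = ∑ i, if rationalPoint (P i) = x then α i else 0 := by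
    simp [divisor, Finsupp.single_apply]
  rw [floorMul, Finsupp.mapRange_apply, h1]
  by_cases hx : ∀ i, rationalPoint (P i) ≠ x
  · rw [pointDiv_of_forall_ne _ hx, Finset.sum_eq_zero fun i _ => if_neg (hx i)]
    simp
  · push Not at hx
    obtain ⟨i, rfl⟩ := hx
    rw [pointDiv_point hP, Finset.sum_eq_single i]
    · simp [fl]
    · intro j _ hj
      rw [if_neg fun h => hj (hP (rationalPoint_injective h))]
    · simp

end Line

/-! ### Gröbner bases of weighted homogeneous ideals -/

section Initial

variable {k : Type u} [Field k] {N : ℕ} {d : Fin N → ℕ}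

/-- The exponents of the initial monomials of the elements of `I`. -/
def initialMonomials (I : Ideal (MvPolynomial (Fin N) k)) : Set (Fin N →₀ ℕ) :=
  {m | ∃ f ∈ I, IsInitialMonomial f m}

theorem IsInitialMonomial.unique {f : MvPolynomial (Fin N) k} {m m' : Fin N →₀ ℕ}
    (h : IsInitialMonomial f m) (h' : IsInitialMonomial f m') : m = m' := by
  by_contra hne
  exact (h.2 m' h'.1 (Ne.symm hne)).not_gt (h'.2 m h.1 hne)

theorem initialTerm_eq {f : MvPolynomial (Fin N) k} {m : Fin N →₀ ℕ}
    (h : IsInitialMonomial f m) : initialTerm f = MvPolynomial.monomial m (f.coeff m) := by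
  have hex : ∃ m, IsInitialMonomial f m := ⟨m, h⟩
  rw [initialTerm, dif_pos hex, hex.choose_spec.unique h]

theorem exists_isInitialMonomial {f : MvPolynomial (Fin N) k} (hf : f ≠ 0) :
    ∃ m, IsInitialMonomial f m := by
  obtain ⟨m, hm, hmax⟩ := f.support.exists_max_image word
    (Finset.nonempty_iff_ne_empty.2 fun h => hf (MvPolynomial.support_eq_empty.1 h))
  refine ⟨m, hm, fun m' hm' hne => ?_⟩
  exact lt_of_le_of_ne (hmax m' hm') fun h => hne (word_injective h)

/-- Homogeneous components can be taken without changing the initial monomial. -/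
theorem exists_mem_homogeneous {I : Ideal (MvPolynomial (Fin N) k)}
    (hI : ∀ f ∈ I, ∀ e, MvPolynomial.weightedHomogeneousComponent d e f ∈ I) {m : Fin N →₀ ℕ}
    (hm : m ∈ initialMonomials I) : ∃ f ∈ I, IsInitialMonomial f m ∧ f.coeff m = 1 ∧
      ∀ m' ∈ f.support, Finsupp.weight d m' = Finsupp.weight d m := by
  obtain ⟨f, hf, hfm⟩ := hm
  have hc : f.coeff m ≠ 0 := MvPolynomial.mem_support_iff.1 hfm.1
  have hcoeff : ∀ m', ((f.coeff m)⁻¹ • MvPolynomial.weightedHomogeneousComponent d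
      (Finsupp.weight d m) f).coeff m' =
      if Finsupp.weight d m' = Finsupp.weight d m then (f.coeff m)⁻¹ * f.coeff m' else 0 := by
    intro m'
    rw [MvPolynomial.coeff_smul, MvPolynomial.coeff_weightedHomogeneousComponent]
    split_ifs <;> simp
  refine ⟨(f.coeff m)⁻¹ • MvPolynomial.weightedHomogeneousComponent d (Finsupp.weight d m) f,
    Submodule.smul_of_tower_mem I _ (hI f hf _), ⟨?_, fun m' hm' hne => hfm.2 m' ?_ hne⟩, ?_,
    fun m' hm' => ?_⟩
  · rw [MvPolynomial.mem_support_iff, hcoeff, if_pos rfl]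
    exact mul_ne_zero (inv_ne_zero hc) hc
  · rw [MvPolynomial.mem_support_iff, hcoeff] at hm'
    rw [MvPolynomial.mem_support_iff]
    intro h
    simp [h] at hm'
  · rw [hcoeff, if_pos rfl, inv_mul_cancel₀ hc]
  · by_contra h
    rw [MvPolynomial.mem_support_iff, hcoeff, if_neg h] at hm'
    exact hm' rfl

theorem IsInitialMonomial.monomial_mul (hd : ∀ a, 1 ≤ d a) {f : MvPolynomial (Fin N) k}
    {m : Fin N →₀ ℕ} (h : IsInitialMonomial f m)
    (hw : ∀ m' ∈ f.support, Finsupp.weight d m' = Finsupp.weight d m) (l : Fin N →₀ ℕ) :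
    IsInitialMonomial (MvPolynomial.monomial l 1 * f) (l + m) := by
  constructor
  · rw [MvPolynomial.mem_support_iff, MvPolynomial.coeff_monomial_mul, one_mul]
    exact MvPolynomial.mem_support_iff.1 h.1
  · intro m' hm' hne
    rw [MvPolynomial.mem_support_iff, MvPolynomial.coeff_monomial_mul'] at hm'
    split_ifs at hm' with hle
    · obtain ⟨m₀, rfl⟩ := exists_add_of_le hle
      rw [add_tsub_cancel_left, one_mul, ← MvPolynomial.mem_support_iff] at hm'
      exact (h.2 m₀ hm' fun h0 => hne (by rw [h0])).add_left hd (hw m₀ hm') l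
    · exact absurd rfl hm'

theorem add_mem_initialMonomials (hd : ∀ a, 1 ≤ d a) {I : Ideal (MvPolynomial (Fin N) k)}
    (hI : ∀ f ∈ I, ∀ e, MvPolynomial.weightedHomogeneousComponent d e f ∈ I) {m : Fin N →₀ ℕ}
    (hm : m ∈ initialMonomials I) (l : Fin N →₀ ℕ) : l + m ∈ initialMonomials I := by
  obtain ⟨f, hf, hfm, -, hw⟩ := exists_mem_homogeneous hI hm
  exact ⟨_, I.mul_mem_left _ hf, hfm.monomial_mul hd hw l⟩

theorem initialSpace_eq (I : Ideal (MvPolynomial (Fin N) k)) :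
    initialSpace I = Submodule.span k ((fun m => MvPolynomial.monomial m (1 : k)) ''
      initialMonomials I) := by
  apply le_antisymm
  · rw [initialSpace, Submodule.span_le]
    rintro _ ⟨f, hf, rfl⟩
    by_cases h : ∃ m, IsInitialMonomial f m
    · obtain ⟨m, hm⟩ := h
      rw [initialTerm_eq hm, ← mul_one (f.coeff m), ← smul_eq_mul, ← MvPolynomial.smul_monomial]
      exact Submodule.smul_mem _ _ (Submodule.subset_span ⟨m, ⟨f, hf, hm⟩, rfl⟩)
    · rw [initialTerm, dif_neg h]
      exact Submodule.zero_mem _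
  · rw [Submodule.span_le]
    rintro _ ⟨m, ⟨f, hf, hm⟩, rfl⟩
    have hc : f.coeff m ≠ 0 := MvPolynomial.mem_support_iff.1 hm.1
    have h1 : initialTerm f ∈ initialSpace I := Submodule.subset_span ⟨f, hf, rfl⟩
    have h2 := Submodule.smul_mem _ (f.coeff m)⁻¹ h1
    rwa [initialTerm_eq hm, MvPolynomial.smul_monomial, smul_eq_mul, inv_mul_cancel₀ hc] at h2

/-- Division with remainder: since there are finitely many monomials of each weight, cancelling
initial terms terminates on homogeneous elements. -/
theorem mem_span_of_homogeneous (hd : ∀ a, 1 ≤ d a) {I : Ideal (MvPolynomial (Fin N) k)}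
    {S : Set (Fin N →₀ ℕ)} {g : (Fin N →₀ ℕ) → MvPolynomial (Fin N) k}
    (hS : ∀ m ∈ initialMonomials I, ∃ m' ∈ S, m' ≤ m)
    (hgI : ∀ m ∈ S, g m ∈ I) (hgm : ∀ m ∈ S, IsInitialMonomial (g m) m)
    (hg1 : ∀ m ∈ S, (g m).coeff m = 1)
    (hgw : ∀ m ∈ S, ∀ m' ∈ (g m).support, Finsupp.weight d m' = Finsupp.weight d m)
    {e : ℕ} {f : MvPolynomial (Fin N) k} (hf : f ∈ I)
    (hfe : ∀ m ∈ f.support, Finsupp.weight d m = e) : f ∈ Ideal.span (g '' S) := by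
  by_contra hfG
  -- the initial monomials of counterexamples of weight `e`
  set B : Set (Fin N →₀ ℕ) := {m | ∃ f ∈ I, (∀ m ∈ f.support, Finsupp.weight d m = e) ∧
    f ∉ Ideal.span (g '' S) ∧ IsInitialMonomial f m} with hB
  have hinit : ∀ f ∈ I, (∀ m ∈ f.support, Finsupp.weight d m = e) → f ∉ Ideal.span (g '' S) →
      ∃ m ∈ B, IsInitialMonomial f m := by
    intro f hf hfe hfG
    obtain ⟨m, hm⟩ := exists_isInitialMonomial (f := f) (by
      rintro rfl; exact hfG (Ideal.zero_mem _))
    exact ⟨m, ⟨f, hf, hfe, hfG, hm⟩, hm⟩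
  have hBfin : B.Finite := (Finsupp.finite_of_nat_weight_eq d
    (fun a => by have := hd a; omega) e).subset (by
      rintro m ⟨f, -, hfe, -, hm⟩; exact hfe m hm.1)
  obtain ⟨m₀, hm₀, -⟩ := hinit f hf hfe hfG
  obtain ⟨m, ⟨f, hf, hfe, hfG, hm⟩, hmin⟩ := Set.exists_min_image B word hBfin ⟨m₀, hm₀⟩
  obtain ⟨m', hm'S, hle⟩ := hS m ⟨f, hf, hm⟩
  obtain ⟨l, hl⟩ := exists_add_of_le hle
  rw [add_comm] at hl
  have hq := (hgm m' hm'S).monomial_mul hd (hgw m' hm'S) l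
  set q : MvPolynomial (Fin N) k := MvPolynomial.monomial l 1 * g m' with hqdef
  rw [← hl] at hq
  have hqG : q ∈ Ideal.span (g '' S) :=
    Ideal.mul_mem_left _ _ (Ideal.subset_span ⟨m', hm'S, rfl⟩)
  have hq1 : q.coeff m = 1 := by
    rw [hqdef, hl, MvPolynomial.coeff_monomial_mul, one_mul, hg1 m' hm'S]
  have hqe : ∀ m'' ∈ q.support, Finsupp.weight d m'' = e := by
    intro m'' hm''
    rw [MvPolynomial.mem_support_iff, hqdef, MvPolynomial.coeff_monomial_mul'] at hm''
    split_ifs at hm'' with hle'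
    · obtain ⟨m₁, rfl⟩ := exists_add_of_le hle'
      rw [add_tsub_cancel_left, one_mul, ← MvPolynomial.mem_support_iff] at hm''
      rw [map_add, hgw m' hm'S m₁ hm'', ← map_add, ← hl, hfe m hm.1]
    · exact absurd rfl hm''
  have hr : f - f.coeff m • q ∉ Ideal.span (g '' S) := fun h => hfG (by
    rw [← sub_add_cancel f (f.coeff m • q)]
    exact Ideal.add_mem _ h (Submodule.smul_of_tower_mem _ _ hqG))
  have hsupp : ∀ m'' ∈ (f - f.coeff m • q).support, m'' ∈ f.support ∨ m'' ∈ q.support := by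
    intro m'' hm''
    by_contra! hcon
    rw [MvPolynomial.notMem_support_iff, MvPolynomial.notMem_support_iff] at hcon
    rw [MvPolynomial.mem_support_iff, MvPolynomial.coeff_sub, MvPolynomial.coeff_smul, hcon.1,
      hcon.2, smul_zero, sub_zero] at hm''
    exact hm'' rfl
  obtain ⟨p, hpB, hp⟩ := hinit (f - f.coeff m • q)
    (I.sub_mem hf (Submodule.smul_of_tower_mem I _ (I.mul_mem_left _ (hgI m' hm'S))))
    (fun m'' hm'' => (hsupp m'' hm'').elim (hfe m'') (hqe m'')) hr
  have hpm : p ≠ m := by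
    rintro rfl
    have := MvPolynomial.mem_support_iff.1 hp.1
    rw [MvPolynomial.coeff_sub, MvPolynomial.coeff_smul, hq1, smul_eq_mul, mul_one, sub_self] at this
    exact this rfl
  have hlt : RevLex p m := (hsupp p hp.1).elim (fun h => hm.2 p h hpm) fun h => hq.2 p h hpm
  exact absurd hlt (not_lt.2 (hmin p hpB))

theorem exists_minimal_le {S : Set (Fin N →₀ ℕ)} {m : Fin N →₀ ℕ} (hm : m ∈ S) :
    ∃ m', Minimal (· ∈ S) m' ∧ m' ≤ m := by
  obtain ⟨m', hle, hm'⟩ := exists_minimal_le_of_wellFoundedLT (· ∈ S) m hm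
  exact ⟨m', hm', hle⟩

/-- Dickson's lemma. -/
theorem finite_minimal (S : Set (Fin N →₀ ℕ)) : {m | Minimal (· ∈ S) m}.Finite :=
  WellQuasiOrderedLE.finite_of_isAntichain (setOfPred_minimal_antichain _)

/-- A homogeneous ideal has a Gröbner basis, whose initial terms are necessarily the minimal initial
monomials. -/
theorem exists_isGroebnerBasis (hd : ∀ a, 1 ≤ d a) {I : Ideal (MvPolynomial (Fin N) k)}
    (hI : ∀ f ∈ I, ∀ e, MvPolynomial.weightedHomogeneousComponent d e f ∈ I) :
    ∃ G : Set (MvPolynomial (Fin N) k), IsGroebnerBasis I G ∧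
      initialTerm '' G = (fun m => MvPolynomial.monomial m (1 : k)) ''
        {m | Minimal (· ∈ initialMonomials I) m} := by
  set L : Set (Fin N →₀ ℕ) := {m | Minimal (· ∈ initialMonomials I) m} with hL
  have hex : ∀ m, ∃ f, m ∈ L → f ∈ I ∧ IsInitialMonomial f m ∧ f.coeff m = 1 ∧
      ∀ m' ∈ f.support, Finsupp.weight d m' = Finsupp.weight d m := by
    intro m
    by_cases hm : m ∈ L
    · obtain ⟨f, hf⟩ := exists_mem_homogeneous hI hm.1
      exact ⟨f, fun _ => hf⟩
    · exact ⟨0, fun h => absurd h hm⟩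
  choose g hg using hex
  have hterm : ∀ m ∈ L, initialTerm (g m) = MvPolynomial.monomial m 1 := fun m hm => by
    rw [initialTerm_eq (hg m hm).2.1, (hg m hm).2.2.1]
  have himage : initialTerm '' (g '' L) = (fun m => MvPolynomial.monomial m (1 : k)) '' L := by
    rw [Set.image_image]
    exact Set.image_congr hterm
  have hinj : Function.Injective fun m : Fin N →₀ ℕ => MvPolynomial.monomial m (1 : k) :=
    fun m m' h => MvPolynomial.monomial_left_injective one_ne_zero h
  refine ⟨g '' L, ⟨?_, ?_, ?_, ?_⟩, himage⟩
  · apply le_antisymm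
    · rw [Ideal.span_le]
      rintro _ ⟨m, hm, rfl⟩
      exact (hg m hm).1
    · intro f hf
      rw [← MvPolynomial.sum_weightedHomogeneousComponent d f, finsum_eq_sum _
        (MvPolynomial.weightedHomogeneousComponent_finsupp f)]
      refine Ideal.sum_mem _ fun e _ => ?_
      refine mem_span_of_homogeneous hd (I := I) (e := e)
        (fun m hm => exists_minimal_le hm) (fun m hm => (hg m hm).1)
        (fun m hm => (hg m hm).2.1) (fun m hm => (hg m hm).2.2.1) (fun m hm => (hg m hm).2.2.2)
        (hI f hf e) fun m hm => ?_
      by_contra h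
      rw [MvPolynomial.mem_support_iff, MvPolynomial.coeff_weightedHomogeneousComponent,
        if_neg h] at hm
      exact hm rfl
  · rintro _ ⟨m, hm, rfl⟩ _ ⟨m', hm', rfl⟩ h
    rw [hterm m hm, hterm m' hm'] at h
    rw [hinj h]
  · rw [himage, initialSpace_eq]
    apply le_antisymm
    · intro f hf
      rw [Submodule.restrictScalars_mem, MvPolynomial.mem_ideal_span_monomial_image] at hf
      rw [MvPolynomial.as_sum f]
      refine Submodule.sum_mem _ fun m hm => ?_
      obtain ⟨m', hm', hle⟩ := hf m hm
      obtain ⟨l, rfl⟩ := exists_add_of_le hle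
      rw [← mul_one (f.coeff _), ← smul_eq_mul, ← MvPolynomial.smul_monomial]
      refine Submodule.smul_mem _ _ (Submodule.subset_span ⟨m' + l, ?_, rfl⟩)
      rw [add_comm]
      exact add_mem_initialMonomials hd hI hm'.1 l
    · rw [Submodule.span_le]
      rintro _ ⟨m, hm, rfl⟩
      rw [SetLike.mem_coe, Submodule.restrictScalars_mem,
        MvPolynomial.mem_ideal_span_monomial_image]
      intro m' hm'
      have : m' = m := by
        simpa using MvPolynomial.support_monomial_subset hm'
      rw [this]
      exact exists_minimal_le hm
  · rw [himage]
    rintro _ ⟨m, hm, rfl⟩ h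
    have hsub : ((fun m => MvPolynomial.monomial m (1 : k)) '' L) \
        {MvPolynomial.monomial m (1 : k)} =
        (fun m => MvPolynomial.monomial m (1 : k)) '' (L \ {m}) := by
      rw [Set.image_sdiff hinj, Set.image_singleton]
    rw [hsub, MvPolynomial.mem_ideal_span_monomial_image] at h
    obtain ⟨m', ⟨hm', hne⟩, hle⟩ := h m (by simp)
    exact hne (le_antisymm hle (hm.2 hm'.1 hle))

end Initial

/-! ### Evaluation at the stable generators -/

namespace SectionSystem

variable {n : ℕ} {k K : Type*} [Field k] [Field K] [Algebra k K] (T : SectionSystem n k K)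
variable {N : ℕ} {α : Fin n → ℚ} {d : Fin N → ℕ} {c : Fin N → Fin n → ℤ}

/-- The homomorphism `k[x_1, …, x_N] → K[u]`, `x_a ↦ u^{d_a} mon(c_a)`. -/
def eval (d : Fin N → ℕ) (c : Fin N → Fin n → ℤ) : MvPolynomial (Fin N) k →ₐ[k] K[X] :=
  MvPolynomial.aeval fun a => Polynomial.monomial (d a) (T.mon (c a))

theorem mon_nsmul (e : ℕ) (c : Fin n → ℤ) : T.mon (e • c) = T.mon c ^ e := by
  induction e with
  | zero => simp [T.mon_zero]
  | succ e ih => rw [add_smul, one_smul, T.mon_add, ih, pow_succ]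

theorem eval_monomial (m : Fin N →₀ ℕ) (t : k) :
    T.eval d c (MvPolynomial.monomial m t) =
      Polynomial.monomial (Finsupp.weight d m) (t • T.x c m) := by
  have h : (m.prod fun a e => (Polynomial.monomial (d a) (T.mon (c a))) ^ e) =
      Polynomial.monomial (Finsupp.weight d m) (T.x c m) := by
    induction m using Finsupp.induction_linear with
    | zero => simp [T.x_zero]
    | add m m' h h' =>
      rw [Finsupp.prod_add_index' (fun _ => pow_zero _) (fun _ _ _ => pow_add _ _ _), h, h',
        map_add, T.x_add, Polynomial.monomial_mul_monomial]
    | single a e =>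
      rw [Finsupp.prod_single_index (h := fun a e => Polynomial.monomial (d a) (T.mon (c a)) ^ e)
        (pow_zero _), Polynomial.monomial_pow, x,
        Finsupp.weight_single, Finsupp.weight_single, T.mon_nsmul, smul_eq_mul, mul_comm]
  rw [eval, MvPolynomial.aeval_monomial, h, ← Algebra.smul_def, Polynomial.smul_monomial]

theorem eval_weightedHomogeneousComponent (e : ℕ) (f : MvPolynomial (Fin N) k) :
    T.eval d c (MvPolynomial.weightedHomogeneousComponent d e f) =
      Polynomial.monomial e ((T.eval d c f).coeff e) := by
  induction f using MvPolynomial.induction_on' with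
  | monomial m t =>
    rw [MvPolynomial.weightedHomogeneousComponent_of_mem
      ((MvPolynomial.mem_weightedHomogeneousSubmodule _ _ _ _).2
        (MvPolynomial.isWeightedHomogeneous_monomial d m t rfl)), eval_monomial,
      Polynomial.coeff_monomial]
    by_cases h : e = Finsupp.weight d m
    · rw [if_pos h, if_pos h.symm, eval_monomial, h]
    · rw [if_neg h, if_neg (Ne.symm h), map_zero, map_zero]
  | add f g hf hg => rw [map_add, map_add, map_add, hf, hg, Polynomial.coeff_add, map_add]

theorem weightedHomogeneousComponent_mem_ker (f : MvPolynomial (Fin N) k)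
    (hf : f ∈ RingHom.ker (T.eval d c)) (e : ℕ) :
    MvPolynomial.weightedHomogeneousComponent d e f ∈ RingHom.ker (T.eval d c) := by
  rw [RingHom.mem_ker] at hf ⊢
  rw [eval_weightedHomogeneousComponent, hf, Polynomial.coeff_zero, map_zero]

/-- A monomial is initial for the relation ideal iff its value is a combination of the values of
smaller monomials of the same weight. -/
theorem mem_initialMonomials_ker (m : Fin N →₀ ℕ) :
    m ∈ initialMonomials (RingHom.ker (T.eval d c)) ↔ T.x c m ∈ T.W d c m := by
  constructor
  · intro hm
    obtain ⟨f, hf, hfm, hf1, hfw⟩ :=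
      exists_mem_homogeneous (d := d) T.weightedHomogeneousComponent_mem_ker hm
    have h0 : ∑ m' ∈ f.support, f.coeff m' • T.x c m' = 0 := by
      rw [RingHom.mem_ker, MvPolynomial.as_sum f, map_sum,
        Finset.sum_congr rfl fun m' hm' => by rw [eval_monomial, hfw m' hm'], ← map_sum] at hf
      exact (Polynomial.monomial_eq_zero_iff _ _).1 hf
    rw [← Finset.add_sum_erase _ _ hfm.1, hf1, one_smul, add_eq_zero_iff_eq_neg] at h0
    rw [h0]
    refine Submodule.neg_mem _ (Submodule.sum_mem _ fun m' hm' => ?_)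
    obtain ⟨hne, hm'⟩ := Finset.mem_erase.1 hm'
    exact Submodule.smul_mem _ _ (Submodule.subset_span ⟨m', ⟨hfm.2 m' hm' hne, hfw m' hm'⟩, rfl⟩)
  · intro hm
    obtain ⟨l, hl, hlm⟩ := (Finsupp.mem_span_image_iff_linearCombination k).1 hm
    have hl : ∀ m' ∈ l.support, RevLex m' m ∧ Finsupp.weight d m' = Finsupp.weight d m :=
      fun m' hm' => hl hm'
    set p : MvPolynomial (Fin N) k := ∑ m' ∈ l.support, MvPolynomial.monomial m' (l m') with hp
    have hpsupp : ∀ m' ∈ p.support, m' ∈ l.support := by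
      intro m' hm'
      obtain ⟨m'', h, h'⟩ := Finset.mem_biUnion.1 (MvPolynomial.support_sum hm')
      have := Finset.mem_singleton.1 (MvPolynomial.support_monomial_subset h')
      rwa [this]
    have hpm : p.coeff m = 0 := by
      rw [← MvPolynomial.notMem_support_iff]
      exact fun h => not_revLex_self m (hl m (hpsupp m h)).1
    refine ⟨MvPolynomial.monomial m 1 - p, ?_, ?_, fun m' hm' hne => ?_⟩
    · rw [RingHom.mem_ker, map_sub, eval_monomial, one_smul, hp, map_sum,
        Finset.sum_congr rfl fun m' hm' => by rw [eval_monomial, (hl m' hm').2], ← map_sum,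
        ← hlm, sub_eq_zero]
      rfl
    · rw [MvPolynomial.mem_support_iff, MvPolynomial.coeff_sub, hpm]
      simp
    · rw [MvPolynomial.mem_support_iff, MvPolynomial.coeff_sub, MvPolynomial.coeff_monomial,
        if_neg (Ne.symm hne), zero_sub, neg_ne_zero, ← MvPolynomial.mem_support_iff] at hm'
      exact (hl m' (hpsupp m' hm')).1

theorem monomial_mem_adjoin (hn : 2 ≤ n) (hn4 : n ≤ 4) (h : IsStableSystem α d c) {e : ℕ} {y : K}
    (hy : y ∈ T.L (fl α e)) : Polynomial.monomial e y ∈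
      Algebra.adjoin k (Set.range fun a => Polynomial.monomial (d a) (T.mon (c a))) := by
  rw [Algebra.adjoin_range_eq_range_aeval]
  rw [T.L_eq_span hn hn4 h] at hy
  induction hy using Submodule.span_induction with
  | mem y hy =>
    obtain ⟨m, rfl, rfl⟩ := hy
    refine ⟨MvPolynomial.monomial m 1, ?_⟩
    have := T.eval_monomial (d := d) (c := c) m 1
    rwa [one_smul] at this
  | zero => rw [map_zero]; exact Subalgebra.zero_mem _
  | add y z _ _ hy hz => rw [map_add]; exact Subalgebra.add_mem _ hy hz
  | smul t y _ hy => rw [← Polynomial.smul_monomial]; exact Subalgebra.smul_mem _ hy t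

include T in
theorem floorDeg_weight_nonneg (h : IsStableSystem α d c) (m : Fin N →₀ ℕ) :
    0 ≤ floorDeg α (Finsupp.weight d m) := by
  by_contra hcon
  have := T.x_mem h m
  rw [T.eq_bot (fl α _) (not_le.1 hcon), Submodule.mem_bot] at this
  exact T.mon_ne_zero this

/-- A monomial of weight `e` is one of the generators of degree `e`, or its value lies in the part
of degree `e` that is generated in smaller degrees. -/
theorem x_mem_V_sup_span (h : IsStableSystem α d c) {b : Fin N} {m : Fin N →₀ ℕ}
    (hm : m b = 0) (hw : Finsupp.weight d m = d b) :
    T.x c m ∈ T.V (fl α (d b)) (pregenFamily α (d b)) ⊔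
      Submodule.span k ((fun a => T.mon (c a)) '' {a | d a = d b ∧ a ≠ b}) := by
  have hm0 : m ≠ 0 := by
    rintro rfl
    have := h.pos b
    rw [map_zero] at hw
    omega
  obtain ⟨a, m₀, rfl, -⟩ := exists_eq_single_add hm0
  have hab : a ≠ b := by
    rintro rfl
    simp at hm
  rw [map_add, weight_single_one] at hw
  have ha := h.pos a
  by_cases hm₀ : Finsupp.weight d m₀ = 0
  · rw [eq_zero_of_weight_eq_zero h.pos hm₀, add_zero, x_single]
    exact Submodule.mem_sup_right (Submodule.subset_span ⟨a, ⟨by omega, hab⟩, rfl⟩)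
  · refine Submodule.mem_sup_left ?_
    -- the smaller of the two degrees serves as the index of the product
    obtain ⟨l, l', hl, hl', hx, hll⟩ : ∃ l l' : Fin N →₀ ℕ, 1 ≤ Finsupp.weight d l ∧
        Finsupp.weight d l ≤ Finsupp.weight d l' ∧
        T.x c (Finsupp.single a 1 + m₀) = T.x c l * T.x c l' ∧
        Finsupp.weight d l + Finsupp.weight d l' = d b := by
      rcases le_total (d a) (Finsupp.weight d m₀) with hle | hle
      · exact ⟨Finsupp.single a 1, m₀, by rwa [weight_single_one], by rwa [weight_single_one],
          T.x_add _ _, by rwa [weight_single_one]⟩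
      · exact ⟨m₀, Finsupp.single a 1, by omega, by rwa [weight_single_one],
          by rw [T.x_add, mul_comm], by rw [weight_single_one]; omega⟩
    have hsub : d b - Finsupp.weight d l = Finsupp.weight d l' := by omega
    refine (le_iSup₂ (f := fun A (_ : A ∈ pregenFamily α (d b)) => T.L (fl α (d b) - ind A))
      (dropSet α (d b) (Finsupp.weight d l)) ?_) ?_
    · refine Finset.mem_image.2 ⟨Finsupp.weight d l, Finset.mem_filter.2
        ⟨Finset.mem_Icc.2 ⟨hl, by omega⟩, T.floorDeg_weight_nonneg h l, ?_⟩, rfl⟩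
      rw [hsub]
      exact T.floorDeg_weight_nonneg h l'
    · rw [← fl_add_fl α (by omega), hsub, hx]
      exact T.mul_mem _ _ _ _ (T.x_mem h l) (T.x_mem h l')

theorem gen_notMem_adjoin (hn : 2 ≤ n) (hn4 : n ≤ 4) (h : IsStableSystem α d c) (b : Fin N) :
    Polynomial.monomial (d b) (T.mon (c b)) ∉
      Algebra.adjoin k ((fun a => Polynomial.monomial (d a) (T.mon (c a))) '' {a | a ≠ b}) := by
  intro hmem
  rw [← Subalgebra.mem_toSubmodule, Algebra.adjoin_eq_span] at hmem
  refine T.mon_notMem hn hn4 h b ?_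
  have hcl : ∀ y ∈ Submonoid.closure
      ((fun a => Polynomial.monomial (d a) (T.mon (c a))) '' {a | a ≠ b}),
      ∃ m : Fin N →₀ ℕ, m b = 0 ∧ y = Polynomial.monomial (Finsupp.weight d m) (T.x c m) := by
    intro y hy
    induction hy using Submonoid.closure_induction with
    | mem y hy =>
      obtain ⟨a, ha, rfl⟩ := hy
      exact ⟨Finsupp.single a 1, Finsupp.single_eq_of_ne (Ne.symm ha), by
        rw [weight_single_one, x_single]⟩
    | one => exact ⟨0, rfl, by rw [map_zero, x_zero]; rfl⟩
    | mul y z _ _ hy hz =>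
      obtain ⟨m, hm, rfl⟩ := hy
      obtain ⟨m', hm', rfl⟩ := hz
      exact ⟨m + m', by rw [Finsupp.add_apply, hm, hm'], by
        rw [Polynomial.monomial_mul_monomial, map_add, x_add]⟩
  have key : ∀ y ∈ Submodule.span k ((Submonoid.closure
      ((fun a => Polynomial.monomial (d a) (T.mon (c a))) '' {a | a ≠ b}) : Set K[X])),
      y.coeff (d b) ∈ T.V (fl α (d b)) (pregenFamily α (d b)) ⊔
        Submodule.span k ((fun a => T.mon (c a)) '' {a | d a = d b ∧ a ≠ b}) := by
    intro y hy
    induction hy using Submodule.span_induction with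
    | mem y hy =>
      obtain ⟨m, hm, rfl⟩ := hcl y hy
      rw [Polynomial.coeff_monomial]
      split_ifs with hw
      · exact T.x_mem_V_sup_span h hm hw
      · exact Submodule.zero_mem _
    | zero => rw [Polynomial.coeff_zero]; exact Submodule.zero_mem _
    | add y z _ _ hy hz => rw [Polynomial.coeff_add]; exact Submodule.add_mem _ hy hz
    | smul t y _ hy => rw [Polynomial.coeff_smul]; exact Submodule.smul_mem _ _ hy
  have := key _ hmem
  rwa [Polynomial.coeff_monomial, if_pos rfl] at this

end SectionSystem

section Main

variable {n N : ℕ} {α : Fin n → ℚ} {d : Fin N → ℕ} {c : Fin N → Fin n → ℤ}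

theorem isMinimalGenerating (hn : 2 ≤ n) (hn4 : n ≤ 4) (h : IsStableSystem α d c) {k : Type u}
    [Field k] {P : Fin n → OnePoint k} (hP : Function.Injective P) (s : Fin n → kˣ) :
    IsMinimalGenerating (canonicalRing (divisor α P)) fun a => monomialElt P s (d a) (c a) := by
  refine ⟨le_antisymm ?_ ?_, (lineSections hP s).gen_notMem_adjoin hn hn4 h⟩
  · rw [Algebra.adjoin_le_iff]
    rintro _ ⟨a, rfl⟩ e
    simp only [monomialElt, Polynomial.coeff_monomial]
    split_ifs with hde
    · rw [floorMul_divisor hP, ← hde]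
      exact (lineSections hP s).mon_mem h a
    · exact Submodule.zero_mem _
  · intro p hp
    rw [p.as_sum_support]
    refine Subalgebra.sum_mem _ fun e _ => (lineSections hP s).monomial_mem_adjoin hn hn4 h ?_
    have := hp e
    rw [floorMul_divisor hP] at this
    exact this

theorem exists_initialMonomials_eq (hn : 2 ≤ n) (hn4 : n ≤ 4) (h : IsStableSystem α d c) :
    ∃ S : Set (Fin N →₀ ℕ), ∀ (k : Type u) [Field k] (P : Fin n → OnePoint k),
      Function.Injective P → ∀ s : Fin n → kˣ, initialMonomials (relationIdeal P s d c) = S := by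
  choose t ht using fun m => exists_mem_V_sup_W_iff.{u} hn hn4 h m ∅
  refine ⟨{m | t m}, fun k _ P hP s => Set.ext fun m => ?_⟩
  have := ht m k (RatFunc k) (lineSections hP s)
  rw [SectionSystem.V_empty, bot_sup_eq] at this
  exact ((lineSections hP s).mem_initialMonomials_ker m).trans this

theorem exists_initial_finset (hn : 2 ≤ n) (hn4 : n ≤ 4) (h : IsStableSystem α d c) :
    ∃ L : Finset (Fin N →₀ ℕ), ∀ (k : Type u) [Field k] (P : Fin n → OnePoint k),
      Function.Injective P → ∀ s : Fin n → kˣ, ∃ G : Set (MvPolynomial (Fin N) k),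
        IsGroebnerBasis (relationIdeal P s d c) G ∧
        initialTerm '' G = (fun m => MvPolynomial.monomial m (1 : k)) '' (L : Set _) := by
  obtain ⟨S, hS⟩ := exists_initialMonomials_eq.{u} hn hn4 h
  refine ⟨(finite_minimal S).toFinset, fun k _ P hP s => ?_⟩
  rw [Set.Finite.coe_toFinset, ← hS k P hP s]
  exact exists_isGroebnerBasis h.pos
    (lineSections hP s).weightedHomogeneousComponent_mem_ker

end Main

/-! ### Existence of stable systems -/

section Existence

variable {n : ℕ} (α : Fin n → ℚ)

/-- The recipe applies in every degree: since `n ≤ 4`, the simplified family always has one of the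
shapes listed in `NewOrders`. -/
theorem exists_newOrders (hn : 2 ≤ n) (hn4 : n ≤ 4) (e : ℕ) :
    ∃ (F : Finset (Finset (Fin n))) (j : Fin n) (M : Set ℤ),
      IsReduction (floorDeg α e) (pregenFamily α e) F ∧ NewOrders (floorDeg α e) F j M ∧
      M ⊆ Set.Icc 0 (floorDeg α e) := by
  obtain ⟨F, hF⟩ := exists_isReduction (floorDeg α e) (pregenFamily α e)
  have hcard := hF.card_le (pregenFamily_card_le α e)
  rcases irreducible_cases hn4 hF.2 hcard with rfl | ⟨A, rfl⟩ | ⟨A, B, rfl, hr, hA, hB, hAB⟩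
  · exact ⟨_, ⟨0, by omega⟩, _, hF, NewOrders.none _, subset_rfl⟩
  · rcases A.eq_empty_or_nonempty with rfl | ⟨j, hj⟩
    · exact ⟨_, ⟨0, by omega⟩, _, hF, NewOrders.all _, Set.empty_subset _⟩
    · refine ⟨_, j, _, hF, NewOrders.one A j hj, ?_⟩
      have := hcard A (Finset.mem_singleton_self A)
      rw [Set.insert_subset_iff]
      exact ⟨⟨le_rfl, by omega⟩, Set.Icc_subset_Icc_left (by omega)⟩
  · obtain ⟨j, hj⟩ : A.Nonempty := Finset.card_pos.1 (by omega)
    refine ⟨_, j, _, hF, NewOrders.two A B j (by omega) hj ?_, Set.Icc_subset_Icc_left (by omega)⟩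
    rw [hAB, Finset.mem_compl, not_not]
    exact hj

variable {α}

theorem IsReduction.empty_mem {r : ℤ} {F F' : Finset (Finset (Fin n))} (h : IsReduction r F F')
    (hF : ∅ ∈ F) : ∅ ∈ F' := by
  obtain ⟨h, -⟩ := h
  induction h with
  | refl => exact hF
  | tail _ h ih =>
    obtain ⟨A, B, -, -, -, -⟩ := h
    rw [Finset.mem_insert]
    by_cases hA : A = ∅
    · left; rw [hA, Finset.empty_inter]
    · by_cases hB : B = ∅
      · left; rw [hB, Finset.inter_empty]
      · exact Or.inr (Finset.mem_erase.2 ⟨Ne.symm hB, Finset.mem_erase.2 ⟨Ne.symm hA, ih⟩⟩)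

/-- No new generators are needed in degree `e` if there are no sections, or if `S_e` is a product
`S_c S_{e-c}`. -/
theorem NewOrders.eq_empty {e : ℕ} {F : Finset (Finset (Fin n))} {j : Fin n} {M : Set ℤ}
    (he : floorDeg α e < 0 ∨ ∅ ∈ pregenFamily α e)
    (hF : IsReduction (floorDeg α e) (pregenFamily α e) F)
    (hM : NewOrders (floorDeg α e) F j M) : M = ∅ := by
  have hcard := hF.card_le (pregenFamily_card_le α e)
  have hmem : 0 ≤ floorDeg α e → ∅ ∈ F := fun h => hF.empty_mem (he.resolve_left (not_lt.2 h))
  have hirr := hF.2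
  generalize floorDeg α e = r at *
  cases hM with
  | none =>
    rw [Set.Icc_eq_empty]
    exact fun h => absurd (hmem h) (Finset.notMem_empty _)
  | all => rfl
  | one A _ hj =>
    have h1 := hcard A (Finset.mem_singleton_self A)
    have h2 := Finset.mem_singleton.1 (hmem (by omega))
    rw [← h2] at hj
    exact absurd hj (Finset.notMem_empty _)
  | two A B _ hB hjA hjB =>
    exfalso
    have hA : A ≠ ∅ := by rintro rfl; exact Finset.notMem_empty _ hjA
    rcases Finset.mem_insert.1 (hmem (by omega)) with h | h
    · exact hA h.symm
    · rw [Finset.mem_singleton] at h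
      have h1 := hcard A (Finset.mem_insert_self _ _)
      refine hirr _ (MergeStep.merge _ A B (Finset.mem_insert_self _ _)
        (Finset.mem_insert_of_mem (Finset.mem_singleton_self _)) (h ▸ hA) ?_)
      rw [← h, Finset.union_empty]
      omega

/-- In large degrees `e` there are no sections, or `S_e` is the product of `S_{e-q}` and `S_q`,
where `q` is a common denominator of the coefficients `αᵢ`. -/
theorem exists_forall_ge_empty_mem (α : Fin n → ℚ) :
    ∃ E : ℕ, ∀ e, E ≤ e → floorDeg α e < 0 ∨ ∅ ∈ pregenFamily α e := by
  obtain ⟨q, hq, a, ha⟩ : ∃ q : ℕ, 1 ≤ q ∧ ∃ a : Fin n → ℤ, ∀ i, (q : ℚ) * α i = a i := by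
    refine ⟨∏ i, (α i).den, Finset.prod_pos fun i _ => (α i).den_pos,
      fun i => (∏ l ∈ Finset.univ.erase i, ((α l).den : ℤ)) * (α i).num, fun i => ?_⟩
    rw [← Finset.mul_prod_erase _ _ (Finset.mem_univ i)]
    push_cast
    rw [mul_comm ((α i).den : ℚ), mul_assoc, Rat.den_mul_eq_num]
  have hq' : (0 : ℚ) < q := by exact_mod_cast hq
  have hflq : fl α q = a := funext fun i => by rw [fl, ha, Int.floor_intCast]
  have hadd : ∀ f, fl α (q + f) = fl α q + fl α f := fun f => funext fun i => by
    rw [hflq, Pi.add_apply, fl, fl, Nat.cast_add, add_mul, ha, Int.floor_intCast_add]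
  have hdeg : ∀ f, floorDeg α (q + f) = floorDeg α q + floorDeg α f := fun f => by
    rw [← sum_fl, ← sum_fl, ← sum_fl, hadd]
    exact Finset.sum_add_distrib
  have hδ : (floorDeg α q : ℚ) = q * ∑ i, α i := by
    rw [← sum_fl, hflq, Finset.mul_sum]
    push_cast
    exact Finset.sum_congr rfl fun i _ => (ha i).symm
  have hup : ∀ f : ℕ, (floorDeg α f : ℚ) ≤ f * ∑ i, α i := fun f => by
    rw [floorDeg, Finset.mul_sum]
    push_cast
    exact Finset.sum_le_sum fun i _ => Int.floor_le _
  have hlow : ∀ f : ℕ, f * ∑ i, α i - n ≤ (floorDeg α f : ℚ) := fun f => by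
    have : ∑ i, ((f : ℚ) * α i - 1) ≤ ∑ i, ((⌊(f : ℚ) * α i⌋ : ℤ) : ℚ) :=
      Finset.sum_le_sum fun i _ => (Int.sub_one_lt_floor _).le
    rw [Finset.sum_sub_distrib, ← Finset.mul_sum] at this
    rw [floorDeg]
    push_cast
    simpa using this
  refine ⟨(n + 2) * q, fun e he => ?_⟩
  by_cases hr : floorDeg α e < 0
  · exact Or.inl hr
  right
  rw [not_lt] at hr
  have he2 : 2 * q + n * q ≤ e := by linarith
  have hnq : 0 ≤ n * q := Nat.zero_le _
  obtain ⟨f, rfl⟩ := Nat.exists_eq_add_of_le (show q ≤ e by omega)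
  have hD : 0 ≤ ∑ i, α i := by
    by_contra hneg
    have h1 := hup (q + f)
    have h2 : (0 : ℚ) ≤ floorDeg α (q + f) := by exact_mod_cast hr
    have h3 : ((q + f : ℕ) : ℚ) * ∑ i, α i < 0 :=
      mul_neg_of_pos_of_neg (by push_cast; positivity) (not_le.1 hneg)
    linarith
  have hδ0 : 0 ≤ floorDeg α q := by
    have : (0 : ℚ) ≤ floorDeg α q := by rw [hδ]; positivity
    exact_mod_cast this
  have hf : 0 ≤ floorDeg α f := by
    rcases hδ0.eq_or_lt with h0 | hpos
    · have := hdeg f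
      omega
    · have h1 : (1 : ℚ) ≤ q * ∑ i, α i := by rw [← hδ]; exact_mod_cast hpos
      have h2 : ((n * q : ℕ) : ℚ) * ∑ i, α i ≤ f * ∑ i, α i :=
        mul_le_mul_of_nonneg_right (by exact_mod_cast (show n * q ≤ f by omega)) hD
      have h3 : (n : ℚ) * 1 ≤ n * (q * ∑ i, α i) := mul_le_mul_of_nonneg_left h1 (by positivity)
      push_cast at h2
      have h4 : (0 : ℚ) ≤ floorDeg α f := by linarith [hlow f]
      exact_mod_cast h4
  refine Finset.mem_image.2 ⟨q, Finset.mem_filter.2 ⟨Finset.mem_Icc.2 ⟨hq, by omega⟩, hδ0, ?_⟩, ?_⟩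
  · rwa [Nat.add_sub_cancel_left]
  · rw [dropSet, Finset.filter_eq_empty_iff]
    intro i _
    rw [not_not, Nat.add_sub_cancel_left]
    exact (congrFun (hadd f) i).symm

/-- A section of the form `∏ tᵢ^{cᵢ}` with prescribed order `m` at `P_j`. -/
theorem exists_exponent (hn : 2 ≤ n) (q : Fin n → ℤ) (j : Fin n) {m : ℤ} (h0 : 0 ≤ m)
    (hm : m ≤ ∑ i, q i) : ∃ c : Fin n → ℤ, ∑ i, c i = 0 ∧ (∀ i, 0 ≤ c i + q i) ∧ c j + q j = m := by
  have : Nontrivial (Fin n) := Fin.nontrivial_iff_two_le.2 hn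
  obtain ⟨i, hi⟩ := exists_ne j
  refine ⟨Pi.single j m + Pi.single i (∑ l, q l - m) - q, ?_, fun l => ?_, ?_⟩
  · simp [Finset.sum_sub_distrib, Finset.sum_add_distrib]
  · have h1 : 0 ≤ (Pi.single j m : Fin n → ℤ) := Pi.single_nonneg.2 h0
    have h2 : 0 ≤ (Pi.single i (∑ l, q l - m) : Fin n → ℤ) := Pi.single_nonneg.2 (by omega)
    have h1 := h1 l
    have h2 := h2 l
    simp only [Pi.zero_apply, Pi.sub_apply, Pi.add_apply] at h1 h2 ⊢
    omega
  · simp [hi.symm]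

theorem exists_isStableSystem (hn : 2 ≤ n) (hn4 : n ≤ 4) (α : Fin n → ℚ) :
    ∃ (N : ℕ) (d : Fin N → ℕ) (c : Fin N → Fin n → ℤ), IsStableSystem α d c := by
  choose F j M hF hNO hM using exists_newOrders α hn hn4
  obtain ⟨E, hE⟩ := exists_forall_ge_empty_mem α
  -- pairs of a degree and an order of vanishing, by increasing degree and decreasing order
  set S : Set (ℕ ×ₗ ℤᵒᵈ) := {p | 1 ≤ (ofLex p).1 ∧ OrderDual.ofDual (ofLex p).2 ∈ M (ofLex p).1}
    with hS
  have hfin : S.Finite := by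
    refine ((Set.finite_Iio E).biUnion fun e _ => (Set.finite_Icc 0 (floorDeg α e)).image
      fun m => toLex (e, OrderDual.toDual m)).subset ?_
    intro p hp
    rw [Set.mem_iUnion₂]
    refine ⟨(ofLex p).1, ?_, OrderDual.ofDual (ofLex p).2, hM _ hp.2, rfl⟩
    by_contra hlt
    have := (hNO (ofLex p).1).eq_empty (hE _ (not_lt.1 hlt)) (hF _)
    have hp2 := hp.2
    rw [this] at hp2
    exact hp2
  set φ := hfin.toFinset.orderEmbOfFin rfl with hφ
  have hmem : ∀ a, φ a ∈ S := fun a => hfin.mem_toFinset.1 (Finset.orderEmbOfFin_mem _ _ a)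
  have hsurj : ∀ p ∈ S, ∃ a, φ a = p := fun p hp => by
    have := Finset.range_orderEmbOfFin hfin.toFinset rfl
    rw [Set.Finite.coe_toFinset] at this
    rw [← this] at hp
    exact hp
  have hex : ∀ a, ∃ c : Fin n → ℤ, ∑ i, c i = 0 ∧ (∀ i, 0 ≤ c i + fl α (ofLex (φ a)).1 i) ∧
      c (j (ofLex (φ a)).1) + fl α (ofLex (φ a)).1 (j (ofLex (φ a)).1) =
        OrderDual.ofDual (ofLex (φ a)).2 := fun a =>
    exists_exponent hn _ _ (hM _ (hmem a).2).1 (hM _ (hmem a).2).2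
  choose c hc0 hcn hcj using hex
  refine ⟨_, fun a => (ofLex (φ a)).1, c, fun a => (hmem a).1, ?_, hc0, hcn, ?_⟩
  · intro a b hab
    rcases (Prod.Lex.le_iff).1 (φ.monotone hab) with h | h
    · exact h.le
    · exact h.1.le
  · intro e he
    refine ⟨F e, j e, M e, hF e, hNO e, ?_, ?_⟩
    · rintro a b ha rfl hab
      have hb := hcj b
      have ha' := hcj a
      rw [ha] at ha'
      change c b _ + fl α _ _ < c a _ + fl α _ _
      rw [ha', hb]
      rcases (Prod.Lex.lt_iff).1 (φ.strictMono hab) with h | h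
      · exact absurd h (by rw [ha]; exact lt_irrefl _)
      · exact h.2
    · ext m
      constructor
      · rintro ⟨a, rfl, rfl⟩
        have := (hmem a).2
        rwa [← hcj a] at this
      · intro hm
        obtain ⟨a, ha⟩ := hsurj (toLex (e, OrderDual.toDual m)) ⟨he, hm⟩
        refine ⟨a, by rw [ha]; rfl, ?_⟩
        have := hcj a
        rw [ha] at this
        exact this

end Existence

end QDiv

end

theorem theorem6 (n : ℕ) (hn2 : 2 ≤ n) (hn4 : n ≤ 4) (α : Fin n → ℚ) :
    (∃ (N : ℕ) (d : Fin N → ℕ) (c : Fin N → Fin n → ℤ), QDiv.IsStableSystem α d c) ∧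
    ∀ (N : ℕ) (d : Fin N → ℕ) (c : Fin N → Fin n → ℤ), QDiv.IsStableSystem α d c →
      (∀ (k : Type u) [Field k] (P : Fin n → OnePoint k), Function.Injective P →
        ∀ s : Fin n → kˣ,
          QDiv.IsMinimalGenerating (QDiv.canonicalRing (QDiv.divisor α P))
            (fun a => QDiv.monomialElt P s (d a) (c a))) ∧
      ∃ L : Finset (Fin N →₀ ℕ),
        ∀ (k : Type u) [Field k] (P : Fin n → OnePoint k), Function.Injective P →
          ∀ s : Fin n → kˣ,
            ∃ G : Set (MvPolynomial (Fin N) k),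
              QDiv.IsGroebnerBasis (QDiv.relationIdeal P s d c) G ∧
              QDiv.initialTerm '' G = (fun m => MvPolynomial.monomial m (1 : k)) '' (L : Set _) := by
  refine ⟨QDiv.exists_isStableSystem hn2 hn4 α, fun N d c h => ⟨?_, ?_⟩⟩
  · intro k _ P hP s
    exact QDiv.isMinimalGenerating hn2 hn4 h hP s
  · exact QDiv.exists_initial_finset hn2 hn4 h
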